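/- Let $\mathfrak e,\mathfrak a$ (resp. $\mathfrak b,\mathfrak b'$) be $2$-dimensional complex vector spaces with a non-degenerate symmetric (resp. anti-symmetric) bilinear form, each polarized as $\mathfrak u=\mathbb C u^+\oplus\mathbb C u^-$ with isotropic summands and $\langle u^-,u^+\rangle=1$. Let $A(\mathfrak e),A(\mathfrak a)$ be the Clifford module super vertex operator algebras, let $\underline A(\mathfrak b),\underline A(\mathfrak b')$ be the Weyl module super vertex operator algebras, and let $A(\mathfrak e)_{\rm tw},\dots$ be their canonically twisted modules. Here $A(\mathfrak u)$ (resp. $A(\mathfrak u)_{\rm tw}$) is induced, over the Clifford or Weyl algebra spanned by modes $u^\pm(r)$ with $r\in\mathbb Z+\tfrac12$ (resp. $r\in\mathbb Z$) and $\langle u(r),u'(r')\rangle=\langle u,u'\rangle\delta_{r+r',0}$, from a vector $\mathbf v$ (resp. $\mathbf v_{\rm tw}$) killed by $u^\pm(r)$ for $r>0$ and by $u^+(0)$, and $Y(u^\pm(-\tfrac12)\mathbf v,z)=\sum_r u^\pm(r)z^{-r-1/2}$, likewise for $Y_{\rm tw}$. Put $\jmath=u^+(-\tfrac12)u^-(-\tfrac12)\mathbf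 v$ and $\omega=\tfrac12\big(u^+(-\tfrac32)u^-(-\tfrac12)-u^+(-\tfrac12)u^-(-\tfrac32)\big)\mathbf v$. Set $$W^{(13)}=A(\mathfrak e)\otimes A(\mathfrak a)\otimes\underline A(\mathfrak b)\otimes\underline A(\mathfrak b'),\qquad W^{(13)}_{\rm tw}=A(\mathfrak e)_{\rm tw}\otimes A(\mathfrak a)_{\rm tw}\otimes\underline A(\mathfrak b)_{\rm tw}\otimes\underline A(\mathfrak b')_{\rm tw},$$ with the tensor product Virasoro element $\omega^{(13)}$, with $\jmath_{\mathfrak e}=\jmath\otimes\mathbf v\otimes\mathbf v\otimes\mathbf v$ and $$\jmath^{(13)}=6\,\mathbf v\otimes\jmath\otimes\mathbf v\otimes\mathbf v+\mathbf v\otimes\mathbf v\otimes\jmath\otimes\mathbf v+3\,\mathbf v\otimes\mathbf v\otimes\mathbf v\otimes\jmath .$$ Let $J_{\mathfrak e}(0)$ and $J(0)$ be the coefficients of $z^{-1}$ in $Y_{\rm tw}(\jmath_{\mathfrak e},z)$ and $Y_{\rm tw}(\jmath^{(13)},z)$, and $L(0)$ the coefficient of $z^{-2}$ in $Y_{\rm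 tw}(\omega^{(13)},z)$. A scalar $c\in GL(\mathfrak u^+)=\mathbb C^\times$ acts by $u^+(r)\mapsto c\,u^+(r)$, $u^-(r)\mapsto c^{-1}u^-(r)$, fixing the vacuum. Set $(-1)^F=(-I)\otimes(-I)\otimes I\otimes I$. Let $G=G^{(13)}$ be cyclic of order $4$, acting on $W^{(13)}_{\rm tw}$ by mapping a chosen generator to $I\otimes(-I)\otimes(iI)\otimes(iI)\in GL(\mathfrak e^+)\otimes GL(\mathfrak a^+)\otimes GL(\mathfrak b^+)\otimes GL(\mathfrak b'^+)$. Then $W^{(13)}_{\rm tw}$ is the direct sum of the simultaneous eigenspaces $\{J(0)=m,\ L(0)=n\}$, $m\in\mathbb Z$, $n\in\mathbb Z_{\ge0}$; these are finite-dimensional, for each $n$ they vanish for all large $m$, and they are preserved by $(g+g^{-1})J_{\mathfrak e}(0)(-1)^F$ for all $g\in G$. For every $g\in G$ the series $$\widetilde\psi_g=-\operatorname{tr}\!\big((g+g^{-1})J_{\mathfrak e}(0)(-1)^Fy^{J(0)}q^{L(0)}\,\big|\,W^{(13)}_{\rm tw}\big)\in\mathbb C[y][[y^{-1}]][[q]]$$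 is the expansion of $\psi_g^{(13)}$ in the domain $0<-\operatorname{Im}z<\operatorname{Im}\tau$: with $q=e^{2\pi i\tau}$, $y=e^{2\pi iz}$ it converges absolutely there to the value at $z$ of the meromorphic function $\psi^{(13)}_g(\tau,\cdot)$ (removable singularities removed). Here $\psi^{(13)}_g$ is $\psi_{1A}$, $\psi_{2A}$ or $\psi_{4AB}$ according as $g$ has order $1$, $2$ or $4$, where $$\psi_{1A}=2i\frac{\eta(\tau)^3\theta_1(\tau,6z)}{\theta_1(\tau,z)\theta_1(\tau,3z)},\qquad \psi_{2A}=-2i\frac{\eta(\tau)^3\theta_1(\tau,6z)}{\theta_2(\tau,z)\theta_2(\tau,3z)},$$ $$\psi_{4AB}=-i\frac{\eta(2\tau)^2\theta_2(\tau,6z)}{\eta(\tau)\theta_2(2\tau,2z)\theta_2(2\tau,6z)}\Big(\theta_1(\tau,z+\tfrac14)\theta_1(\tau,3z+\tfrac14)-\theta_1(\tau,z-\tfrac14)\theta_1(\tau,3z-\tfrac14)\Big),$$ $\eta(\tau)=q^{1/24}\prod_{n>0}(1-q^n)$, $\theta_1(\tau,z)=-iq^{1/8}y^{1/2}\prod_{n>0}(1-y^{-1}q^{n-1})(1-yq^n)(1-q^n)$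 and $\theta_2(\tau,z)=q^{1/8}y^{1/2}\prod_{n>0}(1+y^{-1}q^{n-1})(1+yq^n)(1-q^n)$. -/

import Mathlib

noncomputable section

namespace Umbral13

open Complex TensorProduct Filter Topology

/-! ## Clifford and Weyl modules -/

/-- The two kinds of free fields: Clifford (symmetric form) and Weyl (anti-symmetric form). -/
inductive Kind
  | clifford
  | weyl

/-- The two sectors: modes in `ℤ + 1/2` (untwisted), or in `ℤ` (canonically twisted). -/
inductive Sector
  | untwisted
  | twisted

/-- The sign `s` in the defining relations `x y = s y x + ⟨x, y⟩`. -/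
def Kind.sgn : Kind → ℂ
  | .clifford => -1
  | .weyl => 1

/-- The form on the 2-dimensional space with polarized basis `u⁺` (`true`), `u⁻` (`false`).
It is symmetric in the Clifford case and anti-symmetric in the Weyl case, the two lines
are isotropic, and `⟨u⁻, u⁺⟩ = 1`. -/
def Kind.form : Kind → Bool → Bool → ℂ
  | .clifford, false, true => 1
  | .clifford, true, false => 1
  | .weyl, false, true => 1
  | .weyl, true, false => -1
  | _, _, _ => 0

/-- A letter `(ε, n)` stands for the mode `u^ε(n + κ)`, where `κ` is `Sector.shift`. -/
abbrev Letter := Bool × ℤ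

def Sector.shift : Sector → ℚ
  | .untwisted => 1 / 2
  | .twisted => 0

/-- The index `r = n + κ` of the mode `u^ε(r)`. -/
def Letter.index (s : Sector) (x : Letter) : ℚ := x.2 + s.shift

/-- The extended form `⟨u(r), u'(r')⟩ = ⟨u, u'⟩ δ_{r + r', 0}`. -/
def pairing (k : Kind) (s : Sector) (x y : Letter) : ℂ :=
  if Letter.index s x + Letter.index s y = 0 then k.form x.1 y.1 else 0

/-- Defining relations of the Clifford algebra (`x y + y x = ⟨x, y⟩`), respectively the
Weyl algebra (`x y - y x = ⟨x, y⟩`), of the space spanned by the modes. -/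
inductive ModeRel (k : Kind) (s : Sector) :
    FreeAlgebra ℂ Letter → FreeAlgebra ℂ Letter → Prop
  | comm (x y : Letter) : ModeRel k s
      (FreeAlgebra.ι ℂ x * FreeAlgebra.ι ℂ y)
      (k.sgn • (FreeAlgebra.ι ℂ y * FreeAlgebra.ι ℂ x) + algebraMap ℂ _ (pairing k s x y))

/-- The Clifford or Weyl algebra of the space of modes. -/
abbrev ModeAlg (k : Kind) (s : Sector) := RingQuot (ModeRel k s)

def mode (k : Kind) (s : Sector) (x : Letter) : ModeAlg k s :=
  RingQuot.mkAlgHom ℂ (ModeRel k s) (FreeAlgebra.ι ℂ x)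

/-- The modes that annihilate the vacuum: `u(r)` for `r > 0`, and `u⁺(0)`. -/
def IsAnnihilator (s : Sector) (x : Letter) : Prop :=
  0 < Letter.index s x ∨ (Letter.index s x = 0 ∧ x.1 = true)

/-- The left ideal generated by the annihilating modes. -/
def annIdeal (k : Kind) (s : Sector) : Submodule (ModeAlg k s) (ModeAlg k s) :=
  Submodule.span (ModeAlg k s) (mode k s '' {x | IsAnnihilator s x})

/-- The module induced from the trivial module of the annihilating modes: the underlying space
of the Clifford or Weyl module super vertex algebra, or of its canonically twisted module. -/
abbrev Fock (k : Kind) (s : Sector) := ModeAlg k s ⧸ annIdeal k s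

def vac (k : Kind) (s : Sector) : Fock k s := (annIdeal k s).mkQ 1

/-- The mode `x` as an operator on the module. -/
def modeOp (k : Kind) (s : Sector) (x : Letter) : Module.End ℂ (Fock k s) :=
  Algebra.lsmul ℂ ℂ (Fock k s) (mode k s x)

/-- The scalar by which `c ∈ GL(𝔞⁺) = ℂˣ` acts on `u^ε`: `c` on `u⁺`, and `c⁻¹` on `u⁻`. -/
def letterScalar (c : ℂˣ) (x : Letter) : ℂ := if x.1 then (c : ℂ) else ((c⁻¹ : ℂˣ) : ℂ)

/-- The automorphism of the mode algebra induced by `c ∈ GL(𝔞⁺)`. -/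
def scaleAlg (k : Kind) (s : Sector) (c : ℂˣ) : ModeAlg k s →ₐ[ℂ] ModeAlg k s :=
  RingQuot.liftAlgHom ℂ
    ⟨FreeAlgebra.lift ℂ (fun x => letterScalar c x • mode k s x), by
      rintro _ _ ⟨x, y⟩
      have h := RingQuot.mkAlgHom_rel ℂ (ModeRel.comm (k := k) (s := s) x y)
      simp only [map_mul, map_add, map_smul, AlgHom.commutes] at h
      simp only [map_mul, map_add, map_smul, AlgHom.commutes, FreeAlgebra.lift_ι_apply,
        smul_mul_smul_comm]
      change mode k s x * mode k s y = k.sgn • (mode k s y * mode k s x) + _ at h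
      rw [h, smul_add, smul_comm, mul_comm (letterScalar c y)]
      congr 1
      have hp : letterScalar c x * letterScalar c y * pairing k s x y = pairing k s x y := by
        rcases x with ⟨_ | _, n⟩ <;> rcases y with ⟨_ | _, m⟩ <;> rcases k with _ | _ <;>
          simp [letterScalar, pairing, Kind.form]
      rw [Algebra.smul_def, ← map_mul, hp]⟩

theorem scaleAlg_mode (k : Kind) (s : Sector) (c : ℂˣ) (x : Letter) :
    scaleAlg k s c (mode k s x) = letterScalar c x • mode k s x := by
  simp [scaleAlg, mode]

theorem scaleAlg_mem (k : Kind) (s : Sector) (c : ℂˣ) :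
    (annIdeal k s).restrictScalars ℂ ≤
      ((annIdeal k s).restrictScalars ℂ).comap (scaleAlg k s c).toLinearMap := by
  intro a (ha : a ∈ Submodule.span (ModeAlg k s) (mode k s '' {x | IsAnnihilator s x}))
  change scaleAlg k s c a ∈ annIdeal k s
  induction ha using Submodule.span_induction with
  | mem a h =>
    obtain ⟨x, hx, rfl⟩ := h
    rw [scaleAlg_mode, Algebra.smul_def]
    exact (annIdeal k s).smul_mem _ (Submodule.subset_span ⟨x, hx, rfl⟩)
  | zero => simp
  | add a b ha hb iha ihb =>
    rw [map_add]
    exact add_mem iha ihb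
  | smul r a ha ih =>
    rw [smul_eq_mul, map_mul]
    exact (annIdeal k s).smul_mem _ ih

/-- The action of `c ∈ GL(𝔞⁺) = ℂˣ` on the module:
`u₁(r₁) ⋯ uₗ(rₗ) v ↦ (c u₁)(r₁) ⋯ (c uₗ)(rₗ) v`. -/
def scaleOp (k : Kind) (s : Sector) (c : ℂˣ) : Module.End ℂ (Fock k s) :=
  ((annIdeal k s).restrictScalars ℂ).liftQ
    (((annIdeal k s).mkQ.restrictScalars ℂ).comp (scaleAlg k s c).toLinearMap) (by
      intro a ha
      have h := scaleAlg_mem k s c ha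
      simpa using h)

/-! ## Vertex operators

A field on `M` is written `∑ₘ f m z^(-m-1)`, with `m` running over `ℚ`; only exponents in
`½ ℤ` occur. -/

/-- The sum of a family of operators that is finite on each vector. -/
def locSum {ι M : Type*} [AddCommGroup M] [Module ℂ M] (f : ι → Module.End ℂ M) :
    Module.End ℂ M := by
  classical
  exact if h : ∀ v, (Function.support fun i => f i v).Finite then
    { toFun := fun v => ∑ᶠ i, f i v
      map_add' := fun v w => by
        simp only [map_add]
        exact finsum_add_distrib (h v) (h w)
      map_smul' := fun c v => by
        simp only [map_smul, RingHom.id_apply]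
        exact (smul_finsum' c (h v)).symm }
  else 0

/-- The `n`-th product of the generating field `u^ε(z) = ∑ᵣ u^ε(r) z^(-r-1/2)` with the field `f`
of a state `w` that is a product of `l` modes: the field of `u^ε₍ₙ₎ w`. By the (twisted) Borcherds
identity the product `u^ε₍ₙ₎ f` is
`∑ᵢ C(-p, i) z^(-p-i) Res_x x^p ((x-z)^(n+i) u(x) f(z) - (±1) (-z+x)^(n+i) f(z) u(x))`
where `p = κ - 1/2`, so that `x^p u(x)` has integral exponents, and the sign `±1` is that of the
super commutator. In the untwisted sector `p = 0`, and only `i = 0` contributes. -/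
def nthProd (k : Kind) (s : Sector) (ε : Bool) (n : ℤ) (l : ℕ)
    (f : ℚ → Module.End ℂ (Fock k s)) : ℚ → Module.End ℂ (Fock k s) := fun m =>
  let p : ℚ := s.shift - 1 / 2
  locSum fun i : ℕ => ((Ring.choose (-p) i : ℚ) : ℂ) • locSum fun j : ℕ =>
    (((-1) ^ j * Ring.choose (n + i) j : ℤ) : ℂ) •
      (modeOp k s (ε, n + i - j) * f (m - i - p + j)
        - ((-1 : ℂ) ^ (n + i) * k.sgn ^ l) • (f (n + m - p - j) * modeOp k s (ε, j)))

/-- The vertex operator, on the module in sector `s`, of the state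
`u^{ε₁}(n₁+½) ⋯ u^{εₗ}(nₗ+½) v = u^{ε₁}₍ₙ₁₎ ⋯ u^{εₗ}₍ₙₗ₎ v` of the untwisted module.
The vacuum has the identity as its vertex operator. -/
def wordField (k : Kind) (s : Sector) : List Letter → ℚ → Module.End ℂ (Fock k s)
  | [] => fun m => if m = -1 then 1 else 0
  | x :: w => nthProd k s x.1 x.2 w.length (wordField k s w)

/-- The state `u^{ε₁}(n₁+½) ⋯ u^{εₗ}(nₗ+½) v` of the untwisted module. -/
def wordState (k : Kind) (w : List Letter) : Fock k .untwisted :=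
  (w.map (modeOp k .untwisted)).prod (vac k .untwisted)

/-- The order used for monomials; a mode may be repeated in the Weyl case only. -/
def Kind.precedes (k : Kind) (x y : Letter) : Prop :=
  (x.1 = true ∧ y.1 = false) ∨ (x.1 = y.1 ∧ x.2 < y.2) ∨
    (match k with
      | .clifford => False
      | .weyl => x = y)

/-- Ordered monomials in the creating modes. Their states form a basis of the untwisted module
(Poincaré–Birkhoff–Witt). -/
def IsOrdered (k : Kind) (w : List Letter) : Prop :=
  (∀ x ∈ w, ¬ IsAnnihilator .untwisted x) ∧ w.Pairwise k.precedes

/-- The element `ȷ = u⁺(-½) u⁻(-½) v`. -/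
def jState (k : Kind) : Fock k .untwisted := wordState k [(true, -1), (false, -1)]

/-- The Virasoro element `ω = ½ (u⁺(-3/2) u⁻(-1/2) - u⁺(-1/2) u⁻(-3/2)) v`. -/
def omegaState (k : Kind) : Fock k .untwisted :=
  (1 / 2 : ℂ) • (wordState k [(true, -2), (false, -1)] - wordState k [(true, -1), (false, -2)])

/-! ## The tensor product -/

/-- `A(𝔢) ⊗ A(𝔞) ⊗ A̲(𝔟) ⊗ A̲(𝔟')`, or the tensor product of the twisted modules. -/
abbrev W (s : Sector) :=
  Fock .clifford s ⊗[ℂ] (Fock .clifford s ⊗[ℂ] (Fock .weyl s ⊗[ℂ] Fock .weyl s))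

/-- The tensor product of four operators. -/
def tensorOp {s : Sector} (f₁ f₂ : Module.End ℂ (Fock .clifford s))
    (f₃ f₄ : Module.End ℂ (Fock .weyl s)) : Module.End ℂ (W s) :=
  TensorProduct.map f₁ (TensorProduct.map f₂ (TensorProduct.map f₃ f₄))

/-- A quadruple of words, one for each tensor factor. -/
abbrev Quad := List Letter × List Letter × List Letter × List Letter

def Quad.state (w : Quad) : W .untwisted :=
  wordState .clifford w.1 ⊗ₜ[ℂ] (wordState .clifford w.2.1 ⊗ₜ[ℂ]
    (wordState .weyl w.2.2.1 ⊗ₜ[ℂ] wordState .weyl w.2.2.2))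

def Quad.IsOrdered (w : Quad) : Prop :=
  Umbral13.IsOrdered .clifford w.1 ∧ Umbral13.IsOrdered .clifford w.2.1 ∧
    Umbral13.IsOrdered .weyl w.2.2.1 ∧ Umbral13.IsOrdered .weyl w.2.2.2

/-- The vertex operator of `w₁ ⊗ w₂ ⊗ w₃ ⊗ w₄` is the tensor product of those of the `wᵢ`, with
the Koszul sign `(-1)^{|w₂||m₁|}` on `m₁ ⊗ m₂ ⊗ m₃ ⊗ m₄` (the Weyl factors are even). -/
def Quad.field (s : Sector) (w : Quad) (m : ℚ) : Module.End ℂ (W s) :=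
  locSum fun r : ℚ × ℚ × ℚ => tensorOp
    (wordField .clifford s w.1 r.1 * scaleOp .clifford s (-1) ^ w.2.1.length)
    (wordField .clifford s w.2.1 r.2.1)
    (wordField .weyl s w.2.2.1 r.2.2)
    (wordField .weyl s w.2.2.2 (m - 3 - r.1 - r.2.1 - r.2.2))

/-- The expression of a state as a linear combination of ordered monomials. -/
def expand (u : W .untwisted) : Quad →₀ ℂ :=
  Function.invFunOn (Finsupp.linearCombination ℂ Quad.state)
    {c : Quad →₀ ℂ | ∀ w ∈ c.support, w.IsOrdered} u

/-- The vertex operators `Y(u, z) = ∑ₘ Y u m z^(-m-1)` on `W .untwisted`, and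
`Y_tw(u, z)` on `W .twisted`, for a state `u` of the tensor product super vertex algebra. -/
def Y (s : Sector) (u : W .untwisted) (m : ℚ) : Module.End ℂ (W s) :=
  (expand u).sum fun w c => c • Quad.field s w m

/-- The pure tensor `u₁ ⊗ u₂ ⊗ u₃ ⊗ u₄`. -/
def pure4 (u₁ u₂ : Fock .clifford .untwisted) (u₃ u₄ : Fock .weyl .untwisted) : W .untwisted :=
  u₁ ⊗ₜ[ℂ] (u₂ ⊗ₜ[ℂ] (u₃ ⊗ₜ[ℂ] u₄))

/-- `ȷ_𝔢 = ȷ ⊗ v ⊗ v ⊗ v`. -/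
def jE : W .untwisted := pure4 (jState _) (vac _ _) (vac _ _) (vac _ _)

/-- `ȷ = 6 v⊗ȷ⊗v⊗v + v⊗v⊗ȷ⊗v + 3 v⊗v⊗v⊗ȷ`. -/
def jTotal : W .untwisted :=
  (6 : ℂ) • pure4 (vac _ _) (jState _) (vac _ _) (vac _ _)
    + pure4 (vac _ _) (vac _ _) (jState _) (vac _ _)
    + (3 : ℂ) • pure4 (vac _ _) (vac _ _) (vac _ _) (jState _)

/-- The Virasoro element of the tensor product. -/
def omegaTotal : W .untwisted :=
  pure4 (omegaState _) (vac _ _) (vac _ _) (vac _ _)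
    + pure4 (vac _ _) (omegaState _) (vac _ _) (vac _ _)
    + pure4 (vac _ _) (vac _ _) (omegaState _) (vac _ _)
    + pure4 (vac _ _) (vac _ _) (vac _ _) (omegaState _)

/-- `J_𝔢(0)`: the coefficient of `z⁻¹` in `Y_tw(ȷ_𝔢, z)`. -/
def JE0 : Module.End ℂ (W .twisted) := Y .twisted jE 0

/-- `J(0)`: the coefficient of `z⁻¹` in `Y_tw(ȷ, z)`. -/
def J0 : Module.End ℂ (W .twisted) := Y .twisted jTotal 0

/-- `L(0)`: the coefficient of `z⁻²` in `Y_tw(ω, z)`. -/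
def L0 : Module.End ℂ (W .twisted) := Y .twisted omegaTotal 1

/-- `GL(𝔢⁺) × GL(𝔞⁺) × GL(𝔟⁺) × GL(𝔟'⁺)`; the four spaces are lines. -/
abbrev Torus := ℂˣ × ℂˣ × ℂˣ × ℂˣ

/-- The action of the torus on the tensor product. -/
def act (s : Sector) (c : Torus) : Module.End ℂ (W s) :=
  tensorOp (scaleOp _ s c.1) (scaleOp _ s c.2.1) (scaleOp _ s c.2.2.1) (scaleOp _ s c.2.2.2)

/-- `(-1)^F = (-I) ⊗ (-I) ⊗ I ⊗ I`. -/
def fermionParity : Module.End ℂ (W .twisted) := act .twisted (-1, -1, 1, 1)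

def iUnit : ℂˣ := Units.mk0 I I_ne_zero

/-- The bigraded piece on which `J(0) = m` and `L(0) = n`. -/
def piece (m : ℤ) (n : ℕ) : Submodule ℂ (W .twisted) :=
  Module.End.eigenspace J0 (m : ℂ) ⊓ Module.End.eigenspace L0 (n : ℂ)

/-- The trace of `T` on an invariant subspace `E`. -/
def traceOn {V : Type*} [AddCommGroup V] [Module ℂ V] (E : Submodule ℂ V)
    (T : Module.End ℂ V) : ℂ := by
  classical
  exact if h : ∀ x ∈ E, T x ∈ E then LinearMap.trace ℂ E (T.restrict h) else 0

/-- The operator `(g + g⁻¹) J_𝔢(0) (-1)^F`, for `g` acting by the scalars `c`. -/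
def twinedOp (c : Torus) : Module.End ℂ (W .twisted) :=
  (act .twisted c + act .twisted c⁻¹) * JE0 * fermionParity

/-- The coefficient of `y^m q^n` in `-tr((g + g⁻¹) J_𝔢(0) (-1)^F y^{J(0)} q^{L(0)})`. -/
def psiTildeCoeff (c : Torus) (m : ℤ) (n : ℕ) : ℂ := - traceOn (piece m n) (twinedOp c)

/-! ## The meromorphic Jacobi forms -/

/-- `θ₁(τ, z) = -i q^{1/8} y^{1/2} ∏_{n>0} (1 - y⁻¹ q^{n-1}) (1 - y q^n) (1 - q^n)`. -/
def theta1 (τ z : ℂ) : ℂ :=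
  -I * cexp (2 * Real.pi * I * τ / 8) * cexp (Real.pi * I * z) *
    ∏' n : ℕ, (1 - cexp (-(2 * Real.pi * I * z)) * cexp (2 * Real.pi * I * τ) ^ n) *
      (1 - cexp (2 * Real.pi * I * z) * cexp (2 * Real.pi * I * τ) ^ (n + 1)) *
      (1 - cexp (2 * Real.pi * I * τ) ^ (n + 1))

/-- `θ₂(τ, z) = q^{1/8} y^{1/2} ∏_{n>0} (1 + y⁻¹ q^{n-1}) (1 + y q^n) (1 - q^n)`. -/
def theta2 (τ z : ℂ) : ℂ :=
  cexp (2 * Real.pi * I * τ / 8) * cexp (Real.pi * I * z) *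
    ∏' n : ℕ, (1 + cexp (-(2 * Real.pi * I * z)) * cexp (2 * Real.pi * I * τ) ^ n) *
      (1 + cexp (2 * Real.pi * I * z) * cexp (2 * Real.pi * I * τ) ^ (n + 1)) *
      (1 - cexp (2 * Real.pi * I * τ) ^ (n + 1))

def psi1A (τ z : ℂ) : ℂ :=
  2 * I * (ModularForm.eta τ ^ 3 * theta1 τ (6 * z)) / (theta1 τ z * theta1 τ (3 * z))

def psi2A (τ z : ℂ) : ℂ :=
  -2 * I * (ModularForm.eta τ ^ 3 * theta1 τ (6 * z)) / (theta2 τ z * theta2 τ (3 * z))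

def psi4AB (τ z : ℂ) : ℂ :=
  -I * (ModularForm.eta (2 * τ) ^ 2 * theta2 τ (6 * z)) /
      (ModularForm.eta τ * theta2 (2 * τ) (2 * z) * theta2 (2 * τ) (6 * z)) *
    (theta1 τ (z + 1 / 4) * theta1 τ (3 * z + 1 / 4)
      - theta1 τ (z - 1 / 4) * theta1 τ (3 * z - 1 / 4))

/-- The formula for `ψ_g`, for `g` in a cyclic group of order 4: class `1A` is the identity, `2A`
the involution, `4AB` the elements of order 4. -/
def psi {G : Type*} [Group G] (g : G) : ℂ → ℂ → ℂ := by
  classical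
  exact if g = 1 then psi1A else if g ^ 2 = 1 then psi2A else psi4AB

end Umbral13

end

noncomputable section

namespace Umbral13

open Complex TensorProduct Filter Topology

/-! ## Commutation relations of the modes -/

section Commutation

variable {k : Kind} {s : Sector}

/-! Every operator in the trace is diagonal in a monomial basis, so the trace is a sum over
monomials; two cancellations inside the bigraded pieces turn this sum into an infinite product.

Basis. Words in the creating modes span a twisted module (`wordVec_span`). The number operators have
the multiplicities as joint eigenvalues, which gives independence; the vacuum is nonzero because
exterior and polynomial algebras are models. Evaluating the Borcherds formula on two-letter states
shows that the zero mode of `ȷ` is the charge plus 1/2 (Clifford) or minus 1/2 (Weyl), and that of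
`ω` is the energy plus 1/8 or minus 1/8. In the tensor product the constants add up to 1 for `J0`
and to 0 for `L0`, and each joint eigenvalue has finitely many monomials.

Cancellation. (1) Adding `u⁻(0)` in `A(𝔢)` changes neither grading but flips the parity. The two
values of `J_𝔢(0)` differ by 1, so a pair contributes just one signed monomial
(`sum_cancel_zero_mode`); without `J_𝔢(0)` the trace would vanish. (2) A mode of `𝔟'` taken twice
has the degrees and the torus weight of one mode of `𝔞`, with opposite sign. This is `(1 - x²) / (1
- x) = 1 + x`, and leaves `𝔟'` with multiplicities at most 1 (`sum_reduced`). Step (2) is essential: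
the full monomial sum for `𝔟'` needs `|y³q| < 1`, while the domain only gives `|yq| < 1 < |y|`.
Afterwards the only geometric series are those of `𝔟`, which converge under precisely these
conditions.

Product. If `g` acts by `d = i^k`, put `a = d y` and `b = d y³`. The remaining monomials sum to
`traceProduct`, which is `(q;q)² θ(b²) / (θ(a) θ(b))` where the denominator is nonzero
(`traceProduct_mul_thetaProd`), with `θ` denoting `thetaProd`. Adding the terms for `d` and `d⁻¹`
gives `ψ_g`; in order 4 the two fractions are brought to a common denominator by `θ(iy; q) θ(-iy; q)
= θ(-y²; q²)`. Only `a` enters the denominators of `traceProduct`, so it is continuous on the whole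
domain. It agrees with the theta quotient off isolated points, which shows that the remaining
singularities are removable. -/

theorem sgn_mul_self (k : Kind) : k.sgn * k.sgn = 1 := by cases k <;> simp [Kind.sgn]

theorem mode_mul_mode (k : Kind) (s : Sector) (x y : Letter) :
    mode k s x * mode k s y =
      k.sgn • (mode k s y * mode k s x) + algebraMap ℂ _ (pairing k s x y) := by
  have h := RingQuot.mkAlgHom_rel ℂ (ModeRel.comm (k := k) (s := s) x y)
  simp only [map_mul, map_add, map_smul, AlgHom.commutes] at h
  exact h

/-- The letter of the mode dual to a given one. -/
def Letter.dual (s : Sector) (x : Letter) : Letter :=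
  (!x.1, match s with
    | .untwisted => -x.2 - 1
    | .twisted => -x.2)

theorem index_add_index_eq_zero {x y : Letter} :
    Letter.index s x + Letter.index s y = 0 ↔ y.2 = (Letter.dual s x).2 := by
  cases s
  · simp only [Letter.index, Sector.shift, Letter.dual]
    constructor
    · intro h
      have : ((x.2 + y.2 + 1 : ℤ) : ℚ) = 0 := by push_cast; linarith
      have := Int.cast_eq_zero.1 this
      omega
    · intro h
      rw [h]; push_cast; ring
  · simp only [Letter.index, Sector.shift, Letter.dual]
    constructor
    · intro h
      have : ((x.2 + y.2 : ℤ) : ℚ) = 0 := by push_cast; linarith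
      have := Int.cast_eq_zero.1 this
      omega
    · intro h
      rw [h]; push_cast; ring

theorem pairing_of_ne_dual {x y : Letter} (h : y ≠ Letter.dual s x) : pairing k s x y = 0 := by
  rw [pairing]
  split_ifs with h0
  · rw [index_add_index_eq_zero] at h0
    have : y.1 ≠ !x.1 := fun h1 => h (Prod.ext h1 h0)
    rcases x with ⟨_ | _, n⟩ <;> rcases y with ⟨_ | _, m⟩ <;> cases k <;> simp_all [Kind.form]
  · rfl

theorem dual_dual (x : Letter) : Letter.dual s (Letter.dual s x) = x := by
  cases s <;> simp [Letter.dual]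

theorem pairing_dual (x : Letter) : pairing k s (Letter.dual s x) x = k.form (!x.1) x.1 := by
  rw [pairing, if_pos]
  · simp [Letter.dual]
  · rw [index_add_index_eq_zero, dual_dual]

theorem pairing_comm (x y : Letter) : pairing k s y x = -k.sgn * pairing k s x y := by
  rw [pairing, pairing, add_comm]
  split_ifs
  · rcases x with ⟨_ | _, n⟩ <;> rcases y with ⟨_ | _, m⟩ <;> cases k <;> simp [Kind.form, Kind.sgn]
  · simp

theorem form_not_ne_zero (b : Bool) : k.form (!b) b ≠ 0 := by
  cases b <;> cases k <;> simp [Kind.form]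

theorem isAnnihilator_iff {x : Letter} :
    IsAnnihilator s x ↔ (match s with
      | .untwisted => 0 ≤ x.2
      | .twisted => 0 < x.2 ∨ x.2 = 0 ∧ x.1 = true) := by
  cases s
  · simp only [IsAnnihilator, Letter.index, Sector.shift]
    constructor
    · rintro (h | ⟨h, -⟩)
      · by_contra! h2
        have : (x.2 : ℚ) ≤ -1 := by exact_mod_cast (show x.2 ≤ -1 by omega)
        linarith
      -- A half-integral index never vanishes, so the clause on zero modes is empty in the untwisted
      -- sector.
      · exfalso
        have : ((2 * x.2 + 1 : ℤ) : ℚ) = 0 := by push_cast; linarith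
        have := Int.cast_eq_zero.1 this
        omega
    · intro h
      left
      have : (0 : ℚ) ≤ x.2 := by exact_mod_cast h
      linarith
  · simp [IsAnnihilator, Letter.index, Sector.shift]

theorem isAnnihilator_dual {x : Letter} (hx : ¬ IsAnnihilator s x) :
    IsAnnihilator s (Letter.dual s x) := by
  rw [isAnnihilator_iff] at hx ⊢
  cases s
  · simp only [Letter.dual] at hx ⊢
    omega
  · rcases x with ⟨_ | _, n⟩ <;> simp [Letter.dual] at hx ⊢ <;> omega

theorem not_isAnnihilator_dual {x : Letter} (hx : IsAnnihilator s x) :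
    ¬ IsAnnihilator s (Letter.dual s x) := by
  rw [isAnnihilator_iff] at hx ⊢
  cases s
  · simp only [Letter.dual] at hx ⊢
    omega
  · rcases x with ⟨_ | _, n⟩ <;> simp [Letter.dual] at hx ⊢ <;> omega

theorem pairing_annihilators {x y : Letter} (hx : IsAnnihilator s x) (hy : IsAnnihilator s y) :
    pairing k s x y = 0 :=
  pairing_of_ne_dual fun h => not_isAnnihilator_dual hx (h ▸ hy)

theorem pairing_creators {x y : Letter} (hx : ¬ IsAnnihilator s x) (hy : ¬ IsAnnihilator s y) :
    pairing k s x y = 0 :=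
  pairing_of_ne_dual fun h => hy (h ▸ isAnnihilator_dual hx)

end Commutation

/-- The properties of the modules `Fock k s` on which everything below rests, for an abstract
vector space `M` with operators `u x` and a vector `v₀`. -/
structure IsFock (k : Kind) (s : Sector) {M : Type*} [AddCommGroup M] [Module ℂ M]
    (u : Letter → Module.End ℂ M) (v₀ : M) : Prop where
  rel : ∀ x y, u x * u y = k.sgn • (u y * u x) + pairing k s x y • 1
  vac : ∀ x, IsAnnihilator s x → u x v₀ = 0
  cyclic : ∀ S : Submodule ℂ M, v₀ ∈ S → (∀ x, ∀ v ∈ S, u x v ∈ S) → S = ⊤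
  ne_zero : v₀ ≠ 0

/-! ## Words in the creating modes -/

section Words

variable {k : Kind} {s : Sector} {M : Type*} [AddCommGroup M] [Module ℂ M]
  {u : Letter → Module.End ℂ M} {v₀ : M}

theorem IsFock.rel_apply (hF : IsFock k s u v₀) (x y : Letter) (v : M) :
    u x (u y v) = k.sgn • u y (u x v) + pairing k s x y • v := by
  have h := LinearMap.congr_fun (hF.rel x y) v
  simpa using h

/-- The vector `u₁ ⋯ uₗ v₀`. -/
def wordVec (u : Letter → Module.End ℂ M) (v₀ : M) (w : List Letter) : M :=
  (w.map u).prod v₀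

@[simp] theorem wordVec_nil : wordVec u v₀ [] = v₀ := rfl

@[simp] theorem wordVec_cons (x : Letter) (w : List Letter) :
    wordVec u v₀ (x :: w) = u x (wordVec u v₀ w) := by
  simp [wordVec]

/-- The operator counting the occurrences of a creating mode. -/
def numberOp (k : Kind) (s : Sector) (u : Letter → Module.End ℂ M) (x : Letter) :
    Module.End ℂ M :=
  (k.form (!x.1) x.1)⁻¹ • (u x * u (Letter.dual s x))

/-- Moving `u x` and its dual past a letter `y` produces `sgn` twice, hence no sign in either case;
an extra term arises only for `y = x`. Repeated letters are harmless in the Clifford case, as the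
word is then zero. -/
theorem numberOp_wordVec (hF : IsFock k s u v₀) {x : Letter} (hx : ¬ IsAnnihilator s x) (w : List Letter)
    (hw : ∀ y ∈ w, ¬ IsAnnihilator s y) :
    numberOp k s u x (wordVec u v₀ w) = (w.count x : ℂ) • wordVec u v₀ w := by
  have hf := form_not_ne_zero (k := k) x.1
  induction w with
  | nil => simp [numberOp, hF.vac _ (isAnnihilator_dual hx)]
  | cons y w ih =>
    have hy := hw y (by simp)
    have ih := ih fun z hz => hw z (by simp [hz])
    simp only [numberOp, LinearMap.smul_apply, Module.End.mul_apply] at ih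
    rw [inv_smul_eq_iff₀ hf] at ih
    simp only [numberOp, LinearMap.smul_apply, Module.End.mul_apply, wordVec_cons]
    rw [inv_smul_eq_iff₀ hf, hF.rel_apply (Letter.dual s x), map_add, map_smul,
      hF.rel_apply x y, pairing_creators hx hy, zero_smul, add_zero, smul_smul,
      sgn_mul_self, one_smul, ih, map_smul]
    by_cases hxy : y = x
    · subst hxy
      rw [pairing_dual, List.count_cons_self]
      simp only [map_smul]
      push_cast
      module
    · rw [pairing_of_ne_dual (x := Letter.dual s x) (by rwa [dual_dual]), zero_smul, map_zero,
        add_zero, List.count_cons_of_ne hxy]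
      simp only [map_smul]

/-- Words without forbidden repetitions. -/
def Admissible (k : Kind) (w : List Letter) : Prop := k = .clifford → w.Nodup

/-- The dual mode strips off the first letter. The scalar is nonzero for every word in the Weyl
case, and in the Clifford case when `x` does not recur in `w`. -/
theorem dual_modeOp_wordVec (hF : IsFock k s u v₀) {x : Letter} (hx : ¬ IsAnnihilator s x) (w : List Letter)
    (hw : ∀ y ∈ w, ¬ IsAnnihilator s y) :
    u (Letter.dual s x) (wordVec u v₀ (x :: w)) =
      k.form (!x.1) x.1 • (k.sgn * w.count x + 1) • wordVec u v₀ w := by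
  have h := numberOp_wordVec hF hx w hw
  simp only [numberOp, LinearMap.smul_apply, Module.End.mul_apply] at h
  rw [inv_smul_eq_iff₀ (form_not_ne_zero x.1)] at h
  rw [wordVec_cons, hF.rel_apply, pairing_dual, h]
  module

theorem wordVec_ne_zero (hF : IsFock k s u v₀) (w : List Letter)
    (hw : ∀ y ∈ w, ¬ IsAnnihilator s y) (ha : Admissible k w) : wordVec u v₀ w ≠ 0 := by
  induction w with
  | nil => exact hF.ne_zero
  | cons x w ih =>
    intro h
    have hw' : ∀ y ∈ w, ¬ IsAnnihilator s y := fun z hz => hw z (by simp [hz])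
    have h1 := dual_modeOp_wordVec hF (hw x (by simp)) w hw'
    rw [h, map_zero, eq_comm, smul_eq_zero_iff_right (form_not_ne_zero x.1), smul_eq_zero] at h1
    refine h1.elim (fun h1 => ?_) (ih hw' fun hk => (ha hk).of_cons)
    cases k
    · rw [List.count_eq_zero_of_not_mem (List.nodup_cons.1 (ha rfl)).1] at h1
      simp at h1
    · simp only [Kind.sgn, one_mul] at h1
      exact Nat.cast_add_one_ne_zero _ h1

/-- Creating modes commute up to `sgn`. The sign is not recorded, since only spans depend on this.
-/
theorem wordVec_perm (hF : IsFock k s u v₀) {w w' : List Letter} (h : w.Perm w') (hw : ∀ y ∈ w, ¬ IsAnnihilator s y) :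
    ∃ c : ℂ, wordVec u v₀ w = c • wordVec u v₀ w' := by
  induction h with
  | nil => exact ⟨1, by simp⟩
  | @cons x w w' _ ih =>
    obtain ⟨c, hc⟩ := ih fun y hy => hw y (by simp [hy])
    exact ⟨c, by rw [wordVec_cons, hc, map_smul, wordVec_cons]⟩
  | swap x y w =>
    refine ⟨k.sgn, ?_⟩
    simp only [wordVec_cons]
    rw [hF.rel_apply, pairing_creators (hw y (by simp)) (hw x (by simp)), zero_smul,
      add_zero]
  | trans h1 _ ih1 ih2 =>
    obtain ⟨c, hc⟩ := ih1 hw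
    obtain ⟨d, hd⟩ := ih2 fun y hy => hw y (h1.mem_iff.2 hy)
    exact ⟨c * d, by rw [hc, hd, smul_smul]⟩

/-- A repeated letter can be moved to the front twice, and `x² = -x²` for a creating Clifford mode.
-/
theorem wordVec_clifford_of_not_nodup (hF : IsFock .clifford s u v₀) {w : List Letter}
    (hw : ∀ y ∈ w, ¬ IsAnnihilator s y)
    (h : ¬ w.Nodup) : wordVec u v₀ w = 0 := by
  obtain ⟨x, hx⟩ : ∃ x, List.Sublist [x, x] w := by
    rw [List.nodup_iff_sublist] at h
    push Not at h
    exact h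
  obtain ⟨l, hl⟩ := hx.exists_perm_append
  obtain ⟨c, hc⟩ := wordVec_perm hF hl hw
  have hxa := hw x (hx.subset (by simp))
  have h2 := hF.rel_apply x x (wordVec u v₀ l)
  rw [pairing_creators hxa hxa, zero_smul, add_zero, Kind.sgn, neg_one_smul, eq_neg_iff_add_eq_zero,
    ← two_smul ℂ, smul_eq_zero_iff_right two_ne_zero] at h2
  rw [hc]
  simp only [List.cons_append, List.nil_append, wordVec_cons]
  rw [h2, smul_zero]

/-- The span of the creating words is stable under all modes: a creating mode lengthens a word, an
annihilating one is commuted to the right until it meets `v₀`. Cyclicity concludes. -/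
theorem wordVec_span (hF : IsFock k s u v₀) (v : M) : v ∈ Submodule.span ℂ
    (wordVec u v₀ '' {w | ∀ y ∈ w, ¬ IsAnnihilator s y}) := by
  set S := Submodule.span ℂ (wordVec u v₀ '' {w | ∀ y ∈ w, ¬ IsAnnihilator s y}) with hS
  have hmem : ∀ w : List Letter, (∀ y ∈ w, ¬ IsAnnihilator s y) → wordVec u v₀ w ∈ S :=
    fun w hw => Submodule.subset_span ⟨w, hw, rfl⟩
  have hcr : ∀ x, ¬ IsAnnihilator s x → ∀ v ∈ S, u x v ∈ S := by
    intro x hx v hv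
    induction hv using Submodule.span_induction with
    | mem v hv =>
      obtain ⟨w, hw, rfl⟩ := hv
      rw [← wordVec_cons]
      refine hmem _ fun y hy => ?_
      rcases List.mem_cons.1 hy with rfl | hy
      exacts [hx, hw y hy]
    | zero => simp
    | add v w _ _ h1 h2 => rw [map_add]; exact add_mem h1 h2
    | smul c v _ h => rw [map_smul]; exact S.smul_mem _ h
  have hann : ∀ x, IsAnnihilator s x → ∀ v ∈ S, u x v ∈ S := by
    intro x hx v hv
    induction hv using Submodule.span_induction with
    | mem v hv =>
      obtain ⟨w, hw, rfl⟩ := hv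
      induction w with
      | nil => rw [wordVec_nil, hF.vac _ hx]; exact zero_mem _
      | cons y w ih =>
        have hw' : ∀ y ∈ w, ¬ IsAnnihilator s y := fun z hz => hw z (by simp [hz])
        rw [wordVec_cons, hF.rel_apply]
        exact add_mem (S.smul_mem _ (hcr y (hw y (by simp)) _ (ih hw')))
          (S.smul_mem _ (hmem w hw'))
    | zero => simp
    | add v w _ _ h1 h2 => rw [map_add]; exact add_mem h1 h2
    | smul c v _ h => rw [map_smul]; exact S.smul_mem _ h
  have : S = ⊤ := hF.cyclic S (hmem [] (by simp)) fun x v hv => ?_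
  · rw [this]; trivial
  by_cases hx : IsAnnihilator s x
  exacts [hann x hx v hv, hcr x hx v hv]

end Words

/-! ## Non-triviality of the modules -/

section Models

variable {s : Sector}

/-- The relations might collapse the induced module. In a model the left ideal of the annihilating
modes kills `v`, while 1 does not, so 1 is not in the ideal. -/
theorem vac_ne_zero_of_model {k : Kind} {M : Type*} [AddCommGroup M] [Module ℂ M]
    (φ : ModeAlg k s →ₐ[ℂ] Module.End ℂ M) (v : M) (hv : v ≠ 0)
    (h : ∀ x, IsAnnihilator s x → φ (mode k s x) v = 0) : vac k s ≠ 0 := by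
  intro h0
  have h1 : (1 : ModeAlg k s) ∈ annIdeal k s := (Submodule.Quotient.mk_eq_zero _).1 h0
  have h2 : ∀ a ∈ annIdeal k s, φ a v = 0 := by
    intro a ha
    induction ha using Submodule.span_induction with
    | mem a ha => obtain ⟨x, hx, rfl⟩ := ha; exact h x hx
    | zero => simp
    | add a b _ _ ha hb => simp [ha, hb]
    | smul r a _ ha => simp [ha]
  exact hv (by simpa using h2 1 h1)

open Classical in
/-- The action of the modes on polynomials in the creating modes. -/
def weylModel (s : Sector) (x : Letter) : Module.End ℂ (MvPolynomial Letter ℂ) :=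
  if IsAnnihilator s x then
    (MvPolynomial.mkDerivation ℂ fun y => MvPolynomial.C (pairing .weyl s x y) :
      Derivation ℂ (MvPolynomial Letter ℂ) (MvPolynomial Letter ℂ)).toLinearMap
  else LinearMap.mulLeft ℂ (MvPolynomial.X x)

/-- Derivations with constant coefficients commute with each other, multiplications do too, and the
mixed relations are the Leibniz rule. -/
theorem weylModel_rel (s : Sector) (x y : Letter) :
    weylModel s x * weylModel s y =
      weylModel s y * weylModel s x + pairing .weyl s x y • 1 := by
  unfold weylModel
  split_ifs with hx hy hy
  · rw [pairing_annihilators hx hy, zero_smul, add_zero]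
    set D : Letter → Derivation ℂ (MvPolynomial Letter ℂ) (MvPolynomial Letter ℂ) :=
      fun x => MvPolynomial.mkDerivation ℂ fun y => MvPolynomial.C (pairing .weyl s x y) with hD
    have : ⁅D x, D y⁆ = 0 := by
      refine MvPolynomial.derivation_ext fun i => ?_
      simp [hD, Derivation.commutator_apply, MvPolynomial.derivation_C]
    refine LinearMap.ext fun p => ?_
    have h2 := Derivation.congr_fun this p
    rwa [Derivation.commutator_apply, Derivation.zero_apply, sub_eq_zero] at h2
  · refine LinearMap.ext fun p => ?_
    simp [MvPolynomial.mkDerivation_X, MvPolynomial.smul_eq_C_mul]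
    ring
  · rw [pairing_comm]
    refine LinearMap.ext fun p => ?_
    simp [MvPolynomial.mkDerivation_X, MvPolynomial.smul_eq_C_mul, Kind.sgn]
    ring
  · rw [pairing_creators hx hy, zero_smul, add_zero]
    refine LinearMap.ext fun p => ?_
    simp
    ring

open Classical in
/-- The action of the modes on the exterior algebra of the creating modes. -/
def cliffordModel (s : Sector) (x : Letter) :
    Module.End ℂ (CliffordAlgebra (0 : QuadraticForm ℂ (Letter →₀ ℂ))) :=
  if IsAnnihilator s x then
    CliffordAlgebra.contractLeft (Finsupp.lift ℂ ℂ Letter fun y => pairing .clifford s x y)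
  else LinearMap.mulLeft ℂ (CliffordAlgebra.ι 0 (Finsupp.single x 1))

/-- The same with contractions, which are anti-derivations, and exterior multiplications. -/
theorem cliffordModel_rel (s : Sector) (x y : Letter) :
    cliffordModel s x * cliffordModel s y =
      -(cliffordModel s y * cliffordModel s x) + pairing .clifford s x y • 1 := by
  unfold cliffordModel
  split_ifs with hx hy hy
  · rw [pairing_annihilators hx hy, zero_smul, add_zero]
    refine LinearMap.ext fun p => ?_
    simp only [Module.End.mul_apply, LinearMap.neg_apply]
    exact CliffordAlgebra.contractLeft_comm _ _ _
  · refine LinearMap.ext fun p => ?_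
    simp only [Module.End.mul_apply, LinearMap.neg_apply, LinearMap.mulLeft_apply,
      LinearMap.add_apply, LinearMap.smul_apply, Module.End.one_apply,
      CliffordAlgebra.contractLeft_ι_mul]
    simp
    abel
  · rw [pairing_comm]
    refine LinearMap.ext fun p => ?_
    simp only [Module.End.mul_apply, LinearMap.neg_apply, LinearMap.mulLeft_apply,
      LinearMap.add_apply, LinearMap.smul_apply, Module.End.one_apply,
      CliffordAlgebra.contractLeft_ι_mul]
    simp [Kind.sgn]
  · rw [pairing_creators hx hy, zero_smul, add_zero]
    refine LinearMap.ext fun p => ?_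
    have h := CliffordAlgebra.ι_mul_ι_add_swap (Q := (0 : QuadraticForm ℂ (Letter →₀ ℂ)))
      (Finsupp.single x 1) (Finsupp.single y 1)
    simp only [QuadraticMap.polar, zero_apply, sub_zero, map_zero] at h
    simp only [Module.End.mul_apply, LinearMap.neg_apply, LinearMap.mulLeft_apply]
    rw [← mul_assoc, ← mul_assoc, eq_neg_of_add_eq_zero_left h, neg_mul]

theorem vac_ne_zero (k : Kind) (s : Sector) : vac k s ≠ 0 := by
  cases k
  · refine vac_ne_zero_of_model (RingQuot.liftAlgHom ℂ ⟨FreeAlgebra.lift ℂ (cliffordModel s), ?_⟩)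
      (1 : CliffordAlgebra (0 : QuadraticForm ℂ (Letter →₀ ℂ))) ?_ fun x hx => ?_
    · rintro _ _ ⟨x, y⟩
      simp only [map_mul, map_add, map_smul, AlgHom.commutes, FreeAlgebra.lift_ι_apply]
      rw [cliffordModel_rel, Kind.sgn, Algebra.algebraMap_eq_smul_one]
      congr 1
    · have : Nontrivial (CliffordAlgebra (0 : QuadraticForm ℂ (Letter →₀ ℂ))) :=
        inferInstanceAs (Nontrivial (ExteriorAlgebra ℂ (Letter →₀ ℂ)))
      exact one_ne_zero
    · simp [mode, cliffordModel, hx]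
  · refine vac_ne_zero_of_model (RingQuot.liftAlgHom ℂ ⟨FreeAlgebra.lift ℂ (weylModel s), ?_⟩)
      (1 : MvPolynomial Letter ℂ) one_ne_zero fun x hx => ?_
    · rintro _ _ ⟨x, y⟩
      simp only [map_mul, map_add, map_smul, AlgHom.commutes, FreeAlgebra.lift_ι_apply]
      rw [weylModel_rel, Kind.sgn, one_smul, Algebra.algebraMap_eq_smul_one]
    · simp [mode, weylModel, hx]

theorem modeOp_vac {k : Kind} {x : Letter} (hx : IsAnnihilator s x) :
    modeOp k s x (vac k s) = 0 := by
  have h : mode k s x ∈ annIdeal k s := Submodule.subset_span ⟨x, hx, rfl⟩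
  have h2 : modeOp k s x (vac k s) = (annIdeal k s).mkQ (mode k s x • 1) := rfl
  rw [h2, smul_eq_mul, mul_one]
  exact (Submodule.Quotient.mk_eq_zero _).2 h

theorem fock_cyclic (k : Kind) (s : Sector) (S : Submodule ℂ (Fock k s)) (hvac : vac k s ∈ S)
    (hmode : ∀ x, ∀ v ∈ S, modeOp k s x v ∈ S) : S = ⊤ := by
  have key : ∀ (a : FreeAlgebra ℂ Letter) (v : Fock k s), v ∈ S →
      RingQuot.mkAlgHom ℂ (ModeRel k s) a • v ∈ S := by
    intro a
    induction a using FreeAlgebra.induction with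
    | grade0 r =>
      intro v hv
      rw [AlgHom.commutes, algebraMap_smul]
      exact S.smul_mem _ hv
    | grade1 x => exact fun v hv => hmode x v hv
    | mul a b ha hb =>
      intro v hv
      rw [map_mul, mul_smul]
      exact ha _ (hb _ hv)
    | add a b ha hb =>
      intro v hv
      rw [map_add, add_smul]
      exact add_mem (ha _ hv) (hb _ hv)
  refine eq_top_iff.2 fun v _ => ?_
  obtain ⟨a, rfl⟩ := (annIdeal k s).mkQ_surjective v
  obtain ⟨a, rfl⟩ := RingQuot.mkAlgHom_surjective ℂ (ModeRel k s) a
  have := key a _ hvac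
  rwa [vac, ← map_smul, smul_eq_mul, mul_one] at this

theorem isFock (k : Kind) (s : Sector) : IsFock k s (modeOp k s) (vac k s) where
  rel x y := by
    have h := congrArg (Algebra.lsmul ℂ ℂ (Fock k s)) (mode_mul_mode k s x y)
    simp only [map_mul, map_add, map_smul, AlgHom.commutes] at h
    rw [Algebra.algebraMap_eq_smul_one] at h
    exact h
  vac _ hx := modeOp_vac hx
  cyclic S := fock_cyclic k s S
  ne_zero := vac_ne_zero k s

end Models

/-! ## Bases of ordered words -/

/-- Joint eigenvectors with pairwise distinct systems of eigenvalues are independent. -/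
theorem linearIndependent_of_joint_eigenvectors {K V ι X : Type*} [Field K] [AddCommGroup V]
    [Module K V] (v : ι → V) (N : X → Module.End K V) (c : ι → X → K)
    (hN : ∀ i x, N x (v i) = c i x • v i) (hc : Function.Injective c) (hv : ∀ i, v i ≠ 0) :
    LinearIndependent K v := by
  classical
  rw [linearIndependent_iff']
  intro t
  induction t using Finset.induction_on with
  | empty => simp
  | insert a t ha ih =>
    intro g hg
    have h1 : ∀ j ∈ t, g j = 0 := by
      intro j hj
      -- Some operator separates `j` from `a`. Applying `N x - c a x` to the relation removes the
      -- `a`-term and multiplies the `j`-th coefficient by a nonzero factor.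
      obtain ⟨x, hx⟩ : ∃ x, c j x ≠ c a x := by
        by_contra! h
        exact ha (hc (funext h) ▸ hj)
      have h2 := congrArg (fun w => N x w - c a x • w) hg
      simp only [map_zero, smul_zero, sub_zero, map_sum, map_smul, hN, Finset.smul_sum,
        ← Finset.sum_sub_distrib] at h2
      rw [Finset.sum_insert ha, smul_comm, sub_self, zero_add] at h2
      have h3 := ih (fun i => g i * (c i x - c a x)) (by
        rw [← h2]
        exact Finset.sum_congr rfl fun i _ => by module) j hj
      exact (mul_eq_zero.1 h3).resolve_right (sub_ne_zero.2 hx)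
    rw [Finset.sum_insert ha, Finset.sum_eq_zero (fun j hj => by rw [h1 j hj, zero_smul]),
      add_zero, smul_eq_zero_iff_left (hv a)] at hg
    intro i hi
    rcases Finset.mem_insert.1 hi with rfl | hi
    exacts [hg, h1 i hi]

section Bases

variable {k : Kind} {s : Sector} {M : Type*} [AddCommGroup M] [Module ℂ M]
  {u : Letter → Module.End ℂ M} {v₀ : M}

theorem linearIndependent_wordVec (hF : IsFock k s u v₀) {ι : Type*} (w : ι → List Letter)
    (hw : ∀ i, ∀ y ∈ w i, ¬ IsAnnihilator s y) (ha : ∀ i, Admissible k (w i))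
    (hinj : ∀ i j, (∀ x, (w i).count x = (w j).count x) → i = j) :
    LinearIndependent ℂ fun i => wordVec u v₀ (w i) := by
  refine linearIndependent_of_joint_eigenvectors _
    (fun x : {x // ¬ IsAnnihilator s x} => numberOp k s u x) (fun i x => ((w i).count x.1 : ℂ))
    (fun i x => numberOp_wordVec hF x.2 _ (hw i)) (fun i j hij => hinj i j fun x => ?_)
    (fun i => wordVec_ne_zero hF _ (hw i) (ha i))
  by_cases hx : IsAnnihilator s x
  · rw [List.count_eq_zero_of_not_mem fun h => hw i x h hx,
      List.count_eq_zero_of_not_mem fun h => hw j x h hx]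
  · have h := congrFun hij ⟨x, hx⟩
    exact Nat.cast_injective h

theorem precedes_antisymm {x y : Letter} (h1 : k.precedes x y) (h2 : k.precedes y x) : x = y := by
  rcases x with ⟨_ | _, n⟩ <;> rcases y with ⟨_ | _, m⟩ <;> cases k <;>
    simp_all [Kind.precedes] <;> omega

theorem IsOrdered.admissible {w : List Letter} (h : IsOrdered k w) : Admissible k w := by
  rintro rfl
  refine h.2.imp fun {a b} hab => ?_
  rintro rfl
  simp [Kind.precedes] at hab

/-- This is the half of Poincaré–Birkhoff–Witt that makes `expand` unambiguous. Ordered words with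
equal multiplicities coincide because `precedes` is antisymmetric. -/
theorem linearIndependent_ordered (hF : IsFock k .untwisted u v₀) :
    LinearIndependent ℂ fun w : {w // IsOrdered k w} => wordVec u v₀ w.1 := by
  refine linearIndependent_wordVec hF _ (fun w => w.2.1) (fun w => w.2.admissible)
    fun w w' h => Subtype.ext ?_
  exact (List.perm_iff_count.2 h).eq_of_pairwise (fun a b _ _ => precedes_antisymm) w.2.2 w'.2.2

/-- The set indexing the creating modes `u⁺(-1-j)` and `u⁻(-j)` of the twisted sector. -/
abbrev Mo := Bool × ℕ

/-- The creating mode with a given index. -/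
def Mo.letter (i : Mo) : Letter := if i.1 then (true, -1 - (i.2 : ℤ)) else (false, -(i.2 : ℤ))

theorem Mo.letter_injective : Function.Injective Mo.letter := by
  rintro ⟨_ | _, n⟩ ⟨_ | _, m⟩ h <;> simp_all [Mo.letter]

theorem Mo.letter_creates (i : Mo) : ¬ IsAnnihilator .twisted i.letter := by
  rw [isAnnihilator_iff]
  rcases i with ⟨_ | _, n⟩ <;> simp [Mo.letter]
  omega

theorem Mo.exists_letter {x : Letter} (hx : ¬ IsAnnihilator .twisted x) :
    ∃ i : Mo, i.letter = x := by
  rw [isAnnihilator_iff] at hx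
  rcases x with ⟨_ | _, n⟩ <;> simp at hx
  · exact ⟨(false, n.natAbs), Prod.ext rfl (by simp only [Mo.letter, Bool.false_eq_true, if_false]; omega)⟩
  · exact ⟨(true, (-1 - n).natAbs), Prod.ext rfl (by simp only [Mo.letter, if_true]; omega)⟩

/-- A word with prescribed multiplicities. -/
def wordOf (F : Mo →₀ ℕ) : List Letter := F.toMultiset.toList.map Mo.letter

theorem wordOf_creates (F : Mo →₀ ℕ) : ∀ y ∈ wordOf F, ¬ IsAnnihilator .twisted y := by
  intro y hy
  obtain ⟨i, -, rfl⟩ := List.mem_map.1 hy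
  exact i.letter_creates

theorem Mo.count_toFinsupp (l : List Mo) (i : Mo) :
    Multiset.toFinsupp (l : Multiset Mo) i = l.count i := by
  rw [Multiset.toFinsupp_apply, Multiset.coe_count]
  congr 1
  exact lawful_beq_subsingleton _ _

theorem count_wordOf (F : Mo →₀ ℕ) (i : Mo) : (wordOf F).count i.letter = F i := by
  rw [wordOf, List.count_map_of_injective _ _ Mo.letter_injective, ← Mo.count_toFinsupp,
    Multiset.coe_toList, Finsupp.toMultiset_toFinsupp]

/-- The multiplicities that occur: in the Clifford case a mode may not be repeated. -/
abbrev Idx (k : Kind) := {F : Mo →₀ ℕ // k = .clifford → ∀ i, F i ≤ 1}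

theorem wordOf_admissible (F : Idx k) : Admissible k (wordOf F.1) := by
  intro hk
  rw [List.nodup_iff_count_le_one]
  intro x
  by_cases hx : IsAnnihilator .twisted x
  · rw [List.count_eq_zero_of_not_mem fun h => wordOf_creates _ x h hx]
    exact zero_le_one
  · obtain ⟨i, rfl⟩ := Mo.exists_letter hx
    rw [count_wordOf]
    exact F.2 hk i

theorem span_wordOf (hF : IsFock k .twisted u v₀) :
    ⊤ ≤ Submodule.span ℂ (Set.range fun F : Idx k => wordVec u v₀ (wordOf F.1)) := by
  intro v _
  refine Submodule.span_le.2 ?_ (wordVec_span hF v)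
  rintro _ ⟨w, hw, rfl⟩
  obtain ⟨l, rfl⟩ : ∃ l : List Mo, l.map Mo.letter = w := by
    induction w with
    | nil => exact ⟨[], rfl⟩
    | cons y w ih =>
      obtain ⟨i, hi⟩ := Mo.exists_letter (hw y (by simp))
      obtain ⟨l, hl⟩ := ih fun z hz => hw z (by simp [hz])
      exact ⟨i :: l, by simp [hi, hl]⟩
  have hperm : (l.map Mo.letter).Perm (wordOf (Multiset.toFinsupp (l : Multiset Mo))) := by
    refine List.Perm.map _ ?_
    rw [← Multiset.coe_eq_coe, Multiset.coe_toList, Multiset.toFinsupp_toMultiset]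
  obtain ⟨c, hc⟩ := wordVec_perm hF hperm hw
  by_cases ha : k = .clifford → ∀ i, Multiset.toFinsupp (l : Multiset Mo) i ≤ 1
  · rw [hc]
    exact Submodule.smul_mem _ _ (Submodule.subset_span ⟨⟨_, ha⟩, rfl⟩)
  · push Not at ha
    obtain ⟨rfl, i, hi⟩ := ha
    have : wordVec u v₀ (l.map Mo.letter) = 0 := by
      refine wordVec_clifford_of_not_nodup hF hw fun hnd => ?_
      have h2 := List.nodup_iff_count_le_one.1 (List.Nodup.of_map _ hnd) i
      rw [Mo.count_toFinsupp] at hi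
      omega
    rw [this]
    exact zero_mem _

/-- The basis of the twisted module. -/
def fockBasis (hF : IsFock k .twisted u v₀) : Module.Basis (Idx k) ℂ M :=
  Module.Basis.mk (linearIndependent_wordVec hF (fun F : Idx k => wordOf F.1)
    (fun F => wordOf_creates F.1) (fun F => wordOf_admissible F)
    fun F G h => Subtype.ext <| Finsupp.ext fun i => by simpa [count_wordOf] using h i.letter)
    (span_wordOf hF)

theorem fockBasis_apply (hF : IsFock k .twisted u v₀) (F : Idx k) :
    fockBasis hF F = wordVec u v₀ (wordOf F.1) := by
  simp [fockBasis]

theorem numberOp_fockBasis (hF : IsFock k .twisted u v₀) (i : Mo) (F : Idx k) :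
    numberOp k .twisted u i.letter (fockBasis hF F) = (F.1 i : ℂ) • fockBasis hF F := by
  rw [fockBasis_apply, numberOp_wordVec hF i.letter_creates _ (wordOf_creates _), count_wordOf]

end Bases

/-! ## Locally finite sums of operators -/

section LocSum

variable {ι M : Type*} [AddCommGroup M] [Module ℂ M]

theorem locSum_apply {f : ι → Module.End ℂ M}
    (h : ∀ v, (Function.support fun i => f i v).Finite) (v : M) :
    locSum f v = ∑ᶠ i, f i v := by
  rw [locSum, dif_pos h]
  rfl

theorem locSum_eq_sum {f : ι → Module.End ℂ M} (t : Finset ι) (h : ∀ i ∉ t, f i = 0) :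
    locSum f = ∑ i ∈ t, f i := by
  have hs : ∀ v, (Function.support fun i => f i v) ⊆ t := fun v i hi => by
    by_contra hit
    exact hi (by simp [h i hit])
  ext1 v
  rw [locSum_apply (fun v => t.finite_toSet.subset (hs v)), finsum_eq_sum_of_support_subset _ (hs v),
    LinearMap.sum_apply]

theorem locSum_eq_single {f : ι → Module.End ℂ M} (a : ι) (h : ∀ i, i ≠ a → f i = 0) :
    locSum f = f a := by
  rw [locSum_eq_sum {a} fun i hi => h i (by simpa using hi), Finset.sum_singleton]

theorem locSum_smul_const {g : ι → ℂ} (hg : (Function.support g).Finite) (U : Module.End ℂ M) :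
    locSum (fun i => g i • U) = (∑ᶠ i, g i) • U := by
  rw [locSum_eq_sum hg.toFinset fun i hi => ?_, finsum_eq_sum_of_support_toFinset_subset _ hg le_rfl,
    Finset.sum_smul]
  have : g i = 0 := by simpa using hi
  simp [this]

end LocSum

/-! ## Binomial coefficients -/

section Binomial

theorem choose_neg_one (j : ℕ) : (-1 : ℤ) ^ j * Ring.choose (-1 : ℤ) j = 1 := by
  rw [Ring.choose_neg, show (1 : ℤ) + j - 1 = (j : ℕ) by ring, Ring.choose_natCast]
  simp [Int.negOnePow_def, Units.smul_def, ← mul_pow]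

theorem choose_neg_two (j : ℕ) : (-1 : ℤ) ^ j * Ring.choose (-2 : ℤ) j = j + 1 := by
  rw [Ring.choose_neg, show (2 : ℤ) + j - 1 = ((j + 1 : ℕ) : ℤ) by push_cast; ring,
    Ring.choose_natCast]
  have h : (-1 : ℤ) ^ j * (-1) ^ j = 1 := by rw [← mul_pow]; simp
  simp only [Int.negOnePow_def, Units.smul_def, zpow_natCast, Units.val_pow_eq_pow_val,
    Units.val_neg, Units.val_one, smul_eq_mul, Nat.choose_succ_self_right]
  push_cast
  linear_combination (j + 1 : ℤ) * h

theorem choose_half_two : Ring.choose (1 / 2 : ℚ) 2 = -1 / 8 := by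
  have h := Ring.descPochhammer_eq_factorial_smul_choose (1 / 2 : ℚ) 2
  simp [descPochhammer, Polynomial.smeval_mul, Polynomial.smeval_sub, Polynomial.smeval_X,
    Nat.factorial] at h
  linarith

theorem sum_alternating_choose (p : ℕ) (hp : p ≠ 0) :
    ∑ j ∈ Finset.range (p + 1), ((-1) ^ j * (p.choose j : ℂ)) = 0 := by
  have h := Int.alternating_sum_range_choose_of_ne hp
  exact_mod_cast congrArg (Int.cast : ℤ → ℂ) h

theorem sum_alternating_choose_mul (p : ℕ) (hp : 2 ≤ p) :
    ∑ j ∈ Finset.range (p + 1), ((-1) ^ j * (p.choose j : ℂ)) * ((p : ℂ) - j) = 0 := by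
  obtain ⟨p, rfl⟩ : ∃ q, p = q + 1 := ⟨p - 1, by omega⟩
  -- The factor is absorbed by `C(p+1, j) (p+1-j) = (p+1) C(p, j)`, which leaves the plain
  -- alternating sum for `p ≥ 1`.
  have h : ∀ j ∈ Finset.range (p + 2), ((-1) ^ j * ((p + 1).choose j : ℂ)) * (((p + 1 : ℕ) : ℂ) - j)
      = (p + 1) * ((-1) ^ j * (p.choose j : ℂ)) := by
    intro j hj
    have hj : j ≤ p + 1 := Nat.lt_succ_iff.1 (Finset.mem_range.1 hj)
    have h := congrArg (Nat.cast : ℕ → ℂ) (Nat.choose_mul_succ_eq p j)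
    push_cast [Nat.cast_sub hj] at h ⊢
    linear_combination (-1) ^ j * (-h)
  rw [Finset.sum_congr rfl h, ← Finset.mul_sum, Finset.sum_range_succ,
    sum_alternating_choose p (by omega)]
  simp

end Binomial

/-! ## Vertex operators of words of length at most two -/

section Fields

variable {k : Kind} {s : Sector} {M : Type*} [AddCommGroup M] [Module ℂ M]
  {u : Letter → Module.End ℂ M} {v₀ : M}

/-- The product `nthProd` for operators on an arbitrary space. -/
def nthProdOn (k : Kind) (s : Sector) (u : Letter → Module.End ℂ M) (ε : Bool) (n : ℤ) (l : ℕ)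
    (f : ℚ → Module.End ℂ M) : ℚ → Module.End ℂ M := fun m =>
  let p : ℚ := s.shift - 1 / 2
  locSum fun i : ℕ => ((Ring.choose (-p) i : ℚ) : ℂ) • locSum fun j : ℕ =>
    (((-1) ^ j * Ring.choose (n + i) j : ℤ) : ℂ) •
      (u (ε, n + i - j) * f (m - i - p + j)
        - ((-1 : ℂ) ^ (n + i) * k.sgn ^ l) • (f (n + m - p - j) * u (ε, j)))

/-- The vertex operators `wordField` for operators on an arbitrary space. -/
def wordFieldOn (k : Kind) (s : Sector) (u : Letter → Module.End ℂ M) :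
    List Letter → ℚ → Module.End ℂ M
  | [] => fun m => if m = -1 then 1 else 0
  | x :: w => nthProdOn k s u x.1 x.2 w.length (wordFieldOn k s u w)

theorem wordField_eq (k : Kind) (s : Sector) (w : List Letter) :
    wordField k s w = wordFieldOn k s (modeOp k s) w := by
  induction w with
  | nil => rfl
  | cons x w ih => rw [wordField, wordFieldOn, ih]; rfl

/-- The coefficient `(-1)^j C(N, j)`. -/
def altChoose (N : ℤ) (j : ℕ) : ℂ := (((-1) ^ j * Ring.choose N j : ℤ) : ℂ)

theorem altChoose_natCast (p j : ℕ) : altChoose p j = (-1) ^ j * (p.choose j : ℂ) := by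
  rw [altChoose, Ring.choose_natCast]; push_cast; rfl

theorem altChoose_neg_one (j : ℕ) : altChoose (-1) j = 1 := by
  rw [altChoose, choose_neg_one]; simp

theorem altChoose_neg_two (j : ℕ) : altChoose (-2) j = j + 1 := by
  rw [altChoose, choose_neg_two]; simp

theorem nthProdOn_twisted (ε : Bool) (n : ℤ) (l : ℕ) (f : ℚ → Module.End ℂ M) (m : ℚ) :
    nthProdOn k .twisted u ε n l f m =
      locSum fun i : ℕ => ((Ring.choose (1 / 2 : ℚ) i : ℚ) : ℂ) • locSum fun j : ℕ =>
        altChoose (n + i) j • (u (ε, n + i - j) * f (m - i + 1 / 2 + j)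
          - ((-1 : ℂ) ^ (n + i) * k.sgn ^ l) • (f (n + m + 1 / 2 - j) * u (ε, j))) := by
  simp only [nthProdOn, Sector.shift, altChoose, zero_sub, neg_neg, sub_neg_eq_add]

theorem finsum_ite_intCast (g : ℕ → ℂ) (t : ℤ) :
    ∑ᶠ j : ℕ, (if (j : ℤ) = t then g j else 0) = if 0 ≤ t then g t.toNat else 0 := by
  split_ifs with h
  · rw [finsum_eq_single _ t.toNat fun j hj => if_neg fun h2 => hj (by omega),
      if_pos (Int.toNat_of_nonneg h)]
  · have h0 : ∀ j : ℕ, (if (j : ℤ) = t then g j else 0) = 0 :=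
      fun j => if_neg fun (h2 : (j : ℤ) = t) => h (h2 ▸ Int.natCast_nonneg j)
    simp only [h0, finsum_zero]

theorem finite_support_ite_intCast (g : ℕ → ℂ) (t : ℤ) :
    (Function.support fun j : ℕ => if (j : ℤ) = t then g j else 0).Finite := by
  refine (Set.finite_singleton t.toNat).subset fun j hj => ?_
  by_contra h
  exact hj (if_neg fun h2 => h (by simp [← h2]))

/-- The coefficient with which `u(t)` occurs in the `i`-th term of the product with the
identity field. -/
def unitCoeff (N t : ℤ) : ℂ :=
  (if 0 ≤ N - t then altChoose N (N - t).toNat else 0)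
    - (-1) ^ N * (if 0 ≤ t then altChoose N t.toNat else 0)

/-- For `N ≥ 0` the two expansions of `(x - z)^N` are the same polynomial, and the identity field
commutes with `u`. Hence only the finitely many `i` with `n + i < 0` contribute to the field of a
single letter. -/
theorem unitCoeff_natCast (p : ℕ) (t : ℤ) : unitCoeff p t = 0 := by
  simp only [unitCoeff, altChoose_natCast, zpow_natCast]
  rcases lt_or_ge t 0 with h | h
  · rw [if_neg (not_le.2 h), if_pos (by omega), Nat.choose_eq_zero_of_lt (by omega)]
    simp
  · obtain ⟨t, rfl⟩ := Int.eq_ofNat_of_zero_le h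
    rw [if_pos h]
    rcases lt_or_ge p t with h | h
    · rw [if_neg (by omega), Int.toNat_natCast, Nat.choose_eq_zero_of_lt h]
      simp
    · rw [if_pos (by omega), Int.toNat_natCast, ← Nat.cast_sub h, Int.toNat_natCast,
        Nat.choose_symm h]
      obtain ⟨r, rfl⟩ := Nat.exists_eq_add_of_le h
      have h2 : (-1 : ℂ) ^ t * (-1) ^ t = 1 := by rw [← mul_pow]; simp
      rw [Nat.add_sub_cancel_left, pow_add]
      linear_combination -(-1) ^ r * ((t + r).choose t : ℂ) * h2

/-- The two expansions of `1/(x - z)` differ by the formal delta function, so every mode occurs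
exactly once; for `N = -2` the derivative of the delta function appears. -/
theorem unitCoeff_neg_one (t : ℤ) : unitCoeff (-1) t = 1 := by
  simp only [unitCoeff, altChoose_neg_one]
  by_cases h : 0 ≤ t
  · rw [if_pos h, if_neg (by omega)]; simp
  · rw [if_neg h, if_pos (by omega)]; simp

theorem unitCoeff_neg_two (t : ℤ) : unitCoeff (-2) t = -1 - t := by
  simp only [unitCoeff, altChoose_neg_two]
  rcases lt_trichotomy t (-1) with h | rfl | h
  · obtain ⟨j, rfl⟩ : ∃ j : ℕ, t = -2 - j := ⟨(-2 - t).toNat, by omega⟩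
    rw [if_neg (by omega : ¬ (0 : ℤ) ≤ -2 - j), if_pos (by omega)]
    simp; ring
  · simp
  · obtain ⟨j, rfl⟩ := Int.eq_ofNat_of_zero_le (show 0 ≤ t by omega)
    rw [if_pos (Int.natCast_nonneg j), if_neg (by omega)]
    simp; ring

/-- The identity field lives at index `-1` alone. It selects at most one `j` in each of the two sums
over `j`, and the mode that goes with it is always `n + a + 1`. -/
theorem wordFieldOn_single_aux (ε : Bool) (n a : ℤ) :
    wordFieldOn k .twisted u [(ε, n)] (a - 1 / 2) =
      locSum fun i : ℕ => (((Ring.choose (1 / 2 : ℚ) i : ℚ) : ℂ) * unitCoeff (n + i) (n + a + 1)) •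
        u (ε, n + a + 1) := by
  simp only [wordFieldOn, nthProdOn_twisted, List.length_nil, pow_zero, mul_one]
  congr 1
  funext i
  rw [mul_smul]
  congr 1
  set t := n + a + 1 with ht
  have h : ∀ j : ℕ, altChoose (n + i) j •
      (u (ε, n + i - j) * (if (a : ℚ) - 1 / 2 - i + 1 / 2 + j = -1 then 1 else 0)
        - (-1 : ℂ) ^ (n + i) • ((if (n : ℚ) + (a - 1 / 2) + 1 / 2 - j = -1 then 1 else 0) * u (ε, j)))
      = ((if (j : ℤ) = n + i - t then altChoose (n + i) j else 0)
        - (-1) ^ (n + i) * (if (j : ℤ) = t then altChoose (n + i) j else 0)) • u (ε, t) := by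
    intro j
    have e1 : (a : ℚ) - 1 / 2 - i + 1 / 2 + j = -1 ↔ (j : ℤ) = n + i - t := by
      rw [← Int.cast_inj (α := ℚ), ht]
      push_cast
      constructor <;> intro h <;> linarith
    have e2 : (n : ℚ) + (a - 1 / 2) + 1 / 2 - j = -1 ↔ (j : ℤ) = t := by
      rw [← Int.cast_inj (α := ℚ), ht]
      push_cast
      constructor <;> intro h <;> linarith
    simp only [e1, e2]
    by_cases h1 : (j : ℤ) = n + i - t <;> by_cases h2 : (j : ℤ) = t
    · simp only [if_pos h1, if_pos h2, mul_one, one_mul]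
      rw [show n + i - (j : ℤ) = t by omega, h2]
      module
    · simp only [if_pos h1, if_neg h2, mul_one, zero_mul]
      rw [show n + i - (j : ℤ) = t by omega]
      module
    · simp only [if_neg h1, if_pos h2, mul_zero, one_mul]
      rw [h2]
      module
    · simp only [if_neg h1, if_neg h2, mul_zero, zero_mul]
      module
  simp only [h]
  have f1 := finite_support_ite_intCast (fun j => altChoose (n + i) j) (n + i - t)
  have f2 : (Function.support fun j : ℕ => (-1 : ℂ) ^ (n + i) *
      (if (j : ℤ) = t then altChoose (n + i) j else 0)).Finite :=
    (finite_support_ite_intCast (fun j => altChoose (n + i) j) t).subset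
      fun j hj h => hj (by simp only [h, mul_zero])
  rw [locSum_smul_const ((f1.union f2).subset (Function.support_sub _ _)),
    finsum_sub_distrib f1 f2, ← mul_finsum, finsum_ite_intCast, finsum_ite_intCast, unitCoeff]

/-- This recovers `Y_tw(u(-½)v, z) = ∑ u(r) z^(-r-1/2)`: the index `a - 1/2` belongs to
`z^(-a-1/2)`. -/
theorem wordFieldOn_generator (ε : Bool) (a : ℤ) :
    wordFieldOn k .twisted u [(ε, -1)] (a - 1 / 2) = u (ε, a) := by
  rw [wordFieldOn_single_aux, locSum_eq_single 0]
  · simp [unitCoeff_neg_one]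
  · intro i hi
    rw [show (-1 : ℤ) + i = ((i - 1 : ℕ) : ℤ) by omega, unitCoeff_natCast, mul_zero, zero_smul]

/-- The field of `u(-3/2)v` is the `z`-derivative of the generating field. The term `i = 0` gives
`-a`, and `i = 1` adds `C(1/2, 1) = 1/2`. -/
theorem wordFieldOn_derivative (ε : Bool) (a : ℤ) :
    wordFieldOn k .twisted u [(ε, -2)] (a - 1 / 2) = (1 / 2 - a : ℂ) • u (ε, a - 1) := by
  rw [wordFieldOn_single_aux, locSum_eq_sum (Finset.range 2)]
  · simp only [Finset.sum_range_succ, Finset.sum_range_zero, zero_add, Nat.cast_zero, add_zero,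
      Nat.cast_one, Ring.choose_zero_right, Ring.choose_one_right,
      show (-2 : ℤ) + 1 = -1 by norm_num, unitCoeff_neg_one, unitCoeff_neg_two]
    rw [← add_smul, show (-2 : ℤ) + a + 1 = a - 1 by ring]
    congr 1
    push_cast
    ring
  · intro i hi
    rw [Finset.mem_range] at hi
    rw [show (-2 : ℤ) + i = ((i - 2 : ℕ) : ℤ) by omega, unitCoeff_natCast, mul_zero, zero_smul]

end Fields

/-! ### Zero modes of the quadratic states. -/

section PairFields

variable {k : Kind} {M : Type*} [AddCommGroup M] [Module ℂ M]
  {u : Letter → Module.End ℂ M} {v₀ : M}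

/-- The operator `u⁺(r) u⁻(-r)`. -/
def plusMinus (u : Letter → Module.End ℂ M) (r : ℤ) : Module.End ℂ M := u (true, r) * u (false, -r)

/-- The operator `u⁻(-r) u⁺(r)`. -/
def minusPlus (u : Letter → Module.End ℂ M) (r : ℤ) : Module.End ℂ M := u (false, -r) * u (true, r)

theorem plusMinus_eq (hF : IsFock k .twisted u v₀) (r : ℤ) :
    plusMinus u r = k.sgn • minusPlus u r - k.sgn • 1 := by
  have h : pairing k .twisted (true, r) (false, -r) = -k.sgn := by
    rw [pairing, if_pos (by rw [index_add_index_eq_zero]; rfl)]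
    cases k <;> simp [Kind.form, Kind.sgn]
  rw [plusMinus, hF.rel, h, minusPlus]
  module

/-- `locSum` takes the default value 0 unless its family is finite on every vector; this supplies
that finiteness for the infinite sums of `pairTerm`. -/
theorem eventually_annihilates (hF : IsFock k .twisted u v₀) (v : M) :
    ∃ R : ℕ, ∀ (ε : Bool) (n : ℤ), R ≤ n → u (ε, n) v = 0 := by
  let S : Submodule ℂ M :=
    { carrier := {v | ∃ R : ℕ, ∀ (ε : Bool) (n : ℤ), R ≤ n → u (ε, n) v = 0}
      zero_mem' := ⟨0, fun _ _ _ => map_zero _⟩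
      add_mem' := by
        rintro v w ⟨R, hR⟩ ⟨R', hR'⟩
        refine ⟨R + R', fun ε n hn => ?_⟩
        push_cast at hn
        rw [map_add, hR ε n (by omega), hR' ε n (by omega), add_zero]
      smul_mem' := by
        rintro c v ⟨R, hR⟩
        exact ⟨R, fun ε n hn => by rw [map_smul, hR ε n hn, smul_zero]⟩ }
  have hS : S = ⊤ := by
    refine hF.cyclic S ⟨1, fun ε n hn => hF.vac _ ?_⟩ ?_
    · rw [isAnnihilator_iff]
      left
      change 0 < n
      push_cast at hn
      omega
    · rintro x v ⟨R, hR⟩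
      -- Beyond `|x.2|` no mode is dual to `x`, so `u (ε, n)` passes `u x` without a constant term.
      refine ⟨R + x.2.natAbs + 1, fun ε n hn => ?_⟩
      rw [hF.rel_apply, hR ε n (by omega), map_zero, smul_zero, zero_add,
        pairing_of_ne_dual, zero_smul]
      rintro rfl
      simp only [Letter.dual] at hn
      omega
  have : v ∈ S := hS ▸ Submodule.mem_top
  exact this

/-- The `i`-th term, with `N = n + i`, of the product of two generating fields (or a derivative). -/
def pairTerm (k : Kind) (u : Letter → Module.End ℂ M) (H : ℤ → ℂ) (N : ℤ) : Module.End ℂ M :=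
  locSum fun j : ℕ => altChoose N j •
    (H (N - j) • plusMinus u (N - j) - ((-1 : ℂ) ^ N * k.sgn) • H j • minusPlus u j)

/-- `H` records the coefficients of the second field: it is 1 with `e = 0` for the generating field,
and `r - 1/2` with `e = 1` for its derivative. The index `e - n - 1` is the one at which only the
products `u⁺(r) u⁻(-r)`, in either order, occur. -/
theorem nthProdOn_pair (H : ℤ → ℂ) (n e : ℤ) (f : ℚ → Module.End ℂ M)
    (hf : ∀ a : ℤ, f (a - 1 / 2) = H (e - a) • u (false, a - e)) :
    nthProdOn k .twisted u true n 1 f ((e - n - 1 : ℤ) : ℚ) =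
      locSum fun i : ℕ => ((Ring.choose (1 / 2 : ℚ) i : ℚ) : ℂ) • pairTerm k u H (n + i) := by
  rw [nthProdOn_twisted]
  congr 1; funext i
  rw [pairTerm]
  congr 2; funext j
  have e1 : ((e - n - 1 : ℤ) : ℚ) - i + 1 / 2 + j = ((e - (n + i - j) : ℤ) : ℚ) - 1 / 2 := by
    push_cast; ring
  have e2 : (n : ℚ) + ((e - n - 1 : ℤ) : ℚ) + 1 / 2 - j = ((e - j : ℤ) : ℚ) - 1 / 2 := by
    push_cast; ring
  rw [e1, e2, hf, hf, plusMinus, minusPlus, pow_one]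
  rw [show e - (n + i - j) - e = -(n + i - j) by ring, show e - (e - (n + i - j)) = n + i - j by ring,
    show e - (j : ℤ) - e = -j by ring, show e - (e - (j : ℤ)) = j by ring, mul_smul_comm,
    smul_mul_assoc]

/-- Both sums are finite, and after exchanging the factors of `plusMinus` their quadratic parts
cancel by `j ↦ p - j`. What remains is `-sgn` times the `p`-th finite difference of `H` at 0. It
vanishes for `p ≥ 1` if `H` is constant and for `p ≥ 2` if `H` is linear, so the sum over `i` stops
and only contributes a vacuum eigenvalue. -/
theorem pairTerm_natCast (hF : IsFock k .twisted u v₀) (H : ℤ → ℂ) (p : ℕ) :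
    pairTerm k u H p =
      (-k.sgn * ∑ j ∈ Finset.range (p + 1), (-1) ^ j * (p.choose j : ℂ) * H (p - j)) • 1 := by
  rw [pairTerm, locSum_eq_sum (Finset.range (p + 1))]
  · have h1 : ∀ j : ℕ, altChoose p j •
        (H (p - j) • plusMinus u (p - j) - ((-1 : ℂ) ^ (p : ℤ) * k.sgn) • H j • minusPlus u j) =
        ((-1) ^ j * (p.choose j : ℂ) * H (p - j) * k.sgn) • minusPlus u (p - j)
        - ((-1) ^ j * (p.choose j : ℂ) * (-1) ^ p * k.sgn * H j) • minusPlus u j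
        + (-k.sgn * ((-1) ^ j * (p.choose j : ℂ) * H (p - j))) • (1 : Module.End ℂ M) := by
      intro j
      rw [plusMinus_eq hF, altChoose_natCast, zpow_natCast]
      module
    simp only [h1]
    rw [Finset.sum_add_distrib, Finset.sum_sub_distrib, ← Finset.sum_smul, ← Finset.mul_sum]
    convert zero_add _
    rw [sub_eq_zero, ← Finset.sum_range_reflect]
    refine Finset.sum_congr rfl fun j hj => ?_
    have hj : j ≤ p := Nat.lt_succ_iff.1 (Finset.mem_range.1 hj)
    rw [show p + 1 - 1 - j = p - j by omega, Nat.cast_sub hj, sub_sub_cancel, Nat.choose_symm hj]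
    obtain ⟨r, rfl⟩ := Nat.exists_eq_add_of_le hj
    rw [Nat.add_sub_cancel_left, pow_add]
    have h2 : (-1 : ℂ) ^ j * (-1) ^ j = 1 := by rw [← mul_pow]; simp
    congr 1
    linear_combination -(-1) ^ r * ((j + r).choose j : ℂ) * k.sgn * H j * h2
  · intro j hj
    rw [Finset.mem_range] at hj
    rw [altChoose_natCast, Nat.choose_eq_zero_of_lt (by omega)]
    simp

theorem pairTerm_natCast_one (hF : IsFock k .twisted u v₀) (p : ℕ) :
    pairTerm k u (fun _ => 1) p = (if p = 0 then -k.sgn else 0 : ℂ) • 1 := by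
  rw [pairTerm_natCast hF]
  congr 1
  split_ifs with h
  · subst h; simp
  · simp [sum_alternating_choose p h]

theorem pairTerm_natCast_linear (hF : IsFock k .twisted u v₀) (p : ℕ) :
    pairTerm k u (fun r => r - 1 / 2) p =
      (if p = 0 then k.sgn / 2 else if p = 1 then -k.sgn else 0 : ℂ) • 1 := by
  rw [pairTerm_natCast hF]
  congr 1
  split_ifs with h h
  · subst h; simp
    ring
  · subst h; simp [Finset.sum_range_succ]
  · push_cast
    simp only [mul_sub, Finset.sum_sub_distrib, ← Finset.sum_mul] at *
    have h1 := sum_alternating_choose p (by omega)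
    have h2 := sum_alternating_choose_mul p (by omega)
    simp only [mul_sub, Finset.sum_sub_distrib, ← Finset.sum_mul] at h2
    linear_combination (-k.sgn) * h2 + k.sgn / 2 * h1

theorem plusMinus_fockBasis (hF : IsFock k .twisted u v₀) (j : ℕ) (F : Idx k) :
    plusMinus u (-1 - j) (fockBasis hF F) = (F.1 (true, j) : ℂ) • fockBasis hF F := by
  have h := numberOp_fockBasis hF (true, j) F
  have hf : k.form false true = 1 := by cases k <;> rfl
  simpa [numberOp, hf, Mo.letter, Letter.dual, plusMinus] using h

theorem minusPlus_fockBasis (hF : IsFock k .twisted u v₀) (j : ℕ) (F : Idx k) :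
    minusPlus u j (fockBasis hF F) = (-k.sgn * F.1 (false, j) : ℂ) • fockBasis hF F := by
  have h := numberOp_fockBasis hF (false, j) F
  have hf : (k.form true false)⁻¹ = -k.sgn := by cases k <;> simp [Kind.form, Kind.sgn]
  simp only [numberOp, Mo.letter, Letter.dual, Bool.not_false, hf, LinearMap.smul_apply,
    Bool.false_eq_true, if_false, neg_neg] at h
  have h2 := congrArg (fun w => -k.sgn • w) h
  simp only [smul_smul, neg_mul_neg, sgn_mul_self, one_smul] at h2
  exact h2

/-- A weighted number of modes. -/
def weightSum (α β : ℕ → ℂ) (F : Mo →₀ ℕ) : ℂ :=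
  F.sum fun i c => (c : ℂ) * if i.1 then α i.2 else β i.2

theorem weightSum_add (α β : ℕ → ℂ) (F G : Mo →₀ ℕ) :
    weightSum α β (F + G) = weightSum α β F + weightSum α β G := by
  rw [weightSum, Finsupp.sum_add_index'] <;> intros <;> simp [weightSum]
  split_ifs <;> ring

theorem finite_support_weight (α β : ℕ → ℂ) (F : Mo →₀ ℕ) :
    (Function.support fun j => α j * F (true, j) + β j * F (false, j)).Finite := by
  refine (F.support.image Prod.snd).finite_toSet.subset fun j hj => ?_
  by_contra h
  simp only [Finset.coe_image, Set.mem_image, Finset.mem_coe, Finsupp.mem_support_iff, not_exists,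
    not_and] at h
  have h1 : F (true, j) = 0 := by by_contra h1; exact h _ h1 rfl
  have h2 : F (false, j) = 0 := by by_contra h1; exact h _ h1 rfl
  exact hj (by simp [h1, h2])

theorem finsum_weight (α β : ℕ → ℂ) (F : Mo →₀ ℕ) :
    ∑ᶠ j, (α j * F (true, j) + β j * F (false, j)) = weightSum α β F := by
  induction F using Finsupp.induction_linear with
  | zero => simp [weightSum]
  | add F G hF hG =>
    rw [weightSum_add, ← hF, ← hG, ← finsum_add_distrib (finite_support_weight α β F)
      (finite_support_weight α β G)]
    refine finsum_congr fun j => ?_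
    simp only [Finsupp.add_apply]
    push_cast
    ring
  | single i c =>
    rw [weightSum, Finsupp.sum_single_index (by simp)]
    rcases i with ⟨_ | _, n⟩
    · rw [finsum_eq_single _ n fun j hj => ?_]
      · simp [mul_comm]
      · simp [hj.symm]
    · rw [finsum_eq_single _ n fun j hj => ?_]
      · simp [mul_comm]
      · simp [hj.symm]

/-- For `N < 0` all products are already ordered with the annihilating mode on the right, so they
are multiples of number operators. The mode `u⁺(N - j)` has index `j - 1 - N` in `Mo`, whence the
shift in `hα`. -/
theorem pairTerm_negative (hF : IsFock k .twisted u v₀) (H : ℤ → ℂ) (N : ℤ) (hN : N < 0) (F : Idx k)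
    (α β : ℕ → ℂ) (hα : ∀ j : ℕ, ∀ l : ℕ, (l : ℤ) = j - 1 - N → α l = altChoose N j * H (N - j))
    (hα0 : ∀ l : ℕ, (l : ℤ) < -1 - N → α l = 0)
    (hβ : ∀ j : ℕ, β j = (-1) ^ N * altChoose N j * H j) :
    pairTerm k u H N (fockBasis hF F) = weightSum α β F.1 • fockBasis hF F := by
  have hfin : ∀ v, (Function.support fun j : ℕ => (altChoose N j •
      (H (N - j) • plusMinus u (N - j) - ((-1 : ℂ) ^ N * k.sgn) • H j • minusPlus u j)) v).Finite := by
    intro v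
    obtain ⟨R, hR⟩ := eventually_annihilates hF v
    refine (Finset.range R).finite_toSet.subset fun j hj => ?_
    by_contra h
    simp only [Finset.coe_range, Set.mem_Iio, not_lt] at h
    refine hj ?_
    have h1 : plusMinus u (N - j) v = 0 := by
      rw [plusMinus, Module.End.mul_apply, hR false _ (by omega), map_zero]
    have h2 : minusPlus u j v = 0 := by
      rw [minusPlus, Module.End.mul_apply, hR true _ (by omega), map_zero]
    simp [h1, h2]
  -- The modes `u⁺(-1), …, u⁺(-d)` do not occur in the sum; `hα0` gives them weight 0, so the sum
  -- may be extended to all modes.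
  obtain ⟨d, rfl⟩ : ∃ d : ℕ, N = -1 - d := ⟨(-1 - N).toNat, by omega⟩
  have hterm : ∀ j : ℕ, (altChoose (-1 - d) j • (H (-1 - d - j) • plusMinus u (-1 - d - j)
        - ((-1 : ℂ) ^ (-1 - d : ℤ) * k.sgn) • H j • minusPlus u j)) (fockBasis hF F) =
      (α (j + d) * F.1 (true, j + d) + β j * F.1 (false, j)) • fockBasis hF F := by
    intro j
    rw [hα j (j + d) (by push_cast; ring), hβ]
    have h1 := plusMinus_fockBasis hF (j + d) F
    rw [show (-1 - ((j + d : ℕ) : ℤ)) = -1 - d - j by push_cast; ring] at h1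
    simp only [LinearMap.smul_apply, LinearMap.sub_apply, h1, minusPlus_fockBasis hF j F, smul_smul,
      ← sub_smul]
    congr 1
    linear_combination (altChoose (-1 - d) j * (-1 : ℂ) ^ (-1 - d : ℤ) * H j * F.1 (false, j)) *
      sgn_mul_self k
  rw [pairTerm, locSum_apply hfin]
  simp only [hterm]
  rw [← finsum_smul]
  congr 1
  have f1 : (Function.support fun j => α j * F.1 (true, j)).Finite := by
    simpa using finite_support_weight α 0 F.1
  have f2 : (Function.support fun j => β j * F.1 (false, j)).Finite := by
    simpa using finite_support_weight 0 β F.1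
  have f3 : (Function.support fun j => α (j + d) * F.1 (true, j + d)).Finite :=
    f1.preimage (f := fun j => j + d) (fun a _ b _ h => by simpa using h)
  rw [← finsum_weight, finsum_add_distrib f3 f2, finsum_add_distrib f1 f2]
  congr 1
  obtain ⟨R, hR⟩ : ∃ R, ∀ j, F.1 (true, j) ≠ 0 → j < R := by
    refine ⟨(F.1.support.image Prod.snd).sup id + 1, fun j hj => Nat.lt_succ_of_le ?_⟩
    exact Finset.le_sup (f := id) (Finset.mem_image.2 ⟨(true, j), by simpa using hj, rfl⟩)
  rw [finsum_eq_sum_of_support_subset (s := Finset.range R),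
    finsum_eq_sum_of_support_subset (s := Finset.range (d + R)),
    Finset.sum_range_add (fun j => α j * (F.1 (true, j) : ℂ)) d R]
  · rw [Finset.sum_eq_zero (s := Finset.range d) fun l hl => ?_, zero_add]
    · simp only [add_comm]
    · rw [hα0 l (by have := Finset.mem_range.1 hl; omega), zero_mul]
  · intro j hj
    have := hR j fun h => hj (by simp [h])
    simp
    omega
  · intro j hj
    have := hR (j + d) fun h => hj (by simp [h])
    simp
    omega

/-- The charge: the number of modes `u⁺` minus the number of modes `u⁻`. -/
def charge (F : Mo →₀ ℕ) : ℤ := F.sum fun i c => c * if i.1 then 1 else -1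

/-- The energy: the sum of the `-r` over the modes `u(r)`. -/
def energy (F : Mo →₀ ℕ) : ℕ := F.sum fun i c => c * if i.1 then i.2 + 1 else i.2

theorem weightSum_charge (F : Mo →₀ ℕ) : weightSum (fun _ => 1) (fun _ => -1) F = charge F := by
  simp [weightSum, charge, Finsupp.sum]

theorem weightSum_energy (F : Mo →₀ ℕ) : weightSum (fun j => j + 1) (fun j => j) F = energy F := by
  simp [weightSum, energy, Finsupp.sum]

/-- The term `i = 0` counts charge. The term `i = 1` is `C(1/2, 1) · (-sgn)`, the vacuum charge of
the twisted sector, and all later ones vanish. -/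
theorem jField_fockBasis (hF : IsFock k .twisted u v₀) (F : Idx k) :
    wordFieldOn k .twisted u [(true, -1), (false, -1)] 0 (fockBasis hF F) =
      (charge F.1 - k.sgn / 2 : ℂ) • fockBasis hF F := by
  have h := nthProdOn_pair (k := k) (u := u) (fun _ => 1) (-1) 0
    (wordFieldOn k .twisted u [(false, -1)])
    (fun a => by rw [wordFieldOn_generator, one_smul, sub_zero])
  simp only [sub_neg_eq_add, zero_add, sub_self, Int.cast_zero] at h
  change nthProdOn k .twisted u true (-1) 1 (wordFieldOn k .twisted u [(false, -1)]) 0 _ = _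
  rw [h, locSum_eq_sum (Finset.range 2)]
  · have h1 := pairTerm_negative hF (fun _ => 1) (-1) (by norm_num) F (fun _ => 1) (fun _ => -1)
      (fun j l _ => by rw [altChoose_neg_one, one_mul]) (fun l hl => by omega)
      (fun j => by rw [altChoose_neg_one]; norm_num)
    have h2 := pairTerm_natCast_one hF 0
    simp only [Finset.sum_range_succ, Finset.sum_range_zero, zero_add, Nat.cast_zero, add_zero,
      Nat.cast_one, Ring.choose_zero_right, Ring.choose_one_right, neg_add_cancel] at h1 h2 ⊢
    rw [h2, LinearMap.add_apply, LinearMap.smul_apply, h1, weightSum_charge]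
    simp only [if_true, LinearMap.smul_apply, Module.End.one_apply]
    push_cast
    module
  · intro i hi
    rw [Finset.mem_range] at hi
    rw [show (-1 : ℤ) + i = ((i - 1 : ℕ) : ℤ) by omega, pairTerm_natCast_one hF, if_neg (by omega),
      zero_smul, smul_zero]

/-- The weights are `(j, j + 1)` from `i = 0` plus `½ (1, -1)` from `i = 1`; the constant is `C(1/2,
2) · (-sgn)` from `i = 2`. -/
theorem omegaField_first_fockBasis (hF : IsFock k .twisted u v₀) (F : Idx k) :
    wordFieldOn k .twisted u [(true, -2), (false, -1)] 1 (fockBasis hF F) =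
      (weightSum (fun j => j + 1 / 2) (fun j => j + 1 / 2) F.1 + k.sgn / 8 : ℂ) •
        fockBasis hF F := by
  have h := nthProdOn_pair (k := k) (u := u) (fun _ => 1) (-2) 0
    (wordFieldOn k .twisted u [(false, -1)])
    (fun a => by rw [wordFieldOn_generator, one_smul, sub_zero])
  rw [show (((0 : ℤ) - -2 - 1 : ℤ) : ℚ) = 1 by norm_num] at h
  change nthProdOn k .twisted u true (-2) 1 (wordFieldOn k .twisted u [(false, -1)]) 1 _ = _
  rw [h, locSum_eq_sum (Finset.range 3)]
  · have h1 := pairTerm_negative hF (fun _ => 1) (-1) (by norm_num) F (fun _ => 1) (fun _ => -1)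
      (fun j l _ => by rw [altChoose_neg_one, one_mul]) (fun l hl => by omega)
      (fun j => by rw [altChoose_neg_one]; norm_num)
    have h1' := pairTerm_negative hF (fun _ => 1) (-2) (by norm_num) F (fun j => j) (fun j => j + 1)
      (fun j l hl => by
        rw [altChoose_neg_two, mul_one]
        have : l = j + 1 := by omega
        subst this; push_cast; rfl)
      (fun l hl => by
        have : l = 0 := by omega
        subst this; exact Nat.cast_zero)
      (fun j => by rw [altChoose_neg_two]; norm_num)
    have h2 := pairTerm_natCast_one hF 0
    simp only [Finset.sum_range_succ, Finset.sum_range_zero, zero_add, Nat.cast_zero, add_zero,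
      Nat.cast_one, Ring.choose_zero_right, Ring.choose_one_right, Nat.cast_ofNat, neg_add_cancel,
      choose_half_two, show (-2 : ℤ) + 1 = -1 by norm_num] at h1 h2 ⊢
    rw [h2, LinearMap.add_apply, LinearMap.add_apply, LinearMap.smul_apply, LinearMap.smul_apply,
      h1, h1']
    simp only [if_true, LinearMap.smul_apply, Module.End.one_apply, smul_smul, ← add_smul]
    congr 1
    simp only [weightSum, Finsupp.sum]
    push_cast
    rw [one_mul, Finset.mul_sum, ← Finset.sum_add_distrib]
    congr 1
    · refine Finset.sum_congr rfl fun i _ => ?_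
      split_ifs <;> ring
    · ring
  · intro i hi
    rw [Finset.mem_range] at hi
    rw [show (-2 : ℤ) + i = ((i - 2 : ℕ) : ℤ) by omega, pairTerm_natCast_one hF, if_neg (by omega),
      zero_smul, smul_zero]

/-- Here only `i = 0` has an operator part. The constant is `½ · sgn/2 + (-1/8) · (-sgn)`, from `i =
1` and `i = 2`. -/
theorem omegaField_second_fockBasis (hF : IsFock k .twisted u v₀) (F : Idx k) :
    wordFieldOn k .twisted u [(true, -1), (false, -2)] 1 (fockBasis hF F) =
      (weightSum (fun j => -j - 3 / 2) (fun j => 1 / 2 - j) F.1 + 3 * k.sgn / 8 : ℂ) •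
        fockBasis hF F := by
  have h := nthProdOn_pair (k := k) (u := u) (fun r => r - 1 / 2) (-1) 1
    (wordFieldOn k .twisted u [(false, -2)])
    (fun a => by rw [wordFieldOn_derivative]; congr 1; push_cast; ring)
  rw [show (((1 : ℤ) - -1 - 1 : ℤ) : ℚ) = 1 by norm_num] at h
  change nthProdOn k .twisted u true (-1) 1 (wordFieldOn k .twisted u [(false, -2)]) 1 _ = _
  rw [h, locSum_eq_sum (Finset.range 3)]
  · have h1 := pairTerm_negative hF (fun r => r - 1 / 2) (-1) (by norm_num) F
      (fun j => -j - 3 / 2) (fun j => 1 / 2 - j)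
      (fun j l hl => by
        have : l = j := by omega
        subst this
        rw [altChoose_neg_one]; push_cast; ring)
      (fun l hl => by omega)
      (fun j => by rw [altChoose_neg_one]; push_cast; norm_num)
    have h2 := pairTerm_natCast_linear hF 0
    have h3 := pairTerm_natCast_linear hF 1
    simp only [Finset.sum_range_succ, Finset.sum_range_zero, zero_add, Nat.cast_zero, add_zero,
      Nat.cast_one, Ring.choose_zero_right, Ring.choose_one_right, Nat.cast_ofNat, neg_add_cancel,
      choose_half_two, show (-1 : ℤ) + 2 = 1 by norm_num] at h1 h2 h3 ⊢
    rw [h2, h3, LinearMap.add_apply, LinearMap.add_apply, LinearMap.smul_apply, h1]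
    simp only [if_true, LinearMap.smul_apply, Module.End.one_apply, smul_smul, ← add_smul,
      one_ne_zero, if_false]
    congr 1
    push_cast
    ring
  · intro i hi
    rw [Finset.mem_range] at hi
    rw [show (-1 : ℤ) + i = ((i - 1 : ℕ) : ℤ) by omega, pairTerm_natCast_linear hF,
      if_neg (by omega), if_neg (by omega), zero_smul, smul_zero]

end PairFields

/-! ## The action of the torus -/

section Scale

theorem scaleOp_vac (k : Kind) (s : Sector) (c : ℂˣ) : scaleOp k s c (vac k s) = vac k s := by
  change (annIdeal k s).mkQ (scaleAlg k s c 1) = _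
  rw [map_one]
  rfl

theorem scaleOp_modeOp (k : Kind) (s : Sector) (c : ℂˣ) (x : Letter) (v : Fock k s) :
    scaleOp k s c (modeOp k s x v) = letterScalar c x • modeOp k s x (scaleOp k s c v) := by
  obtain ⟨a, rfl⟩ := (annIdeal k s).mkQ_surjective v
  change (annIdeal k s).mkQ (scaleAlg k s c (mode k s x * a)) =
    (annIdeal k s).mkQ (letterScalar c x • (mode k s x * scaleAlg k s c a))
  rw [map_mul, scaleAlg_mode, smul_mul_assoc]

theorem scale_wordVec {M : Type*} [AddCommGroup M] [Module ℂ M] {u : Letter → Module.End ℂ M}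
    {v₀ : M} {T : Module.End ℂ M} {c : ℂˣ} (h0 : T v₀ = v₀)
    (h : ∀ x v, T (u x v) = letterScalar c x • u x (T v)) (w : List Letter) :
    T (wordVec u v₀ w) = (w.map (letterScalar c)).prod • wordVec u v₀ w := by
  induction w with
  | nil => simp [h0]
  | cons x w ih =>
    rw [wordVec_cons, h, ih, map_smul, smul_smul, List.map_cons, List.prod_cons]

theorem prod_letterScalar_wordOf (c : ℂˣ) (F : Mo →₀ ℕ) :
    ((wordOf F).map (letterScalar c)).prod = (c : ℂ) ^ charge F := by
  have h1 : ∀ i : Mo, letterScalar c i.letter = (c : ℂ) ^ (if i.1 then (1 : ℤ) else -1) := by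
    rintro ⟨_ | _, n⟩ <;> simp [letterScalar, Mo.letter]
  have h2 : ((wordOf F).map (letterScalar c)).prod =
      (F.toMultiset.map fun i : Mo => letterScalar c i.letter).prod := by
    rw [wordOf, List.map_map, ← Multiset.prod_coe, ← Multiset.map_coe, Multiset.coe_toList]
    rfl
  rw [h2]
  clear h2
  induction F using Finsupp.induction_linear with
  | zero => simp [charge]
  | add F G hF hG =>
    have : charge (F + G) = charge F + charge G := by
      rw [charge, Finsupp.sum_add_index'] <;> intros <;> simp [charge]
      split_ifs <;> ring
    rw [map_add, Multiset.map_add, Multiset.prod_add, hF, hG, this, zpow_add₀ c.ne_zero]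
  | single i n =>
    rw [charge, Finsupp.sum_single_index (by simp), Finsupp.toMultiset_single, Multiset.map_nsmul,
      Multiset.map_singleton, Multiset.prod_nsmul, Multiset.prod_singleton, h1, ← zpow_natCast,
      ← zpow_mul, mul_comm]

/-- The monomial basis of a twisted module. -/
def twBasis (k : Kind) : Module.Basis (Idx k) ℂ (Fock k .twisted) := fockBasis (isFock k .twisted)

theorem scaleOp_twBasis (k : Kind) (c : ℂˣ) (F : Idx k) :
    scaleOp k .twisted c (twBasis k F) = (c : ℂ) ^ charge F.1 • twBasis k F := by
  rw [twBasis, fockBasis_apply,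
    scale_wordVec (scaleOp_vac k .twisted c) (scaleOp_modeOp k .twisted c),
    prod_letterScalar_wordOf]

/-- It removes the Koszul sign from `Quad.field` on the states needed here: their second word has
length 0 or 2. -/
theorem scaleOp_neg_one_sq (k : Kind) : scaleOp k .twisted (-1) ^ 2 = 1 := by
  refine (twBasis k).ext fun F => ?_
  rw [pow_two, Module.End.mul_apply, scaleOp_twBasis, map_smul, scaleOp_twBasis]
  have h : (((-1 : ℂˣ) : ℂ) ^ charge F.1) * ((-1 : ℂˣ) : ℂ) ^ charge F.1 = 1 := by
    rw [← mul_zpow]; norm_num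
  exact ((smul_smul _ _ (twBasis k F)).trans (congrArg (· • twBasis k F) h)).trans (one_smul ℂ _)

end Scale

/-! ## Vertex operators on the tensor product -/

section Tensor

theorem linearIndepOn_wordState (k : Kind) : LinearIndepOn ℂ (wordState k) {w | IsOrdered k w} :=
  linearIndependent_ordered (isFock k .untwisted)

theorem linearIndepOn_quadState : LinearIndepOn ℂ Quad.state {w | w.IsOrdered} :=
  (linearIndepOn_wordState .clifford).tmul_of_flat_left <|
    (linearIndepOn_wordState .clifford).tmul_of_flat_left <|
      (linearIndepOn_wordState .weyl).tmul_of_flat_left (linearIndepOn_wordState .weyl)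

/-- By independence of the ordered monomials the chosen inverse is a true left inverse, so `Y` can
be read off from any explicit ordered expression. -/
theorem expand_linearCombination (c : Quad →₀ ℂ) (hc : ∀ w ∈ c.support, w.IsOrdered) :
    expand (Finsupp.linearCombination ℂ Quad.state c) = c := by
  have hinj : Set.InjOn (Finsupp.linearCombination ℂ Quad.state)
      {c : Quad →₀ ℂ | ∀ w ∈ c.support, w.IsOrdered} := by
    intro a ha b hb hab
    have h := linearIndepOn_iff.1 linearIndepOn_quadState (a - b)
      ((Finsupp.supported ℂ ℂ {w : Quad | w.IsOrdered}).sub_mem ha hb)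
      (by rw [map_sub, hab, sub_self])
    exact sub_eq_zero.1 h
  exact hinj.leftInvOn_invFunOn hc

theorem Y_linearCombination (s : Sector) (c : Quad →₀ ℂ) (hc : ∀ w ∈ c.support, w.IsOrdered)
    (m : ℚ) : Y s (Finsupp.linearCombination ℂ Quad.state c) m =
      Finsupp.linearCombination ℂ (fun w => Quad.field s w m) c := by
  rw [Y, expand_linearCombination c hc]
  rfl

theorem Y_sum {ι : Type*} (s : Sector) (t : Finset ι) (a : ι → ℂ) (w : ι → Quad)
    (hw : ∀ i ∈ t, (w i).IsOrdered) (m : ℚ) :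
    Y s (∑ i ∈ t, a i • (w i).state) m = ∑ i ∈ t, a i • Quad.field s (w i) m := by
  classical
  have h := Y_linearCombination s (∑ i ∈ t, Finsupp.single (w i) (a i)) (fun x hx => ?_) m
  · simpa only [map_sum, Finsupp.linearCombination_single] using h
  · obtain ⟨i, hi, hix⟩ := Finset.mem_biUnion.1 (Finsupp.support_finsetSum hx)
    rw [Finset.mem_singleton.1 (Finsupp.support_single_subset hix)]
    exact hw i hi

variable {f₁ f₂ : Module.End ℂ (Fock .clifford .twisted)} {f₃ f₄ : Module.End ℂ (Fock .weyl .twisted)}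

theorem tensorOp_zero₁ : tensorOp 0 f₂ f₃ f₄ = 0 := TensorProduct.map_zero_left _

theorem tensorOp_zero₂ : tensorOp f₁ 0 f₃ f₄ = 0 := by
  rw [tensorOp, TensorProduct.map_zero_left, TensorProduct.map_zero_right]

theorem tensorOp_zero₃ : tensorOp f₁ f₂ 0 f₄ = 0 := by
  rw [tensorOp, TensorProduct.map_zero_left, TensorProduct.map_zero_right,
    TensorProduct.map_zero_right]

theorem tensorOp_zero₄ : tensorOp f₁ f₂ f₃ 0 = 0 := by
  rw [tensorOp, TensorProduct.map_zero_right, TensorProduct.map_zero_right,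
    TensorProduct.map_zero_right]

theorem wordField_nil_self (k : Kind) (s : Sector) : wordField k s [] (-1) = 1 := by
  simp [wordField]

theorem wordField_nil_of_ne (k : Kind) (s : Sector) {m : ℚ} (h : m ≠ -1) :
    wordField k s [] m = 0 := by
  simp [wordField, h]

/-- The field of the vacuum is supported at index `-1`. With three vacuum factors a single
distribution of the indices survives, and the `3` in `m - 3` makes the fourth index come out as `m`.
-/
theorem field₁ (w : List Letter) (m : ℚ) :
    Quad.field .twisted (w, [], [], []) m = tensorOp (wordField .clifford .twisted w m) 1 1 1 := by
  rw [Quad.field, locSum_eq_single (m, -1, -1)]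
  · rw [show m - 3 - m - -1 - -1 = (-1 : ℚ) by ring]
    simp only [wordField_nil_self, List.length_nil, pow_zero, mul_one]
  · rintro ⟨r₁, r₂, r₃⟩ hr
    dsimp only
    by_cases h2 : r₂ = -1
    · by_cases h3 : r₃ = -1
      · rw [wordField_nil_of_ne .weyl _ (m := m - 3 - r₁ - r₂ - r₃), tensorOp_zero₄]
        intro h4
        exact hr (by rw [h2, h3] at h4 ⊢; rw [show r₁ = m by linarith])
      · rw [wordField_nil_of_ne .weyl _ h3, tensorOp_zero₃]
    · rw [wordField_nil_of_ne .clifford _ h2, tensorOp_zero₂]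

theorem field₂ (w : List Letter) (hw : w.length = 2) (m : ℚ) :
    Quad.field .twisted ([], w, [], []) m = tensorOp 1 (wordField .clifford .twisted w m) 1 1 := by
  rw [Quad.field, locSum_eq_single (-1, m, -1)]
  · rw [show m - 3 - -1 - m - -1 = (-1 : ℚ) by ring]
    simp only [wordField_nil_self, hw, scaleOp_neg_one_sq, mul_one]
  · rintro ⟨r₁, r₂, r₃⟩ hr
    dsimp only
    by_cases h2 : r₁ = -1
    · by_cases h3 : r₃ = -1
      · rw [wordField_nil_of_ne .weyl _ (m := m - 3 - r₁ - r₂ - r₃), tensorOp_zero₄]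
        intro h4
        exact hr (by rw [h2, h3] at h4 ⊢; rw [show r₂ = m by linarith])
      · rw [wordField_nil_of_ne .weyl _ h3, tensorOp_zero₃]
    · rw [wordField_nil_of_ne .clifford _ h2, zero_mul, tensorOp_zero₁]

theorem field₃ (w : List Letter) (m : ℚ) :
    Quad.field .twisted ([], [], w, []) m = tensorOp 1 1 (wordField .weyl .twisted w m) 1 := by
  rw [Quad.field, locSum_eq_single (-1, -1, m)]
  · rw [show m - 3 - -1 - -1 - m = (-1 : ℚ) by ring]
    simp only [wordField_nil_self, List.length_nil, pow_zero, mul_one]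
  · rintro ⟨r₁, r₂, r₃⟩ hr
    dsimp only
    by_cases h2 : r₁ = -1
    · by_cases h3 : r₂ = -1
      · rw [wordField_nil_of_ne .weyl _ (m := m - 3 - r₁ - r₂ - r₃), tensorOp_zero₄]
        intro h4
        exact hr (by rw [h2, h3] at h4 ⊢; rw [show r₃ = m by linarith])
      · rw [wordField_nil_of_ne .clifford _ h3, tensorOp_zero₂]
    · rw [wordField_nil_of_ne .clifford _ h2, zero_mul, tensorOp_zero₁]

theorem field₄ (w : List Letter) (m : ℚ) :
    Quad.field .twisted ([], [], [], w) m = tensorOp 1 1 1 (wordField .weyl .twisted w m) := by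
  rw [Quad.field, locSum_eq_single (-1, -1, -1)]
  · rw [show m - 3 - -1 - -1 - -1 = (m : ℚ) by ring]
    simp only [wordField_nil_self, List.length_nil, pow_zero, mul_one]
  · rintro ⟨r₁, r₂, r₃⟩ hr
    dsimp only
    by_cases h2 : r₁ = -1
    · by_cases h3 : r₂ = -1
      · rw [wordField_nil_of_ne .weyl _ (m := r₃), tensorOp_zero₃]
        intro h4
        exact hr (by rw [h2, h3, h4])
      · rw [wordField_nil_of_ne .clifford _ h3, tensorOp_zero₂]
    · rw [wordField_nil_of_ne .clifford _ h2, zero_mul, tensorOp_zero₁]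

/-- The index set of the monomial basis of the tensor product of the twisted modules. -/
abbrev QIdx := Idx .clifford × Idx .clifford × Idx .weyl × Idx .weyl

/-- The monomial basis of the tensor product of the twisted modules. -/
def wBasis : Module.Basis QIdx ℂ (W .twisted) :=
  (twBasis .clifford).tensorProduct <| (twBasis .clifford).tensorProduct <|
    (twBasis .weyl).tensorProduct (twBasis .weyl)

theorem wBasis_apply (x : QIdx) : wBasis x = twBasis .clifford x.1 ⊗ₜ[ℂ]
    (twBasis .clifford x.2.1 ⊗ₜ[ℂ] (twBasis .weyl x.2.2.1 ⊗ₜ[ℂ] twBasis .weyl x.2.2.2)) := by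
  simp [wBasis, Module.Basis.tensorProduct_apply']

theorem tensorOp_wBasis {a₁ a₂ a₃ a₄ : ℂ} {x : QIdx}
    (h₁ : f₁ (twBasis _ x.1) = a₁ • twBasis _ x.1) (h₂ : f₂ (twBasis _ x.2.1) = a₂ • twBasis _ x.2.1)
    (h₃ : f₃ (twBasis _ x.2.2.1) = a₃ • twBasis _ x.2.2.1)
    (h₄ : f₄ (twBasis _ x.2.2.2) = a₄ • twBasis _ x.2.2.2) :
    tensorOp f₁ f₂ f₃ f₄ (wBasis x) = (a₁ * a₂ * a₃ * a₄) • wBasis x := by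
  rw [wBasis_apply, tensorOp, TensorProduct.map_tmul, TensorProduct.map_tmul,
    TensorProduct.map_tmul, h₁, h₂, h₃, h₄]
  simp only [TensorProduct.smul_tmul_smul]
  congr 1
  ring

end Tensor

/-! ## The zero modes in the monomial basis -/

section ZeroModes

theorem wordField_j_twBasis (k : Kind) (F : Idx k) :
    wordField k .twisted [(true, -1), (false, -1)] 0 (twBasis k F) =
      (charge F.1 - k.sgn / 2 : ℂ) • twBasis k F := by
  rw [wordField_eq]
  exact jField_fockBasis (isFock k .twisted) F

theorem wordField_omega₁_twBasis (k : Kind) (F : Idx k) :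
    wordField k .twisted [(true, -2), (false, -1)] 1 (twBasis k F) =
      (weightSum (fun j => j + 1 / 2) (fun j => j + 1 / 2) F.1 + k.sgn / 8 : ℂ) • twBasis k F := by
  rw [wordField_eq]
  exact omegaField_first_fockBasis (isFock k .twisted) F

theorem wordField_omega₂_twBasis (k : Kind) (F : Idx k) :
    wordField k .twisted [(true, -1), (false, -2)] 1 (twBasis k F) =
      (weightSum (fun j => -j - 3 / 2) (fun j => 1 / 2 - j) F.1 + 3 * k.sgn / 8 : ℂ) •
        twBasis k F := by
  rw [wordField_eq]
  exact omegaField_second_fockBasis (isFock k .twisted) F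

theorem weightSum_omega (F : Mo →₀ ℕ) :
    1 / 2 * weightSum (fun j => j + 1 / 2) (fun j => j + 1 / 2) F
      - 1 / 2 * weightSum (fun j => -j - 3 / 2) (fun j => 1 / 2 - j) F = energy F := by
  rw [← weightSum_energy]
  simp only [weightSum, Finsupp.sum]
  rw [Finset.mul_sum, Finset.mul_sum, ← Finset.sum_sub_distrib]
  refine Finset.sum_congr rfl fun i _ => ?_
  split_ifs <;> ring

theorem one_twBasis (k : Kind) (F : Idx k) :
    (1 : Module.End ℂ (Fock k .twisted)) (twBasis k F) = (1 : ℂ) • twBasis k F :=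
  (one_smul ℂ (twBasis k F)).symm

theorem isOrdered_pair (k : Kind) {a b : ℤ} (ha : a < 0) (hb : b < 0) :
    IsOrdered k [(true, a), (false, b)] := by
  refine ⟨fun x hx => ?_, by simp [Kind.precedes]⟩
  rw [isAnnihilator_iff]
  simp only [List.mem_cons, List.not_mem_nil, or_false] at hx
  rcases hx with rfl | rfl <;> simpa

theorem isOrdered_nil (k : Kind) : IsOrdered k [] := ⟨by simp, List.Pairwise.nil⟩

theorem jE_eq : jE = ∑ i : Fin 1, (![1] : Fin 1 → ℂ) i •
    Quad.state (![([(true, -1), (false, -1)], [], [], [])] i) := by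
  simp only [Fin.sum_univ_one]
  exact (one_smul ℂ _).symm

theorem jTotal_eq : jTotal = ∑ i : Fin 3, (![6, 1, 3] : Fin 3 → ℂ) i •
    Quad.state (![([], [(true, -1), (false, -1)], [], []), ([], [], [(true, -1), (false, -1)], []),
      ([], [], [], [(true, -1), (false, -1)])] i) := by
  simp only [Fin.sum_univ_succ, Fin.sum_univ_zero, add_zero]
  rw [← add_assoc]
  refine congrArg₂ _ (congrArg₂ _ rfl ?_) rfl
  exact (one_smul ℂ _).symm

section

variable {A B : Type*} [AddCommGroup A] [Module ℂ A] [AddCommGroup B] [Module ℂ B]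

theorem half_sub_tmul (a a' : A) (b : B) : ((1 / 2 : ℂ) • (a - a')) ⊗ₜ[ℂ] b =
    (1 / 2 : ℂ) • a ⊗ₜ[ℂ] b + (-1 / 2 : ℂ) • a' ⊗ₜ[ℂ] b := by
  rw [← TensorProduct.smul_tmul', TensorProduct.sub_tmul]
  module

theorem tmul_half_sub (a : A) (b b' : B) : a ⊗ₜ[ℂ] ((1 / 2 : ℂ) • (b - b')) =
    (1 / 2 : ℂ) • a ⊗ₜ[ℂ] b + (-1 / 2 : ℂ) • a ⊗ₜ[ℂ] b' := by
  rw [TensorProduct.tmul_smul, TensorProduct.tmul_sub]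
  module

theorem tmul_combination (a : A) (b b' : B) :
    a ⊗ₜ[ℂ] ((1 / 2 : ℂ) • b + (-1 / 2 : ℂ) • b') =
      (1 / 2 : ℂ) • a ⊗ₜ[ℂ] b + (-1 / 2 : ℂ) • a ⊗ₜ[ℂ] b' := by
  rw [TensorProduct.tmul_add, TensorProduct.tmul_smul, TensorProduct.tmul_smul]

end

theorem omegaTotal_eq : omegaTotal = ∑ i : Fin 8,
    (![1 / 2, -1 / 2, 1 / 2, -1 / 2, 1 / 2, -1 / 2, 1 / 2, -1 / 2] : Fin 8 → ℂ) i •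
    Quad.state (![([(true, -2), (false, -1)], [], [], []), ([(true, -1), (false, -2)], [], [], []),
      ([], [(true, -2), (false, -1)], [], []), ([], [(true, -1), (false, -2)], [], []),
      ([], [], [(true, -2), (false, -1)], []), ([], [], [(true, -1), (false, -2)], []),
      ([], [], [], [(true, -2), (false, -1)]), ([], [], [], [(true, -1), (false, -2)])] i) := by
  have h₁ : ∀ a b c d e, pure4 ((1 / 2 : ℂ) • (a - b)) c d e =
      (1 / 2 : ℂ) • pure4 a c d e + (-1 / 2 : ℂ) • pure4 b c d e :=
    fun _ _ _ _ _ => half_sub_tmul _ _ _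
  have h₂ : ∀ a b c d e, pure4 c ((1 / 2 : ℂ) • (a - b)) d e =
      (1 / 2 : ℂ) • pure4 c a d e + (-1 / 2 : ℂ) • pure4 c b d e := fun _ _ _ _ _ =>
    (congrArg _ (half_sub_tmul _ _ _)).trans (tmul_combination _ _ _)
  have h₃ : ∀ a b c d e, pure4 c d ((1 / 2 : ℂ) • (a - b)) e =
      (1 / 2 : ℂ) • pure4 c d a e + (-1 / 2 : ℂ) • pure4 c d b e := fun _ _ _ _ _ =>
    (congrArg _ ((congrArg _ (half_sub_tmul _ _ _)).trans (tmul_combination _ _ _))).trans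
      (tmul_combination _ _ _)
  have h₄ : ∀ a b c d e, pure4 c d e ((1 / 2 : ℂ) • (a - b)) =
      (1 / 2 : ℂ) • pure4 c d e a + (-1 / 2 : ℂ) • pure4 c d e b := fun _ _ _ _ _ =>
    (congrArg _ ((congrArg _ (tmul_half_sub _ _ _)).trans (tmul_combination _ _ _))).trans
      (tmul_combination _ _ _)
  rw [omegaTotal]
  simp only [omegaState, h₁, h₂, h₃, h₄, Fin.sum_univ_succ, Fin.sum_univ_zero, add_zero]
  simp only [← add_assoc]
  rfl

variable (x : QIdx)

theorem JE0_wBasis : JE0 (wBasis x) = (charge x.1.1 + 1 / 2 : ℂ) • wBasis x := by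
  rw [JE0, jE_eq, Y_sum _ _ _ _ (by
    intro i _
    fin_cases i
    exact ⟨isOrdered_pair _ (by norm_num) (by norm_num), isOrdered_nil _, isOrdered_nil _,
      isOrdered_nil _⟩)]
  simp only [Fin.sum_univ_one, Matrix.cons_val_zero, one_smul, field₁]
  rw [tensorOp_wBasis (wordField_j_twBasis _ _) (one_twBasis _ _) (one_twBasis _ _)
    (one_twBasis _ _)]
  congr 1
  simp only [Kind.sgn]
  ring

/-- The constant is `6 · ½ - ½ - 3 · ½ = 1`, so the grading is integral. -/
theorem J0_wBasis : J0 (wBasis x) =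
    ((1 + 6 * charge x.2.1.1 + charge x.2.2.1.1 + 3 * charge x.2.2.2.1 : ℤ) : ℂ) • wBasis x := by
  have hp : ∀ k, IsOrdered k [(true, -1), (false, -1)] := fun k =>
    isOrdered_pair _ (by norm_num) (by norm_num)
  rw [J0, jTotal_eq, Y_sum _ _ _ _ (by
    intro i _
    fin_cases i
    · exact ⟨isOrdered_nil _, hp _, isOrdered_nil _, isOrdered_nil _⟩
    · exact ⟨isOrdered_nil _, isOrdered_nil _, hp _, isOrdered_nil _⟩
    · exact ⟨isOrdered_nil _, isOrdered_nil _, isOrdered_nil _, hp _⟩)]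
  simp only [Fin.sum_univ_three, Matrix.cons_val, Matrix.cons_val_zero, Matrix.cons_val_one,
    field₂ [(true, -1), (false, -1)] rfl, field₃, field₄, LinearMap.add_apply,
    LinearMap.smul_apply]
  rw [tensorOp_wBasis (one_twBasis _ _) (wordField_j_twBasis _ _) (one_twBasis _ _)
      (one_twBasis _ _),
    tensorOp_wBasis (one_twBasis _ _) (one_twBasis _ _) (wordField_j_twBasis _ _)
      (one_twBasis _ _),
    tensorOp_wBasis (one_twBasis _ _) (one_twBasis _ _) (one_twBasis _ _)
      (wordField_j_twBasis _ _)]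
  simp only [smul_smul, ← add_smul]
  congr 1
  simp only [Kind.sgn]
  push_cast
  ring

/-- A Clifford factor has vacuum energy `1/8` and a Weyl factor `-1/8`, so the constants cancel. -/
theorem L0_wBasis : L0 (wBasis x) =
    ((energy x.1.1 + energy x.2.1.1 + energy x.2.2.1.1 + energy x.2.2.2.1 : ℕ) : ℂ) •
      wBasis x := by
  have hp : ∀ k, IsOrdered k [(true, -2), (false, -1)] := fun k =>
    isOrdered_pair _ (by norm_num) (by norm_num)
  have hq : ∀ k, IsOrdered k [(true, -1), (false, -2)] := fun k =>
    isOrdered_pair _ (by norm_num) (by norm_num)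
  rw [L0, omegaTotal_eq, Y_sum _ _ _ _ (by
    intro i _
    fin_cases i
    · exact ⟨hp _, isOrdered_nil _, isOrdered_nil _, isOrdered_nil _⟩
    · exact ⟨hq _, isOrdered_nil _, isOrdered_nil _, isOrdered_nil _⟩
    · exact ⟨isOrdered_nil _, hp _, isOrdered_nil _, isOrdered_nil _⟩
    · exact ⟨isOrdered_nil _, hq _, isOrdered_nil _, isOrdered_nil _⟩
    · exact ⟨isOrdered_nil _, isOrdered_nil _, hp _, isOrdered_nil _⟩
    · exact ⟨isOrdered_nil _, isOrdered_nil _, hq _, isOrdered_nil _⟩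
    · exact ⟨isOrdered_nil _, isOrdered_nil _, isOrdered_nil _, hp _⟩
    · exact ⟨isOrdered_nil _, isOrdered_nil _, isOrdered_nil _, hq _⟩)]
  simp only [Fin.sum_univ_eight, Matrix.cons_val, Matrix.cons_val_zero, Matrix.cons_val_one,
    field₁, field₂ [(true, -2), (false, -1)] rfl, field₂ [(true, -1), (false, -2)] rfl, field₃,
    field₄, LinearMap.add_apply, LinearMap.smul_apply]
  rw [tensorOp_wBasis (wordField_omega₁_twBasis _ _) (one_twBasis _ _) (one_twBasis _ _)
      (one_twBasis _ _),
    tensorOp_wBasis (wordField_omega₂_twBasis _ _) (one_twBasis _ _) (one_twBasis _ _)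
      (one_twBasis _ _),
    tensorOp_wBasis (one_twBasis _ _) (wordField_omega₁_twBasis _ _) (one_twBasis _ _)
      (one_twBasis _ _),
    tensorOp_wBasis (one_twBasis _ _) (wordField_omega₂_twBasis _ _) (one_twBasis _ _)
      (one_twBasis _ _),
    tensorOp_wBasis (one_twBasis _ _) (one_twBasis _ _) (wordField_omega₁_twBasis _ _)
      (one_twBasis _ _),
    tensorOp_wBasis (one_twBasis _ _) (one_twBasis _ _) (wordField_omega₂_twBasis _ _)
      (one_twBasis _ _),
    tensorOp_wBasis (one_twBasis _ _) (one_twBasis _ _) (one_twBasis _ _)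
      (wordField_omega₁_twBasis _ _),
    tensorOp_wBasis (one_twBasis _ _) (one_twBasis _ _) (one_twBasis _ _)
      (wordField_omega₂_twBasis _ _)]
  simp only [smul_smul, ← add_smul]
  congr 1
  push_cast
  rw [← weightSum_omega x.1.1, ← weightSum_omega x.2.1.1, ← weightSum_omega x.2.2.1.1,
    ← weightSum_omega x.2.2.2.1]
  simp only [Kind.sgn]
  ring

theorem act_wBasis (c : Torus) : act .twisted c (wBasis x) =
    ((c.1 : ℂ) ^ charge x.1.1 * (c.2.1 : ℂ) ^ charge x.2.1.1 * (c.2.2.1 : ℂ) ^ charge x.2.2.1.1 *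
      (c.2.2.2 : ℂ) ^ charge x.2.2.2.1) • wBasis x :=
  tensorOp_wBasis (scaleOp_twBasis _ _ _) (scaleOp_twBasis _ _ _) (scaleOp_twBasis _ _ _)
    (scaleOp_twBasis _ _ _)

/-- The scalar by which the torus acts on a monomial. -/
def torusWeight (c : Torus) (x : QIdx) : ℂ :=
  (c.1 : ℂ) ^ charge x.1.1 * (c.2.1 : ℂ) ^ charge x.2.1.1 * (c.2.2.1 : ℂ) ^ charge x.2.2.1.1 *
    (c.2.2.2 : ℂ) ^ charge x.2.2.2.1

/-- The eigenvalue of `J_𝔢(0) (-1)^F` on a monomial. -/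
def parityWeight (x : QIdx) : ℂ :=
  (charge x.1.1 + 1 / 2) * ((-1) ^ charge x.1.1 * (-1) ^ charge x.2.1.1)

theorem twinedOp_wBasis (c : Torus) : twinedOp c (wBasis x) =
    ((torusWeight c x + torusWeight c⁻¹ x) * parityWeight x) • wBasis x := by
  rw [twinedOp, fermionParity, Module.End.mul_apply, Module.End.mul_apply, act_wBasis, map_smul,
    JE0_wBasis, smul_smul, map_smul, LinearMap.add_apply, act_wBasis, act_wBasis]
  simp only [smul_smul, ← add_smul, torusWeight, parityWeight]
  congr 1
  simp
  ring

end ZeroModes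

/-! ## Gradings by joint eigenvalues -/

section Grading

variable {V ι : Type*} [AddCommGroup V] [Module ℂ V]

theorem mem_eigenspace_iff_repr (b : Module.Basis ι ℂ V) {T : Module.End ℂ V} {a : ι → ℂ}
    (hT : ∀ i, T (b i) = a i • b i) (μ : ℂ) (v : V) :
    v ∈ Module.End.eigenspace T μ ↔ ∀ i, b.repr v i ≠ 0 → a i = μ := by
  have key : ∀ i, b.repr (T v) i = a i * b.repr v i := by
    intro i
    have : (Finsupp.lapply i).comp (b.repr.toLinearMap.comp T) =
        a i • (Finsupp.lapply i).comp b.repr.toLinearMap := by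
      classical
      refine b.ext fun j => ?_
      simp only [LinearMap.comp_apply, hT, map_smul, LinearMap.smul_apply, LinearEquiv.coe_coe,
        Module.Basis.repr_self, Finsupp.lapply_apply, Finsupp.single_apply, smul_eq_mul]
      split_ifs with h
      · rw [h]
      · simp
    exact LinearMap.congr_fun this v
  rw [Module.End.mem_eigenspace_iff]
  constructor
  · intro h i hi
    have h2 := key i
    rw [h, map_smul, Finsupp.smul_apply, smul_eq_mul] at h2
    exact (mul_right_cancel₀ hi h2).symm
  · intro h
    refine b.repr.injective (Finsupp.ext fun i => ?_)
    rw [key, map_smul, Finsupp.smul_apply, smul_eq_mul]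
    by_cases hi : b.repr v i = 0
    · simp [hi]
    · rw [h i hi]

theorem mem_span_image_iff_repr (b : Module.Basis ι ℂ V) (t : Set ι) (v : V) :
    v ∈ Submodule.span ℂ (b '' t) ↔ ∀ i, b.repr v i ≠ 0 → i ∈ t := by
  rw [b.mem_span_image]
  exact ⟨fun h i hi => h (by simpa using hi), fun h i hi => h i (by simpa using hi)⟩

theorem isInternal_span_fibers [DecidableEq ι] {κ : Type*} [DecidableEq κ]
    (b : Module.Basis ι ℂ V) (d : ι → κ) :
    DirectSum.IsInternal fun a => Submodule.span ℂ (b '' (d ⁻¹' {a})) := by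
  refine DirectSum.isInternal_submodule_of_iSupIndep_of_iSup_eq_top ?_ ?_
  · intro a
    refine (b.linearIndependent.disjoint_span_image (t := (d ⁻¹' {a})ᶜ)
      disjoint_compl_right).mono_right ?_
    refine iSup₂_le fun a' ha' => Submodule.span_mono (Set.image_mono fun i hi => ?_)
    rintro (h : d i = a)
    exact ha' (by rw [← h]; exact hi.symm)
  · rw [eq_top_iff, ← b.span_eq, Submodule.span_le]
    rintro _ ⟨i, rfl⟩
    exact Submodule.mem_iSup_of_mem (d i) (Submodule.subset_span ⟨i, rfl, rfl⟩)

theorem traceOn_span_image (b : Module.Basis ι ℂ V) {T : Module.End ℂ V} {a : ι → ℂ}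
    (hT : ∀ i, T (b i) = a i • b i) {t : Set ι} (ht : t.Finite) :
    traceOn (Submodule.span ℂ (b '' t)) T = ∑ i ∈ ht.toFinset, a i := by
  classical
  have hinv : ∀ x ∈ Submodule.span ℂ (b '' t), T x ∈ Submodule.span ℂ (b '' t) := by
    intro x hx
    induction hx using Submodule.span_induction with
    | mem x hx =>
      obtain ⟨i, hi, rfl⟩ := hx
      rw [hT]
      exact Submodule.smul_mem _ _ (Submodule.subset_span ⟨i, hi, rfl⟩)
    | zero => simp
    | add x y _ _ hx hy => rw [map_add]; exact add_mem hx hy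
    | smul c x _ hx => rw [map_smul]; exact Submodule.smul_mem _ _ hx
  rw [traceOn, dif_pos hinv]
  have : Fintype t := ht.fintype
  have hli : LinearIndependent ℂ fun i : t => b i := b.linearIndependent.comp _ Subtype.val_injective
  have hspan : Submodule.span ℂ (Set.range fun i : t => b i) = Submodule.span ℂ (b '' t) := by
    congr 1
    ext v
    simp
  let B : Module.Basis t ℂ (Submodule.span ℂ (b '' t)) :=
    (Module.Basis.span hli).map (LinearEquiv.ofEq _ _ hspan)
  have hB : ∀ i : t, (B i : V) = b i := fun i => by
    simp [B, Module.Basis.span_apply]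
  have hTB : ∀ i : t, T.restrict hinv (B i) = a i • B i := fun i => by
    refine Subtype.ext ?_
    rw [LinearMap.coe_restrict_apply, hB, hT, Submodule.coe_smul, hB]
  rw [LinearMap.trace_eq_matrix_trace ℂ B, Matrix.trace]
  simp only [Matrix.diag_apply, LinearMap.toMatrix_apply, hTB, map_smul, Finsupp.smul_apply,
    Module.Basis.repr_self, Finsupp.single_eq_same, smul_eq_mul, mul_one]
  exact (Finset.sum_subtype ht.toFinset (fun i => by simp) a).symm

end Grading

/-! ## Sums over multiplicities as infinite products -/

section FinsuppProd

variable {ι : Type*}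

theorem sum_finsupp_box {R : Type*} [CommSemiring R] (f : ι → ℕ → R) (h0 : ∀ i, f i 0 = 1)
    (s : Finset ι) (N : ℕ) :
    ∑ F ∈ s.finsupp (fun _ => Finset.range N), F.prod f =
      ∏ i ∈ s, ∑ k ∈ Finset.range N, f i k := by
  classical
  rw [Finset.prod_sum, Finset.finsupp, Finset.sum_map]
  refine Finset.sum_congr rfl fun p _ => ?_
  exact Finsupp.prod_indicator_index_eq_prod_attach _ fun i _ => h0 i

theorem tendsto_finsupp_box : Tendsto (fun p : Finset ι × ℕ =>
    p.1.finsupp (fun _ => Finset.range (p.2 + 1))) atTop atTop := by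
  classical
  refine tendsto_atTop_finset_of_monotone ?_ fun F => ?_
  · rintro ⟨s, N⟩ ⟨s', N'⟩ ⟨hs, hN⟩ F hF
    simp only [Finset.mem_finsupp_iff, Finset.mem_range] at hF ⊢
    simp only at hs hN
    refine ⟨hF.1.trans hs, fun i hi => ?_⟩
    by_cases h : i ∈ s
    · exact (hF.2 i h).trans_le (by omega)
    · rw [Finsupp.notMem_support_iff.1 fun h2 => h (hF.1 h2)]
      omega
  · refine ⟨(F.support, F.support.sup F), ?_⟩
    simp only [Finset.mem_finsupp_iff, Finset.mem_range]
    exact ⟨le_rfl, fun i hi => Nat.lt_succ_of_le (Finset.le_sup hi)⟩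

/-- A partial sum lies in a box, where the distributive law bounds it by `∏ (1 + ∑ₖ ‖f i (k+1)‖)`,
hence by the exponential of the total. -/
theorem summable_finsupp_prod (f : ι → ℕ → ℂ) (h0 : ∀ i, f i 0 = 1)
    (hs : Summable fun p : ι × ℕ => ‖f p.1 (p.2 + 1)‖) :
    Summable fun F : ι →₀ ℕ => F.prod f := by
  classical
  refine Summable.of_norm ?_
  have hnorm : ∀ F : ι →₀ ℕ, ‖F.prod f‖ = F.prod fun i k => ‖f i k‖ := fun F => by
    simp [Finsupp.prod]
  simp only [hnorm]
  have hG := hs.prod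
  refine summable_of_sum_le (c := Real.exp (∑' i, ∑' k, ‖f i (k + 1)‖))
    (fun F => Finset.prod_nonneg fun i _ => norm_nonneg _) fun T => ?_
  obtain ⟨⟨s, N⟩, hT⟩ := (tendsto_finsupp_box.eventually (eventually_ge_atTop T)).exists
  refine (Finset.sum_le_sum_of_subset_of_nonneg hT fun F _ _ =>
    Finset.prod_nonneg fun i _ => norm_nonneg _).trans ?_
  refine (sum_finsupp_box (fun i k => ‖f i k‖) (fun i => by simp [h0]) s (N + 1)).le.trans ?_
  calc ∏ i ∈ s, ∑ k ∈ Finset.range (N + 1), ‖f i k‖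
      ≤ ∏ i ∈ s, Real.exp (∑' k, ‖f i (k + 1)‖) := by
        refine Finset.prod_le_prod (fun i _ => Finset.sum_nonneg fun k _ => norm_nonneg _)
          fun i _ => ?_
        rw [Finset.sum_range_succ', h0, norm_one, add_comm]
        refine le_trans ?_ (add_comm _ _ |>.trans_le (Real.add_one_le_exp _))
        exact add_le_add_right ((hs.prod_factor i).sum_le_tsum _ fun k _ => norm_nonneg _) 1
    _ = Real.exp (∑ i ∈ s, ∑' k, ‖f i (k + 1)‖) := (Real.exp_sum _ _).symm
    _ ≤ _ := Real.exp_le_exp.2 (hG.sum_le_tsum _ fun i _ => tsum_nonneg fun k => norm_nonneg _)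

/-- The sum is absolutely convergent, so it may be computed along boxes: the multiplicity bound
tends to infinity on a fixed finite set of modes, and then the set grows. -/
theorem hasSum_finsupp_prod (f : ι → ℕ → ℂ) (h0 : ∀ i, f i 0 = 1)
    (hs : Summable fun p : ι × ℕ => ‖f p.1 (p.2 + 1)‖) {Z : ℂ}
    (hZ : HasProd (fun i => ∑' k, f i k) Z) :
    HasSum (fun F : ι →₀ ℕ => F.prod f) Z := by
  classical
  obtain ⟨S, hS⟩ := summable_finsupp_prod f h0 hs
  have hlim := Tendsto.comp hS tendsto_finsupp_box
  have hloc : ∀ i, Summable (f i) := fun i =>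
    (summable_nat_add_iff 1).1 (Summable.of_norm (hs.prod_factor i))
  have hprod : HasProd (fun i => ∑' k, f i k) S := by
    change Tendsto (fun s : Finset ι => ∏ i ∈ s, ∑' k, f i k) atTop (𝓝 S)
    rw [Metric.tendsto_atTop]
    intro ε hε
    rw [Metric.tendsto_atTop] at hlim
    -- The limit over `N` turns `<` into `≤`; starting from `ε / 2` keeps the final inequality
    -- strict.
    obtain ⟨⟨s₀, N₀⟩, h⟩ := hlim (ε / 2) (half_pos hε)
    refine ⟨s₀, fun s hs => lt_of_le_of_lt ?_ (half_lt_self hε)⟩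
    have hlim2 : Tendsto (fun N => ∏ i ∈ s, ∑ k ∈ Finset.range (N + 1), f i k) atTop
        (𝓝 (∏ i ∈ s, ∑' k, f i k)) :=
      tendsto_finsetProd _ fun i _ => (hloc i).hasSum.tendsto_sum_nat.comp (tendsto_add_atTop_nat 1)
    refine le_of_tendsto (hlim2.dist tendsto_const_nhds) ?_
    filter_upwards [eventually_ge_atTop N₀] with N hN
    have := h (s, N) ⟨hs, hN⟩
    simp only [Function.comp_apply, sum_finsupp_box f h0] at this
    exact this.le
  rwa [hprod.unique hZ] at hS

end FinsuppProd

/-! ## The infinite product `∏ (1 - x qⁿ)` -/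

section Pochhammer

/-- The infinite product `∏ (1 - x qⁿ)`. -/
def poch (x q : ℂ) : ℂ := ∏' n : ℕ, (1 - x * q ^ n)

variable {q : ℂ} (hq : ‖q‖ < 1)
include hq

theorem summable_norm_mul_pow (x : ℂ) : Summable fun n : ℕ => ‖x * q ^ n‖ := by
  simp only [norm_mul, norm_pow]
  exact (summable_geometric_of_lt_one (norm_nonneg _) hq).mul_left _

theorem multipliable_poch (x : ℂ) : Multipliable fun n : ℕ => 1 - x * q ^ n := by
  have := multipliable_one_add_of_summable (f := fun n : ℕ => -(x * q ^ n))
    (by simpa using summable_norm_mul_pow hq x)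
  simpa [sub_eq_add_neg] using this

theorem hasProd_poch (x : ℂ) : HasProd (fun n : ℕ => 1 - x * q ^ n) (poch x q) :=
  (multipliable_poch hq x).hasProd

theorem poch_ne_zero {x : ℂ} (hx : ∀ n : ℕ, x * q ^ n ≠ 1) : poch x q ≠ 0 := by
  have := tprod_one_add_ne_zero_of_summable (f := fun n : ℕ => -(x * q ^ n))
    (fun n h => hx n (by linear_combination -h)) (by simpa using summable_norm_mul_pow hq x)
  simpa [poch, sub_eq_add_neg] using this

theorem poch_ne_zero_of_norm_lt {x : ℂ} (hx : ‖x‖ < 1) : poch x q ≠ 0 := by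
  refine poch_ne_zero hq fun n h => ?_
  have h2 : ‖x * q ^ n‖ < 1 := by
    rw [norm_mul, norm_pow]
    exact lt_of_le_of_lt (mul_le_of_le_one_right (norm_nonneg _)
      (pow_le_one₀ (norm_nonneg _) hq.le)) hx
  rw [h, norm_one] at h2
  exact lt_irrefl _ h2

theorem poch_sq (x : ℂ) : poch (x ^ 2) (q ^ 2) = poch x q * poch (-x) q := by
  rw [poch, poch, poch, ← (multipliable_poch hq x).tprod_mul (multipliable_poch hq (-x))]
  exact tprod_congr fun n => by ring

theorem poch_even_odd (x : ℂ) : poch x q = poch x (q ^ 2) * poch (x * q) (q ^ 2) := by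
  have hq2 : ‖q ^ 2‖ < 1 := by
    rw [norm_pow]; exact pow_lt_one₀ (norm_nonneg _) hq two_ne_zero
  rw [poch, ← tprod_even_mul_odd (f := fun n => 1 - x * q ^ n), poch, poch]
  · congr 1
    · exact tprod_congr fun n => by ring
    · exact tprod_congr fun n => by ring
  · exact (multipliable_poch hq2 x).congr fun n => by ring
  · exact (multipliable_poch hq2 (x * q)).congr fun n => by ring

theorem differentiable_poch : Differentiable ℂ fun x => poch x q := by
  intro x
  have hu : Summable fun n : ℕ => (‖x‖ + 1) * ‖q‖ ^ n :=
    (summable_geometric_of_lt_one (norm_nonneg _) hq).mul_left _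
  have h := Summable.hasProdLocallyUniformlyOn_nat_one_add (f := fun (n : ℕ) (y : ℂ) => -(y * q ^ n))
    (Metric.isOpen_ball (x := (0 : ℂ)) (ε := ‖x‖ + 1)) hu
    (Eventually.of_forall fun n y hy => by
      rw [norm_neg, norm_mul, norm_pow]
      exact mul_le_mul_of_nonneg_right (mem_ball_zero_iff.1 hy).le (by positivity))
    (fun n => by fun_prop)
  have h2 := (hasProdLocallyUniformlyOn_iff_tendstoLocallyUniformlyOn.1 h).differentiableOn
    (Eventually.of_forall fun t => by fun_prop) Metric.isOpen_ball
  have h3 := h2.differentiableAt (Metric.isOpen_ball.mem_nhds (by simp : x ∈ Metric.ball 0 (‖x‖ + 1)))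
  simpa [poch, sub_eq_add_neg] using h3

theorem continuous_poch : Continuous fun x => poch x q := (differentiable_poch hq).continuous

theorem eventually_poch_ne_zero (x₀ : ℂ) : ∀ᶠ x in 𝓝[≠] x₀, poch x q ≠ 0 := by
  have han : AnalyticOnNhd ℂ (fun x => poch x q) Set.univ := fun x _ =>
    (differentiable_poch hq).analyticAt x
  refine (han x₀ trivial).eventually_eq_zero_or_eventually_ne_zero.resolve_left fun h => ?_
  -- By the identity theorem, vanishing near `x₀` would force vanishing at 0, where the product is
  -- 1.
  have := han.eqOn_zero_of_preconnected_of_eventuallyEq_zero isPreconnected_univ trivial h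
    (Set.mem_univ 0)
  simp [poch] at this

end Pochhammer

/-! ## The generating series of the single factors -/

section Factors

theorem charge_add (F G : Mo →₀ ℕ) : charge (F + G) = charge F + charge G := by
  rw [charge, Finsupp.sum_add_index'] <;> intros <;> simp [charge]
  split_ifs <;> ring

theorem energy_add (F G : Mo →₀ ℕ) : energy (F + G) = energy F + energy G := by
  rw [energy, Finsupp.sum_add_index'] <;> intros <;> simp [energy]
  split_ifs <;> ring

/-- The sign of a mode. -/
def Mo.sign (i : Mo) : ℤ := if i.1 then 1 else -1

/-- The energy of a mode. -/
def Mo.level (i : Mo) : ℕ := if i.1 then i.2 + 1 else i.2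

theorem charge_single (i : Mo) (n : ℕ) : charge (Finsupp.single i n) = n * i.sign := by
  rw [charge, Finsupp.sum_single_index (by simp)]; rfl

theorem energy_single (i : Mo) (n : ℕ) : energy (Finsupp.single i n) = n * i.level := by
  rw [energy, Finsupp.sum_single_index (by simp)]; rfl

/-- The monomial attached to a mode. -/
def modeTerm (X q : ℂ) (i : Mo) : ℂ := X ^ i.sign * q ^ i.level

@[simp] theorem modeTerm_true (X q : ℂ) (n : ℕ) : modeTerm X q (true, n) = X * q * q ^ n := by
  simp [modeTerm, Mo.sign, Mo.level]; ring

@[simp] theorem modeTerm_false (X q : ℂ) (n : ℕ) : modeTerm X q (false, n) = X⁻¹ * q ^ n := by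
  simp [modeTerm, Mo.sign, Mo.level]

theorem prod_modeTerm {X : ℂ} (hX : X ≠ 0) (q : ℂ) (F : Mo →₀ ℕ) :
    (F.prod fun i k => modeTerm X q i ^ k) = X ^ charge F * q ^ energy F := by
  induction F using Finsupp.induction_linear with
  | zero => simp [charge, energy]
  | add F G hF hG =>
    rw [Finsupp.prod_add_index' (by simp) (fun _ _ _ => pow_add _ _ _), hF, hG, charge_add,
      energy_add, zpow_add₀ hX, pow_add]
    ring
  | single i n =>
    rw [Finsupp.prod_single_index (by simp), charge_single, energy_single, modeTerm, mul_pow,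
      mul_comm (n : ℤ), zpow_mul, zpow_natCast, mul_comm n, pow_mul]

theorem hasProd_mo {g : Mo → ℂ} {a b : ℂ} (ha : HasProd (fun n => g (true, n)) a)
    (hb : HasProd (fun n => g (false, n)) b) : HasProd g (a * b) := by
  have ha' : HasProd (fun i : Mo => if i.1 then g i else 1) a := by
    refine (Function.Injective.hasProd_iff (g := fun n : ℕ => ((true, n) : Mo))
      (fun _ _ h => (Prod.ext_iff.1 h).2) ?_).1 (by simpa [Function.comp_def] using ha)
    rintro ⟨_ | _, n⟩ h
    · rfl
    · exact absurd ⟨n, rfl⟩ h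
  have hb' : HasProd (fun i : Mo => if i.1 then 1 else g i) b := by
    refine (Function.Injective.hasProd_iff (g := fun n : ℕ => ((false, n) : Mo))
      (fun _ _ h => (Prod.ext_iff.1 h).2) ?_).1 (by simpa [Function.comp_def] using hb)
    rintro ⟨_ | _, n⟩ h
    · exact absurd ⟨n, rfl⟩ h
    · rfl
  refine (ha'.mul hb').congr fun s => Finset.prod_congr rfl fun i _ => ?_
  dsimp only
  split_ifs <;> simp

variable {q : ℂ} (hq : ‖q‖ < 1)
include hq

theorem summable_norm_modeTerm (X : ℂ) : Summable fun i => ‖modeTerm X q i‖ := by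
  refine (summable_prod_of_nonneg fun _ => norm_nonneg _).2 ⟨?_, .of_finite⟩
  rintro (_ | _)
  · simpa using summable_norm_mul_pow hq X⁻¹
  · simpa using summable_norm_mul_pow hq (X * q)

/-- The sets of modes contained in `A`, as multiplicity functions. -/
def fermionIndex (A : Set Mo) : Set (Mo →₀ ℕ) := {F | ∀ i, F i ≤ 1 ∧ (F i ≠ 0 → i ∈ A)}

-- A mode in `A` contributes `1 + x` and any other mode contributes 1. The supertrace sign is put
-- into `X`.
open Classical in
theorem hasSum_fermion {X : ℂ} (hX : X ≠ 0) (A : Set Mo) {Z : ℂ}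
    (hZ : HasProd (fun i => if i ∈ A then 1 + modeTerm X q i else 1) Z) :
    HasSum (fun F => if F ∈ fermionIndex A then X ^ charge F * q ^ energy F else 0) Z := by
  set f : Mo → ℕ → ℂ := fun i k => if k = 0 then 1 else
    if k = 1 ∧ i ∈ A then modeTerm X q i else 0 with hf
  have key := hasSum_finsupp_prod f (fun i => by simp [hf]) (Z := Z) ?_ ?_
  · refine key.congr fun s => Finset.sum_congr rfl fun F _ => ?_
    dsimp only
    split_ifs with hF
    · rw [← prod_modeTerm hX]
      refine Finset.prod_congr rfl fun i hi => ?_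
      have h0 := Finsupp.mem_support_iff.1 hi
      have h1 : F i = 1 := by have := (hF i).1; omega
      simp [hf, h1, (hF i).2 h0]
    · simp only [fermionIndex, Set.mem_ofPred_eq, not_forall] at hF
      obtain ⟨i, hi⟩ := hF
      have h0 : F i ≠ 0 := fun h => hi ⟨by omega, fun h2 => absurd h h2⟩
      refine Finset.prod_eq_zero (Finsupp.mem_support_iff.2 h0) ?_
      simp only [hf, h0, if_false]
      refine if_neg fun h => hi ⟨h.1.le, fun _ => h.2⟩
  · refine Summable.of_nonneg_of_le (fun _ => norm_nonneg _) (f := fun p : Mo × ℕ =>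
      ‖modeTerm X q p.1‖ * if p.2 = 0 then 1 else 0) (fun p => ?_) ?_
    · by_cases h : p.2 = 0 <;> simp [hf, h]
      split_ifs <;> simp
    · exact (summable_norm_modeTerm hq X).mul_of_nonneg
        (g := fun n : ℕ => if n = 0 then (1 : ℝ) else 0)
        (summable_of_ne_finset_zero (s := {0}) fun n hn => by simpa using hn)
        (fun _ => norm_nonneg _) (fun n => by dsimp only; split_ifs <;> simp)
  · refine hZ.congr fun s => Finset.prod_congr rfl fun i _ => ?_
    dsimp only
    rw [tsum_eq_sum (s := Finset.range 2)]
    · simp only [hf, Finset.sum_range_succ, Finset.sum_range_zero]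
      by_cases h : i ∈ A <;> simp [h]
    · intro k hk
      rw [Finset.mem_range] at hk
      simp only [hf]
      rw [if_neg (by omega), if_neg (by omega)]

theorem hasSum_boson {X : ℂ} (hX : X ≠ 0) (h1 : ‖X * q‖ < 1) (h2 : ‖X⁻¹‖ < 1) :
    HasSum (fun F => X ^ charge F * q ^ energy F) ((poch (X * q) q)⁻¹ * (poch X⁻¹ q)⁻¹) := by
  -- The largest terms are those of `u⁺(-1)` and `u⁻(0)`, so `r < 1` bounds all the geometric series
  -- at once.
  set r := max ‖X * q‖ ‖X⁻¹‖ with hr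
  have hr1 : r < 1 := max_lt h1 h2
  have hr0 : 0 ≤ r := (norm_nonneg _).trans (le_max_left _ _)
  have hle : ∀ i, ‖modeTerm X q i‖ ≤ r := by
    rintro ⟨_ | _, n⟩
    · rw [modeTerm_false, norm_mul, norm_pow]
      exact (mul_le_of_le_one_right (norm_nonneg _) (pow_le_one₀ (norm_nonneg _) hq.le)).trans
        (le_max_right _ _)
    · rw [modeTerm_true, norm_mul, norm_pow]
      exact (mul_le_of_le_one_right (norm_nonneg _) (pow_le_one₀ (norm_nonneg _) hq.le)).trans
        (le_max_left _ _)
  have key := hasSum_finsupp_prod (fun (i : Mo) k => modeTerm X q i ^ k) (fun i => pow_zero _)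
    (Z := (poch (X * q) q)⁻¹ * (poch X⁻¹ q)⁻¹) ?_ ?_
  · simpa only [prod_modeTerm hX] using key
  · refine Summable.of_nonneg_of_le (fun _ => norm_nonneg _) (f := fun p : Mo × ℕ =>
      ‖modeTerm X q p.1‖ * r ^ p.2) (fun p => ?_) ?_
    · rw [pow_succ', norm_mul, norm_pow]
      exact mul_le_mul_of_nonneg_left (pow_le_pow_left₀ (norm_nonneg _) (hle _) _) (norm_nonneg _)
    · exact (summable_norm_modeTerm hq X).mul_of_nonneg (summable_geometric_of_lt_one hr0 hr1)
        (fun _ => norm_nonneg _) (fun _ => pow_nonneg hr0 _)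
  · have h : ∀ i, ∑' k, modeTerm X q i ^ k = (1 - modeTerm X q i)⁻¹ := fun i =>
      tsum_geometric_of_norm_lt_one ((hle i).trans_lt hr1)
    simp only [h]
    refine hasProd_mo ?_ ?_
    · simp only [modeTerm_true]
      exact (hasProd_poch hq _).inv₀ (poch_ne_zero_of_norm_lt hq h1)
    · simp only [modeTerm_false]
      exact (hasProd_poch hq _).inv₀ (poch_ne_zero_of_norm_lt hq h2)

-- At `X = -1` the mode `u⁻(0)` would contribute `1 - 1 = 0`; with it left out, both families of
-- modes give `(q; q)`.
open Classical in
theorem hasProd_zero_mode_omitted :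
    HasProd (fun i : Mo => if i ∈ ({(false, 0)}ᶜ : Set Mo) then 1 + modeTerm (-1) q i else 1)
      (poch q q * poch q q) := by
  have h := hasProd_poch hq q
  refine hasProd_mo ?_ ?_
  · simpa [sub_eq_add_neg] using h
  · refine (Function.Injective.hasProd_iff Nat.succ_injective fun n hn => ?_).1 ?_
    · have : n = 0 := by
        by_contra h0
        exact hn ⟨n - 1, by simp; omega⟩
      simp [this]
    · refine h.congr fun s => Finset.prod_congr rfl fun n _ => ?_
      simp [pow_succ]
      ring

/-- The mode with twice the energy. -/
def Mo.double (i : Mo) : Mo := if i.1 then (true, 2 * i.2 + 1) else (false, 2 * i.2)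

-- Doubling reaches exactly the modes of even energy, so both families are left with the odd powers
-- of `q`.
open Classical in
theorem hasProd_odd_modes {b : ℂ} :
    HasProd (fun i : Mo => if i ∈ ((Set.range Mo.double)ᶜ : Set Mo) then
      1 + modeTerm (-b ^ 2) q i else 1)
      (poch (b ^ 2 * q) (q ^ 2) * poch ((b ^ 2)⁻¹ * q) (q ^ 2)) := by
  have hq2 : ‖q ^ 2‖ < 1 := by
    rw [norm_pow]; exact pow_lt_one₀ (norm_nonneg _) hq two_ne_zero
  refine hasProd_mo ?_ ?_
  · refine (Function.Injective.hasProd_iff (g := fun n : ℕ => 2 * n)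
      (fun a b h => by simpa using h) fun n hn => ?_).1 ?_
    · rw [if_neg]
      rw [Set.mem_compl_iff, not_not]
      have hodd : n % 2 = 1 := by
        by_contra h0
        exact hn ⟨n / 2, by simp only; omega⟩
      exact ⟨(true, n / 2), by simp [Mo.double]; omega⟩
    · refine (hasProd_poch hq2 _).congr fun s => Finset.prod_congr rfl fun n _ => ?_
      simp only [Function.comp_apply]
      rw [if_pos, modeTerm_true]
      · ring
      · rintro ⟨⟨_ | _, m⟩, hm⟩ <;> simp [Mo.double] at hm
        omega
  · refine (Function.Injective.hasProd_iff (g := fun n : ℕ => 2 * n + 1)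
      (fun a b h => by simpa using h) fun n hn => ?_).1 ?_
    · rw [if_neg]
      rw [Set.mem_compl_iff, not_not]
      have heven : n % 2 = 0 := by
        by_contra h0
        exact hn ⟨n / 2, by simp only; omega⟩
      exact ⟨(false, n / 2), by simp [Mo.double]; omega⟩
    · refine (hasProd_poch hq2 _).congr fun s => Finset.prod_congr rfl fun n _ => ?_
      simp only [Function.comp_apply]
      rw [if_pos, modeTerm_false]
      · rw [inv_neg]; ring
      · rintro ⟨⟨_ | _, m⟩, hm⟩ <;> simp [Mo.double] at hm
        omega

open Classical in
theorem hasProd_all_modes {b : ℂ} :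
    HasProd (fun i : Mo => if i ∈ (Set.univ : Set Mo) then 1 + modeTerm b q i else 1)
      (poch (-(b * q)) q * poch (-b⁻¹) q) := by
  refine hasProd_mo ?_ ?_
  · simpa using hasProd_poch hq (-(b * q))
  · simpa using hasProd_poch hq (-b⁻¹)

end Factors

/-! ## The bigrading -/

section Bigrading

/-- The eigenvalues of `J(0)` and `L(0)` on a monomial. -/
def bidegree (x : QIdx) : ℤ × ℕ :=
  (1 + 6 * charge x.2.1.1 + charge x.2.2.1.1 + 3 * charge x.2.2.2.1,
    energy x.1.1 + energy x.2.1.1 + energy x.2.2.1.1 + energy x.2.2.2.1)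

theorem piece_eq_span (m : ℤ) (n : ℕ) :
    piece m n = Submodule.span ℂ (wBasis '' (bidegree ⁻¹' {(m, n)})) := by
  ext v
  rw [piece, Submodule.mem_inf, mem_eigenspace_iff_repr wBasis J0_wBasis,
    mem_eigenspace_iff_repr wBasis L0_wBasis, mem_span_image_iff_repr]
  simp only [Int.cast_inj, Nat.cast_inj, Set.mem_preimage, Set.mem_singleton_iff, bidegree,
    Prod.mk.injEq]
  exact ⟨fun h i hi => ⟨h.1 i hi, h.2 i hi⟩, fun h => ⟨fun i hi => (h i hi).1, fun i hi => (h i hi).2⟩⟩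

theorem mul_level_le_energy (F : Mo →₀ ℕ) (i : Mo) : F i * i.level ≤ energy F := by
  conv_rhs => rw [← Finsupp.erase_add_single i F]
  rw [energy_add, energy_single]
  exact Nat.le_add_left _ _

/-- A mode `u⁺` costs at least one unit of energy per unit of charge; `u⁻(0)` costs none but lowers
the charge. This bounds `J(0)` from above at fixed `L(0)`, and with it the number of bosonic zero
modes. -/
theorem charge_add_le_energy (F : Mo →₀ ℕ) : charge F + F (false, 0) ≤ energy F := by
  induction F using Finsupp.induction_linear with
  | zero => simp [charge, energy]
  | add F G hF hG =>
    rw [charge_add, energy_add, Finsupp.add_apply]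
    push_cast
    linarith
  | single i n =>
    rw [charge_single, energy_single]
    rcases i with ⟨_ | _, j⟩
    · rcases j with _ | j
      · simp [Mo.sign, Mo.level]
      · simp [Mo.sign, Mo.level]
        nlinarith [Int.natCast_nonneg n, Int.natCast_nonneg j]
    · simp [Mo.sign, Mo.level]
      nlinarith [Int.natCast_nonneg n, Int.natCast_nonneg j]

theorem mem_box_of_energy_le {F : Mo →₀ ℕ} {n K : ℕ} (h : energy F ≤ n) (hK : F (false, 0) ≤ K) :
    F ∈ (Finset.univ ×ˢ Finset.range (n + 1)).finsupp fun _ : Mo => Finset.range (n + K + 1) := by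
  rw [Finset.mem_finsupp_iff]
  have hlev := mul_level_le_energy F
  refine ⟨fun (i : Mo) hi => ?_, fun (i : Mo) _ => ?_⟩
  · have h0 : 1 ≤ F i := Nat.one_le_iff_ne_zero.2 (Finsupp.mem_support_iff.1 hi)
    have h1 : i.2 ≤ i.level := by rw [Mo.level]; split_ifs <;> omega
    have h2 : i.level ≤ n := by nlinarith [hlev i]
    simp
    omega
  · rw [Finset.mem_range]
    by_cases hi : i = (false, 0)
    · subst hi; omega
    · have h1 : 1 ≤ i.level := by
        rcases i with ⟨_ | _, j⟩
        · simp [Mo.level] at hi ⊢; omega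
        · simp [Mo.level]
      nlinarith [hlev i]

theorem bidegree_bounds {x : QIdx} {m : ℤ} {n : ℕ} (hx : bidegree x = (m, n)) :
    m + x.2.2.1.1 (false, 0) + 3 * x.2.2.2.1 (false, 0) ≤ 1 + 10 * n := by
  simp only [bidegree, Prod.mk.injEq] at hx
  have h2 := charge_add_le_energy x.2.1.1
  have h3 := charge_add_le_energy x.2.2.1.1
  have h4 := charge_add_le_energy x.2.2.2.1
  omega

theorem finite_bidegree_fiber (m : ℤ) (n : ℕ) : (bidegree ⁻¹' {(m, n)}).Finite := by
  -- The first summand bounds the bosonic zero modes by `bidegree_bounds`, the `+ 1` covers the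
  -- fermionic ones.
  set K : ℕ := (1 + 10 * n - m).toNat + 1 with hK
  set B := (Finset.univ ×ˢ Finset.range (n + 1)).finsupp fun _ : Mo => Finset.range (n + K + 1)
  refine (((B ×ˢ B ×ˢ B ×ˢ B).finite_toSet).preimage
    (f := fun x : QIdx => (x.1.1, x.2.1.1, x.2.2.1.1, x.2.2.2.1)) ?_).subset ?_
  · rintro ⟨x₁, x₂, x₃, x₄⟩ _ ⟨y₁, y₂, y₃, y₄⟩ _ h
    simp only [Prod.mk.injEq] at h
    obtain ⟨h₁, h₂, h₃, h₄⟩ := h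
    rw [Subtype.ext h₁, Subtype.ext h₂, Subtype.ext h₃, Subtype.ext h₄]
  · intro x hx
    have hb := bidegree_bounds hx
    have hx' := hx
    simp only [Set.mem_preimage, Set.mem_singleton_iff, bidegree, Prod.mk.injEq] at hx'
    have h1 := x.1.2 rfl (false, 0)
    have h2 := x.2.1.2 rfl (false, 0)
    simp only [Set.mem_preimage, Finset.coe_product, Set.mem_prod, Finset.mem_coe]
    exact ⟨mem_box_of_energy_le (by omega) (by omega), mem_box_of_energy_le (by omega) (by omega),
      mem_box_of_energy_le (by omega) (by omega), mem_box_of_energy_le (by omega) (by omega)⟩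

theorem isInternal_piece : DirectSum.IsInternal fun p : ℤ × ℕ => piece p.1 p.2 := by
  classical
  have h := isInternal_span_fibers wBasis bidegree
  have he : (fun p : ℤ × ℕ => piece p.1 p.2) =
      fun p => Submodule.span ℂ (wBasis '' (bidegree ⁻¹' {p})) :=
    funext fun p => piece_eq_span p.1 p.2
  rwa [he]

theorem finiteDimensional_piece (m : ℤ) (n : ℕ) : FiniteDimensional ℂ (piece m n) := by
  rw [piece_eq_span]
  exact FiniteDimensional.span_of_finite ℂ ((finite_bidegree_fiber m n).image _)

theorem piece_eq_bot {m : ℤ} {n : ℕ} (h : 1 + 10 * (n : ℤ) < m) : piece m n = ⊥ := by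
  rw [piece_eq_span, Submodule.span_eq_bot]
  rintro _ ⟨x, hx, rfl⟩
  have := bidegree_bounds hx
  omega

theorem twinedOp_mem_piece (c : Torus) (m : ℤ) (n : ℕ) :
    ∀ v ∈ piece m n, twinedOp c v ∈ piece m n := by
  rw [piece_eq_span]
  intro v hv
  induction hv using Submodule.span_induction with
  | mem v hv =>
    obtain ⟨x, hx, rfl⟩ := hv
    rw [twinedOp_wBasis]
    exact Submodule.smul_mem _ _ (Submodule.subset_span ⟨x, hx, rfl⟩)
  | zero => simp
  | add v w _ _ hv hw => rw [map_add]; exact add_mem hv hw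
  | smul c v _ hv => rw [map_smul]; exact Submodule.smul_mem _ _ hv

theorem psiTildeCoeff_eq (c : Torus) (m : ℤ) (n : ℕ) : psiTildeCoeff c m n =
    -∑ x ∈ (finite_bidegree_fiber m n).toFinset,
      (torusWeight c x + torusWeight c⁻¹ x) * parityWeight x := by
  rw [psiTildeCoeff, piece_eq_span,
    traceOn_span_image wBasis (twinedOp_wBasis · c) (finite_bidegree_fiber m n)]

end Bigrading

/-! ## Cancellations in the trace -/

section Cancellation

/-- Toggling a fermionic mode. -/
def toggle (i : Mo) (F : Mo →₀ ℕ) : Mo →₀ ℕ :=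
  if F i = 0 then F + Finsupp.single i 1 else F - Finsupp.single i 1

theorem toggle_self {i : Mo} {F : Mo →₀ ℕ} (h : F i ≤ 1) : toggle i F i = 1 - F i := by
  rw [toggle]; split_ifs with h0
  · simp [h0]
  · simp; omega

theorem toggle_of_ne {i j : Mo} (F : Mo →₀ ℕ) (h : j ≠ i) : toggle i F j = F j := by
  rw [toggle]; split_ifs <;> simp [h.symm]

theorem toggle_toggle {i : Mo} {F : Mo →₀ ℕ} (h : F i ≤ 1) : toggle i (toggle i F) = F := by
  ext j
  by_cases hj : j = i
  · subst hj
    rw [toggle_self (by rw [toggle_self h]; omega), toggle_self h]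
    omega
  · rw [toggle_of_ne _ hj, toggle_of_ne _ hj]

theorem toggle_ne {i : Mo} {F : Mo →₀ ℕ} (h : F i ≤ 1) : toggle i F ≠ F := fun h2 => by
  have := toggle_self h
  rw [h2] at this
  omega

theorem sub_single_add_single {i : Mo} {F : Mo →₀ ℕ} {k : ℕ} (h : k ≤ F i) :
    F - Finsupp.single i k + Finsupp.single i k = F := by
  ext j
  by_cases hj : i = j
  · subst hj; simp; omega
  · simp [hj]

theorem charge_sub_single {i : Mo} {F : Mo →₀ ℕ} {k : ℕ} (h : k ≤ F i) :
    charge (F - Finsupp.single i k) = charge F - k * i.sign := by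
  have := congrArg charge (sub_single_add_single h)
  rw [charge_add, charge_single] at this
  omega

theorem energy_sub_single {i : Mo} {F : Mo →₀ ℕ} {k : ℕ} (h : k ≤ F i) :
    energy (F - Finsupp.single i k) + k * i.level = energy F := by
  have := congrArg energy (sub_single_add_single h)
  rwa [energy_add, energy_single] at this

/-- Toggling on the multiplicity functions of a Clifford module. -/
def toggleIdx (i : Mo) (F : Idx .clifford) : Idx .clifford :=
  ⟨toggle i F.1, fun h j => by
    by_cases hj : j = i
    · subst hj
      rw [toggle_self (F.2 h _)]
      omega
    · rw [toggle_of_ne _ hj]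
      exact F.2 h j⟩

/-- The weight of a monomial without the factor from `J_𝔢(0)`. -/
def signedWeight (c : Torus) (x : QIdx) : ℂ :=
  torusWeight c x * ((-1) ^ charge x.1.1 * (-1) ^ charge x.2.1.1)

theorem charge_toggle_zero_mode {F : Mo →₀ ℕ} (h : F (false, 0) ≤ 1) :
    charge (toggle (false, 0) F) = charge F + (if F (false, 0) = 0 then -1 else 1) := by
  rw [toggle]
  split_ifs with h0
  · rw [charge_add, charge_single]; simp [Mo.sign]
  · rw [charge_sub_single (by omega)]; simp [Mo.sign]

theorem energy_toggle_zero_mode {F : Mo →₀ ℕ} (h : F (false, 0) ≤ 1) :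
    energy (toggle (false, 0) F) = energy F := by
  rw [toggle]
  split_ifs with h0
  · rw [energy_add, energy_single]; simp [Mo.level]
  · simpa [Mo.level] using energy_sub_single (F := F) (i := (false, 0)) (k := 1) (by omega)

/-- Toggling `u⁻(0)` in `A(𝔢)` preserves the bidegree and the torus weight. The partners have
charges `c` and `c - 1` and opposite parity, and `(c + ½) - (c - ½) = 1` is what the right-hand side
assigns to the one without the zero mode. -/
theorem sum_cancel_zero_mode (d : ℂˣ) (m : ℤ) (n : ℕ) :
    ∑ x ∈ (finite_bidegree_fiber m n).toFinset, torusWeight (1, d ^ 2, d, d) x * parityWeight x =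
      ∑ x ∈ (finite_bidegree_fiber m n).toFinset,
        if x.1.1 (false, 0) = 0 then signedWeight (1, d ^ 2, d, d) x else 0 := by
  rw [← sub_eq_zero, ← Finset.sum_sub_distrib]
  refine Finset.sum_involution (fun x _ => (toggleIdx (false, 0) x.1, x.2)) ?_ ?_ ?_ ?_
  · intro x _
    have h1 := x.1.2 rfl (false, 0)
    have hz : (-1 : ℂ) ^ (charge x.1.1 + 1) = -(-1) ^ charge x.1.1 := by
      rw [zpow_add_one₀ (by norm_num)]; ring
    have hz' : (-1 : ℂ) ^ (charge x.1.1 - 1) = -(-1) ^ charge x.1.1 := by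
      rw [zpow_sub_one₀ (by norm_num)]; norm_num
    simp only [signedWeight, torusWeight, parityWeight, toggleIdx, Units.val_one, one_zpow, one_mul,
      charge_toggle_zero_mode h1, toggle_self h1]
    by_cases h0 : x.1.1 (false, 0) = 0
    · simp only [h0, if_true, ← sub_eq_add_neg, hz']
      norm_num
      ring
    · have h0' : x.1.1 (false, 0) = 1 := by omega
      simp only [h0', if_false, one_ne_zero, hz]
      norm_num
      ring
  · intro x _ _ h
    exact toggle_ne (x.1.2 rfl (false, 0)) (congrArg (fun y : QIdx => y.1.1) h)
  · intro x hx
    simp only [Set.Finite.mem_toFinset, Set.mem_preimage, Set.mem_singleton_iff, bidegree,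
      toggleIdx] at hx ⊢
    rw [energy_toggle_zero_mode (x.1.2 rfl (false, 0))]
    exact hx
  · intro x _
    exact Prod.ext (Subtype.ext (toggle_toggle (x.1.2 rfl (false, 0)))) rfl

theorem double_injective : Function.Injective Mo.double := by
  rintro ⟨_ | _, n⟩ ⟨_ | _, m⟩ h <;> simp_all [Mo.double]

theorem sign_double (p : Mo) : p.double.sign = p.sign := by
  rcases p with ⟨_ | _, n⟩ <;> rfl

theorem level_double (p : Mo) : p.double.level = 2 * p.level := by
  rcases p with ⟨_ | _, n⟩ <;> simp [Mo.double, Mo.level]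
  ring

/-- The modes at which a monomial has a partner that cancels it. -/
def cancelSet (x : QIdx) : Set Mo := {p | x.2.1.1 p.double ≠ 0 ∨ 2 ≤ x.2.2.2.1 p}

/-- Trading a fermionic mode for two bosonic modes of half its charge and energy. -/
def trade (p : Mo) (x : QIdx) : QIdx :=
  (x.1, toggleIdx p.double x.2.1, x.2.2.1,
    ⟨if x.2.1.1 p.double = 0 then x.2.2.2.1 - Finsupp.single p 2
      else x.2.2.2.1 + Finsupp.single p 2, fun h => by cases h⟩)

theorem trade_fermion_self (p : Mo) (x : QIdx) :
    (trade p x).2.1.1 p.double = 1 - x.2.1.1 p.double := toggle_self (x.2.1.2 rfl _)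

theorem trade_fermion_of_ne {p p' : Mo} (h : p' ≠ p) (x : QIdx) :
    (trade p x).2.1.1 p'.double = x.2.1.1 p'.double :=
  toggle_of_ne _ fun h2 => h (double_injective h2)

theorem trade_boson_of_ne {p p' : Mo} (h : p' ≠ p) (x : QIdx) :
    (trade p x).2.2.2.1 p' = x.2.2.2.1 p' := by
  simp only [trade]
  split_ifs <;> simp [h.symm]

/-- Hence a choice of `p` that depends on `cancelSet x` alone is the same for `x` and its partner.
-/
theorem cancelSet_trade {p : Mo} {x : QIdx} (hp : p ∈ cancelSet x) :
    cancelSet (trade p x) = cancelSet x := by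
  ext p'
  by_cases h : p' = p
  · subst h
    refine iff_of_true ?_ hp
    by_cases h0 : x.2.1.1 p'.double = 0
    · left
      rw [trade_fermion_self, h0]
      exact one_ne_zero
    · right
      simp [trade, h0]
  · simp only [cancelSet, Set.mem_ofPred_eq, trade_fermion_of_ne h, trade_boson_of_ne h]

theorem trade_trade {p : Mo} {x : QIdx} (hp : p ∈ cancelSet x) : trade p (trade p x) = x := by
  have hx := x.2.1.2 rfl p.double
  have h1 := trade_fermion_self p x
  refine Prod.ext rfl (Prod.ext (Subtype.ext (toggle_toggle hx)) (Prod.ext rfl (Subtype.ext ?_)))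
  change (if (trade p x).2.1.1 p.double = 0 then (trade p x).2.2.2.1 - Finsupp.single p 2
      else (trade p x).2.2.2.1 + Finsupp.single p 2) = _
  rw [h1]
  by_cases h0 : x.2.1.1 p.double = 0
  · rw [if_neg (by omega)]
    simp only [trade, h0, if_true]
    exact sub_single_add_single (hp.resolve_left fun h => h h0)
  · rw [if_pos (by omega)]
    simp only [trade, h0, if_false]
    exact add_tsub_cancel_right _ _

/-- The changes `ε` and `-2ε` balance in `J(0)`, as `6ε - 3 · 2ε = 0`, and in the torus weight, as
`(d²)^ε d^(-2ε) = 1`; only the parity of the fermionic charge changes. -/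
theorem charge_trade {p : Mo} {x : QIdx} (hp : p ∈ cancelSet x) : ∃ ε : ℤ, (ε = 1 ∨ ε = -1) ∧
    charge (trade p x).2.1.1 = charge x.2.1.1 + ε ∧
    charge (trade p x).2.2.2.1 = charge x.2.2.2.1 - 2 * ε := by
  have hs : p.sign = 1 ∨ p.sign = -1 := by
    rw [Mo.sign]; split_ifs <;> simp
  by_cases h0 : x.2.1.1 p.double = 0
  · refine ⟨p.sign, hs, ?_, ?_⟩
    · simp only [trade, toggleIdx, toggle, h0, if_true, charge_add, charge_single, sign_double]
      simp
    · simp only [trade, h0, if_true]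
      rw [charge_sub_single (hp.resolve_left fun h => h h0)]
      simp
  · refine ⟨-p.sign, by omega, ?_, ?_⟩
    · simp only [trade, toggleIdx, toggle, h0, if_false]
      rw [charge_sub_single (by omega), sign_double]
      simp; ring
    · simp only [trade, h0, if_false, charge_add, charge_single]
      simp

theorem energy_trade {p : Mo} {x : QIdx} (hp : p ∈ cancelSet x) :
    energy (trade p x).2.1.1 + energy (trade p x).2.2.2.1 =
      energy x.2.1.1 + energy x.2.2.2.1 := by
  by_cases h0 : x.2.1.1 p.double = 0
  · simp only [trade, toggleIdx, toggle, h0, if_true, energy_add, energy_single, level_double]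
    have := energy_sub_single (hp.resolve_left fun h => h h0)
    omega
  · simp only [trade, toggleIdx, toggle, h0, if_false, energy_add, energy_single]
    have := energy_sub_single (F := x.2.1.1) (i := p.double) (k := 1) (by omega)
    rw [level_double] at this
    omega

theorem signedWeight_trade (d : ℂˣ) {p : Mo} {x : QIdx} (hp : p ∈ cancelSet x) :
    signedWeight (1, d ^ 2, d, d) (trade p x) = -signedWeight (1, d ^ 2, d, d) x := by
  obtain ⟨ε, hε, h2, h4⟩ := charge_trade hp
  have hsign : (-1 : ℂ) ^ ε = -1 := by rcases hε with rfl | rfl <;> norm_num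
  simp only [signedWeight, torusWeight, h2, h4, Units.val_pow_eq_pow_val]
  rw [zpow_add₀ (by norm_num : (-1 : ℂ) ≠ 0), hsign, zpow_add₀ (pow_ne_zero 2 d.ne_zero),
    zpow_sub₀ d.ne_zero, zpow_mul, zpow_ofNat]
  have := zpow_ne_zero ε (pow_ne_zero 2 d.ne_zero)
  change _ * _ * (d : ℂ) ^ charge x.2.2.1.1 * _ * ((-1) ^ charge x.1.1 * _) = _
  field_simp
  rfl

theorem bidegree_trade {p : Mo} {x : QIdx} (hp : p ∈ cancelSet x) :
    bidegree (trade p x) = bidegree x := by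
  obtain ⟨ε, -, h2, h4⟩ := charge_trade hp
  have hE := energy_trade hp
  have e1 : energy (trade p x).1.1 = energy x.1.1 := rfl
  have e3 : energy (trade p x).2.2.1.1 = energy x.2.2.1.1 := rfl
  have c3 : charge (trade p x).2.2.1.1 = charge x.2.2.1.1 := rfl
  simp only [bidegree, Prod.mk.injEq]
  omega

/-- The monomials that are left after cancellation. -/
def reduced : Set QIdx := {x | x.1.1 ∈ fermionIndex {(false, 0)}ᶜ ∧
  x.2.1.1 ∈ fermionIndex (Set.range Mo.double)ᶜ ∧ x.2.2.2.1 ∈ fermionIndex Set.univ}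

theorem mem_reduced_iff (x : QIdx) :
    x ∈ reduced ↔ x.1.1 (false, 0) = 0 ∧ cancelSet x = ∅ := by
  have h1 := x.1.2 rfl
  have h2 := x.2.1.2 rfl
  constructor
  · rintro ⟨ha, hb, hc⟩
    refine ⟨?_, Set.eq_empty_of_forall_notMem fun p hp => ?_⟩
    · by_contra h
      exact (ha _).2 h rfl
    · rcases hp with hp | hp
      · exact (hb _).2 hp ⟨p, rfl⟩
      · have := (hc p).1
        omega
  · rintro ⟨ha, hb⟩
    refine ⟨fun i => ⟨h1 i, ?_⟩, fun i => ⟨h2 i, ?_⟩, fun i => ⟨?_, fun _ => trivial⟩⟩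
    · rintro hi (rfl : i = _)
      exact hi ha
    · rintro hi ⟨p, rfl⟩
      exact Set.eq_empty_iff_forall_notMem.1 hb p (Or.inl hi)
    · by_contra! h
      exact Set.eq_empty_iff_forall_notMem.1 hb i (Or.inr h)

-- After the zero-mode cancellation, trading pairs off all monomials with nonempty `cancelSet`. It
-- does not touch the factor `A(𝔢)`.
open Classical in
theorem sum_reduced (d : ℂˣ) (m : ℤ) (n : ℕ) :
    ∑ x ∈ (finite_bidegree_fiber m n).toFinset, torusWeight (1, d ^ 2, d, d) x * parityWeight x =
      ∑ x ∈ (finite_bidegree_fiber m n).toFinset,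
        if x ∈ reduced then signedWeight (1, d ^ 2, d, d) x else 0 := by
  rw [sum_cancel_zero_mode, ← Finset.sum_filter_add_sum_filter_not _ (fun x => cancelSet x = ∅),
    Finset.sum_filter]
  convert add_zero _ using 2
  · refine Finset.sum_involution
      (fun x hx => trade (Set.nonempty_iff_ne_empty.2 (Finset.mem_filter.1 hx).2).some x)
      ?_ ?_ ?_ ?_
    · intro x hx
      rw [signedWeight_trade _ (Set.Nonempty.some_mem _)]
      change _ + (if x.1.1 (false, 0) = 0 then _ else _) = _
      split_ifs <;> simp
    · intro x hx _ h
      exact toggle_ne (x.2.1.2 rfl _) (congrArg (fun y : QIdx => y.2.1.1) h)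
    · intro x hx
      simp only [Finset.mem_filter, Set.Finite.mem_toFinset, Set.mem_preimage] at hx ⊢
      rw [bidegree_trade (Set.Nonempty.some_mem _), cancelSet_trade (Set.Nonempty.some_mem _)]
      exact hx
    · intro x hx
      have h := cancelSet_trade
        (Set.nonempty_iff_ne_empty.2 (Finset.mem_filter.1 hx).2).some_mem
      simp only [h]
      exact trade_trade (Set.Nonempty.some_mem _)
  · rename_i x _
    rw [mem_reduced_iff]
    by_cases h1 : x.1.1 (false, 0) = 0 <;> by_cases h2 : cancelSet x = ∅ <;> simp [h1, h2]

end Cancellation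

/-! ## The trace as an infinite product -/

section TraceProduct

theorem hasSum_mul_prod {α β : Type*} {f : α → ℂ} {g : β → ℂ} {a b : ℂ} (hf : HasSum f a)
    (hg : HasSum g b) : HasSum (fun x : α × β => f x.1 * g x.2) (a * b) :=
  hf.mul hg (summable_mul_of_summable_norm hf.summable.norm hg.summable.norm)

/-- The infinite product that represents the trace. -/
def traceProduct (q a b : ℂ) : ℂ :=
  (poch q q * poch q q) *
    ((poch (b ^ 2 * q) (q ^ 2) * poch ((b ^ 2)⁻¹ * q) (q ^ 2)) *
      (((poch (a * q) q)⁻¹ * (poch a⁻¹ q)⁻¹) * (poch (-(b * q)) q * poch (-b⁻¹) q)))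

-- Only `a` has to satisfy size conditions, since every factor except `𝔟` is now fermionic.
open Classical in
theorem hasSum_reduced {q a b : ℂ} (hq : ‖q‖ < 1) (hb : b ≠ 0) (ha0 : a ≠ 0) (ha : ‖a * q‖ < 1)
    (ha' : ‖a⁻¹‖ < 1) :
    HasSum (fun x : QIdx => if x ∈ reduced then
      ((-1) ^ charge x.1.1 * (-1) ^ charge x.2.1.1) * (b ^ 2) ^ charge x.2.1.1 *
        a ^ charge x.2.2.1.1 * b ^ charge x.2.2.2.1 * q ^ (bidegree x).2 else 0)
      (traceProduct q a b) := by
  have h1 := hasSum_fermion hq (neg_ne_zero.2 one_ne_zero) {(false, 0)}ᶜ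
    (by convert hasProd_zero_mode_omitted hq)
  have h2 := hasSum_fermion hq (neg_ne_zero.2 (pow_ne_zero 2 hb)) (Set.range Mo.double)ᶜ
    (by convert hasProd_odd_modes hq)
  have h3 := hasSum_boson hq ha0 ha ha'
  have h4 := hasSum_fermion hq hb Set.univ (by convert hasProd_all_modes hq)
  have h := hasSum_mul_prod h1 (hasSum_mul_prod h2 (hasSum_mul_prod h3 h4))
  -- The product sum runs over arbitrary multiplicities. It restricts to `QIdx` because terms that
  -- repeat a Clifford mode vanish.
  have hinj : Function.Injective fun x : QIdx => (x.1.1, x.2.1.1, x.2.2.1.1, x.2.2.2.1) := by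
    rintro ⟨x₁, x₂, x₃, x₄⟩ ⟨y₁, y₂, y₃, y₄⟩ h
    simp only [Prod.mk.injEq] at h
    obtain ⟨h₁, h₂, h₃, h₄⟩ := h
    rw [Subtype.ext h₁, Subtype.ext h₂, Subtype.ext h₃, Subtype.ext h₄]
  rw [← hinj.hasSum_iff] at h
  · refine h.congr fun s => Finset.sum_congr rfl fun x _ => ?_
    simp only [Function.comp_apply, reduced, Set.mem_ofPred_eq, bidegree]
    by_cases h1 : x.1.1 ∈ fermionIndex {(false, 0)}ᶜ <;>
      by_cases h2 : x.2.1.1 ∈ fermionIndex (Set.range Mo.double)ᶜ <;>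
      by_cases h4 : x.2.2.2.1 ∈ fermionIndex Set.univ <;> simp only [h1, h2, h4, if_true, if_false,
        and_true, and_false, mul_zero, zero_mul]
    rw [← neg_one_mul (b ^ 2), mul_zpow, pow_add, pow_add, pow_add]
    ring
  · rintro ⟨F₁, F₂, F₃, F₄⟩ hx
    by_cases h1 : F₁ ∈ fermionIndex {(false, 0)}ᶜ
    · by_cases h2 : F₂ ∈ fermionIndex (Set.range Mo.double)ᶜ
      · exact absurd ⟨(⟨F₁, fun _ i => (h1 i).1⟩, ⟨F₂, fun _ i => (h2 i).1⟩, ⟨F₃, nofun⟩,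
          ⟨F₄, nofun⟩), rfl⟩ hx
      · simp [h2]
    · simp [h1]

/-- The monomial sum converges absolutely after cancellation, so it can be grouped by bidegree. The
substitution is `a = d y`, `b = d y³`, with `b² = d² y⁶` for the charge 6 of `𝔞`; the extra `y` is
the vacuum charge. -/
theorem hasSum_twined (d : ℂˣ) {q y : ℂ} (hq : ‖q‖ < 1) (hy : y ≠ 0)
    (ha : ‖d * y * q‖ < 1) (ha' : ‖(d * y)⁻¹‖ < 1) :
    HasSum (fun p : ℤ × ℕ => (∑ x ∈ (finite_bidegree_fiber p.1 p.2).toFinset,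
      torusWeight (1, d ^ 2, d, d) x * parityWeight x) * y ^ p.1 * q ^ p.2)
      (y * traceProduct q (d * y) (d * y ^ 3)) := by
  classical
  have hd := d.ne_zero
  have h := (hasSum_reduced hq (mul_ne_zero hd (pow_ne_zero 3 hy)) (mul_ne_zero hd hy) ha
    ha').mul_left y
  set G : QIdx → ℂ := fun x => (if x ∈ reduced then signedWeight (1, d ^ 2, d, d) x else 0) *
    y ^ (bidegree x).1 * q ^ (bidegree x).2 with hG
  have hGsum : HasSum G (y * traceProduct q (d * y) (d * y ^ 3)) := by
    refine h.congr fun s => Finset.sum_congr rfl fun x _ => ?_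
    simp only [hG]
    split_ifs
    · simp only [signedWeight, torusWeight, bidegree, Units.val_one, one_zpow, one_mul,
        Units.val_pow_eq_pow_val]
      have e : y ^ (1 + 6 * charge x.2.1.1 + charge x.2.2.1.1 + 3 * charge x.2.2.2.1) =
          y * (y ^ 6) ^ charge x.2.1.1 * y ^ charge x.2.2.1.1 * (y ^ 3) ^ charge x.2.2.2.1 := by
        rw [zpow_add₀ hy, zpow_add₀ hy, zpow_add₀ hy, zpow_one, zpow_mul, zpow_mul]
        norm_cast
      rw [e, show ((d : ℂ) * y ^ 3) ^ 2 = (d : ℂ) ^ 2 * y ^ 6 by ring, mul_zpow, mul_zpow, mul_zpow]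
      ring
    · simp
  rw [← (Equiv.sigmaFiberEquiv bidegree).hasSum_iff] at hGsum
  refine hGsum.sigma fun p => ?_
  have hfin := finite_bidegree_fiber p.1 p.2
  have : Fintype {x // bidegree x = p} := hfin.fintype
  rw [sum_reduced, Finset.sum_mul, Finset.sum_mul]
  have e : ∑ x ∈ hfin.toFinset, (if x ∈ reduced then signedWeight (1, d ^ 2, d, d) x else 0) *
      y ^ p.1 * q ^ p.2 = ∑ x ∈ hfin.toFinset, G x :=
    Finset.sum_congr rfl fun x hx => by
      have hx' : bidegree x = p := by simpa using hx
      simp only [hG, hx']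
  rw [e, Finset.sum_subtype hfin.toFinset (p := fun x => bidegree x = p) (fun x => by simp)]
  exact hasSum_fintype _

theorem hasSum_psiTildeCoeff (d : ℂˣ) {q y : ℂ} (hq : ‖q‖ < 1) (hy : y ≠ 0)
    (hd : ‖(d : ℂ)‖ = 1) (ha : ‖y * q‖ < 1) (ha' : 1 < ‖y‖) :
    HasSum (fun p : ℤ × ℕ => psiTildeCoeff (1, d ^ 2, d, d) p.1 p.2 * y ^ p.1 * q ^ p.2)
      (-(y * traceProduct q (d * y) (d * y ^ 3)
        + y * traceProduct q ((d : ℂ)⁻¹ * y) ((d : ℂ)⁻¹ * y ^ 3))) := by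
  have h1 := hasSum_twined d hq hy (by rwa [mul_assoc, norm_mul, hd, one_mul])
    (by rw [norm_inv, norm_mul, hd, one_mul]; exact inv_lt_one_of_one_lt₀ ha')
  have h2 := hasSum_twined d⁻¹ hq hy
    (by rwa [mul_assoc, norm_mul, Units.val_inv_eq_inv_val, norm_inv, hd, inv_one, one_mul])
    (by
      rw [norm_inv, norm_mul, Units.val_inv_eq_inv_val, norm_inv, hd, inv_one, one_mul]
      exact inv_lt_one_of_one_lt₀ ha')
  rw [Units.val_inv_eq_inv_val] at h2
  refine (h1.add h2).neg.congr fun s => Finset.sum_congr rfl fun p _ => ?_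
  simp only [psiTildeCoeff_eq]
  have e : ((1, d ^ 2, d, d) : Torus)⁻¹ = (1, d⁻¹ ^ 2, d⁻¹, d⁻¹) := by simp
  simp only [e, add_mul, Finset.sum_add_distrib]
  ring

end TraceProduct

/-! ## Theta quotients -/

section Theta

/-- The nome `e^{2πiz}`. -/
def nome (z : ℂ) : ℂ := cexp (2 * Real.pi * I * z)

theorem nome_ne_zero (z : ℂ) : nome z ≠ 0 := exp_ne_zero _

theorem norm_nome (z : ℂ) : ‖nome z‖ = Real.exp (-(2 * Real.pi * z.im)) := by
  rw [nome, norm_exp]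
  congr 1
  simp

theorem nome_nsmul (k : ℕ) (z : ℂ) : nome (k * z) = nome z ^ k := by
  rw [nome, nome, ← exp_nat_mul]
  congr 1
  ring

theorem nome_add_quarter (z : ℂ) : nome (z + 1 / 4) = I * nome z := by
  rw [nome, nome, mul_add, exp_add, mul_comm,
    show 2 * (Real.pi : ℂ) * I * (1 / 4) = Real.pi / 2 * I by ring, exp_pi_div_two_mul_I]

theorem nome_sub_quarter (z : ℂ) : nome (z - 1 / 4) = -I * nome z := by
  rw [nome, nome, mul_sub, exp_sub,
    show 2 * (Real.pi : ℂ) * I * (1 / 4) = Real.pi / 2 * I by ring, exp_pi_div_two_mul_I, div_I]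
  ring

/-- The product `∏_{n>0} (1 - x⁻¹ q^{n-1}) (1 - x q^n)`. -/
def thetaProd (x q : ℂ) : ℂ := poch x⁻¹ q * poch (x * q) q

theorem thetaProd_sq {q : ℂ} (hq : ‖q‖ < 1) (x : ℂ) :
    thetaProd (x ^ 2) (q ^ 2) = thetaProd x q * thetaProd (-x) q := by
  have h1 := poch_sq hq x⁻¹
  have h2 := poch_sq hq (x * q)
  rw [thetaProd, thetaProd, thetaProd, ← inv_pow, ← mul_pow, h1, h2, inv_neg, neg_mul]
  ring

/-- The factors of `θ(b²)` split into even and odd powers of `q`. The odd ones are the product for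
`𝔞`; the even ones are `(±bq; q)` and `(±b⁻¹; q)`, half of which form the product for `𝔟'` and the
other half `θ(b)`. -/
theorem traceProduct_mul_thetaProd {q : ℂ} (hq : ‖q‖ < 1) {a : ℂ} (ha : thetaProd a q ≠ 0) (b : ℂ) :
    traceProduct q a b * (thetaProd a q * thetaProd b q) = poch q q ^ 2 * thetaProd (b ^ 2) q := by
  have h1 := poch_even_odd hq (b ^ 2 * q)
  have h2 := poch_even_odd hq (b ^ 2)⁻¹
  have h3 := poch_sq hq (b * q)
  have h4 := poch_sq hq b⁻¹
  have e : b ^ 2 * q * q = (b * q) ^ 2 := by ring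
  rw [e, h3] at h1
  rw [← inv_pow, h4, inv_pow] at h2
  rw [thetaProd] at ha
  have ha1 := left_ne_zero_of_mul ha
  have ha2 := right_ne_zero_of_mul ha
  rw [traceProduct, thetaProd, thetaProd, thetaProd, h1, h2]
  generalize poch a⁻¹ q = A at *
  generalize poch (a * q) q = A' at *
  linear_combination
    (poch q q ^ 2 * (poch (b ^ 2 * q) (q ^ 2) * poch ((b ^ 2)⁻¹ * q) (q ^ 2)) *
      (poch (-(b * q)) q * poch (-b⁻¹) q * (poch b⁻¹ q * poch (b * q) q))) *
      (A'⁻¹ * A' * mul_inv_cancel₀ ha1 + mul_inv_cancel₀ ha2)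

theorem traceProduct_eq {q : ℂ} (hq : ‖q‖ < 1) {a b : ℂ} (ha : thetaProd a q ≠ 0)
    (hb : thetaProd b q ≠ 0) : traceProduct q a b =
      poch q q ^ 2 * thetaProd (b ^ 2) q / (thetaProd a q * thetaProd b q) := by
  rw [eq_div_iff (mul_ne_zero ha hb), traceProduct_mul_thetaProd hq ha]

theorem tprod_theta {q : ℂ} (hq : ‖q‖ < 1) (x : ℂ) :
    ∏' n : ℕ, (1 - x⁻¹ * q ^ n) * (1 - x * q ^ (n + 1)) * (1 - q ^ (n + 1)) =
      thetaProd x q * poch q q := by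
  have h1 := multipliable_poch hq x⁻¹
  have h2 := multipliable_poch hq (x * q)
  have h3 := multipliable_poch hq q
  rw [thetaProd, poch, poch, poch, ← h1.tprod_mul h2, ← (h1.mul h2).tprod_mul h3]
  exact tprod_congr fun n => by ring

theorem norm_nome_lt {τ : ℂ} (hτ : 0 < τ.im) : ‖nome τ‖ < 1 := by
  rw [norm_nome, Real.exp_lt_one_iff]
  have := Real.pi_pos
  have : 0 < 2 * Real.pi * τ.im := by positivity
  linarith

theorem theta1_eq {τ : ℂ} (hτ : 0 < τ.im) (z : ℂ) : theta1 τ z =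
    -I * cexp (2 * Real.pi * I * τ / 8) * cexp (Real.pi * I * z) *
      (thetaProd (nome z) (nome τ) * poch (nome τ) (nome τ)) := by
  rw [theta1, ← tprod_theta (norm_nome_lt hτ)]
  simp only [nome, exp_neg]

theorem theta2_eq {τ : ℂ} (hτ : 0 < τ.im) (z : ℂ) : theta2 τ z =
    cexp (2 * Real.pi * I * τ / 8) * cexp (Real.pi * I * z) *
      (thetaProd (-nome z) (nome τ) * poch (nome τ) (nome τ)) := by
  rw [theta2, ← tprod_theta (norm_nome_lt hτ)]
  simp only [nome, exp_neg, inv_neg, neg_mul, sub_neg_eq_add]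

theorem eta_eq (τ : ℂ) : ModularForm.eta τ =
    cexp (2 * Real.pi * I * τ / 24) * poch (nome τ) (nome τ) := by
  rw [ModularForm.eta, Function.Periodic.qParam, poch]
  congr 1
  refine tprod_congr fun n => ?_
  rw [ModularForm.eta_q_eq_pow, nome, pow_succ']

theorem poch_self_ne_zero {q : ℂ} (hq : ‖q‖ < 1) : poch q q ≠ 0 := poch_ne_zero_of_norm_lt hq hq

/-- The sum of the trace series, as a function of `y = e^{2πiz}`. -/
def traceSum (q d y : ℂ) : ℂ :=
  -(y * traceProduct q (d * y) (d * y ^ 3) + y * traceProduct q (d⁻¹ * y) (d⁻¹ * y ^ 3))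

theorem nome_eq_sq (z : ℂ) : nome z = cexp (Real.pi * I * z) ^ 2 := by
  rw [nome, ← exp_nat_mul]; congr 1; push_cast; ring

theorem exp_pi_mul_nsmul (k : ℕ) (z : ℂ) :
    cexp (Real.pi * I * (k * z)) = cexp (Real.pi * I * z) ^ k := by
  rw [← exp_nat_mul]; congr 1; ring

theorem exp_div_eight (τ : ℂ) :
    cexp (2 * Real.pi * I * τ / 8) = cexp (2 * Real.pi * I * τ / 24) ^ 3 := by
  rw [← exp_nat_mul]; congr 1; push_cast; ring

theorem psi1A_eq {τ : ℂ} (hτ : 0 < τ.im) {z : ℂ} (h1 : thetaProd (1 * nome z) (nome τ) ≠ 0)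
    (h3 : thetaProd (1 * nome z ^ 3) (nome τ) ≠ 0) : psi1A τ z = traceSum (nome τ) 1 (nome z) := by
  have hq := norm_nome_lt hτ
  have hP := poch_self_ne_zero hq
  rw [one_mul] at h1 h3
  have e3 := nome_nsmul 3 z
  have e6 := nome_nsmul 6 z
  have x3 := exp_pi_mul_nsmul 3 z
  have x6 := exp_pi_mul_nsmul 6 z
  push_cast at e3 e6 x3 x6
  have n1 := exp_ne_zero (2 * Real.pi * I * τ / 24)
  have n2 := exp_ne_zero (Real.pi * I * z)
  rw [traceSum, inv_one, one_mul, one_mul, traceProduct_eq hq h1 h3, psi1A, theta1_eq hτ,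
    theta1_eq hτ, theta1_eq hτ, eta_eq, e3, e6, x3, x6, exp_div_eight, ← pow_mul]
  generalize thetaProd (nome z) (nome τ) = A at *
  generalize thetaProd (nome z ^ 3) (nome τ) = B at *
  generalize thetaProd (nome z ^ (3 * 2)) (nome τ) = C at *
  generalize poch (nome τ) (nome τ) = P at *
  rw [nome_eq_sq z]
  generalize cexp (Real.pi * I * z) = Y at *
  generalize cexp (2 * Real.pi * I * τ / 24) = T at *
  field_simp
  ring

theorem psi2A_eq {τ : ℂ} (hτ : 0 < τ.im) {z : ℂ} (h1 : thetaProd (-1 * nome z) (nome τ) ≠ 0)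
    (h3 : thetaProd (-1 * nome z ^ 3) (nome τ) ≠ 0) :
    psi2A τ z = traceSum (nome τ) (-1) (nome z) := by
  have hq := norm_nome_lt hτ
  have hP := poch_self_ne_zero hq
  rw [neg_one_mul] at h1 h3
  have e3 := nome_nsmul 3 z
  have e6 := nome_nsmul 6 z
  have x3 := exp_pi_mul_nsmul 3 z
  have x6 := exp_pi_mul_nsmul 6 z
  push_cast at e3 e6 x3 x6
  have n1 := exp_ne_zero (2 * Real.pi * I * τ / 24)
  have n2 := exp_ne_zero (Real.pi * I * z)
  rw [traceSum, inv_neg, inv_one, neg_one_mul, neg_one_mul, traceProduct_eq hq h1 h3, psi2A,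
    theta1_eq hτ, theta2_eq hτ, theta2_eq hτ, eta_eq, e3, e6, x3, x6, exp_div_eight, neg_sq,
    ← pow_mul]
  generalize thetaProd (-nome z) (nome τ) = A at *
  generalize thetaProd (-nome z ^ 3) (nome τ) = B at *
  generalize thetaProd (nome z ^ (3 * 2)) (nome τ) = C at *
  generalize poch (nome τ) (nome τ) = P at *
  rw [nome_eq_sq z]
  generalize cexp (Real.pi * I * z) = Y at *
  generalize cexp (2 * Real.pi * I * τ / 24) = T at *
  field_simp
  ring_nf
  rw [I_sq]
  ring

theorem exp_pi_mul_add_quarter (z : ℂ) :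
    cexp (Real.pi * I * (z + 1 / 4)) = cexp (Real.pi * I * z) * cexp (Real.pi * I / 4) := by
  rw [← exp_add]; congr 1; ring

theorem exp_pi_mul_sub_quarter (z : ℂ) :
    cexp (Real.pi * I * (z - 1 / 4)) = cexp (Real.pi * I * z) * (cexp (Real.pi * I / 4))⁻¹ := by
  rw [← exp_neg, ← exp_add]; congr 1; ring

theorem exp_pi_div_four_sq : cexp (Real.pi * I / 4) ^ 2 = I := by
  rw [← exp_nat_mul,
    show ((2 : ℕ) : ℂ) * (Real.pi * I / 4) = Real.pi / 2 * I by push_cast; ring,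
    exp_pi_div_two_mul_I]

/-- The trace involves `g + g⁻¹`, so `i` and `-i` share one function. -/
theorem traceSum_inv (q d y : ℂ) : traceSum q d⁻¹ y = traceSum q d y := by
  rw [traceSum, traceSum, inv_inv, add_comm]

/-- The shifts by `±1/4` produce the theta products at `±i y` and `±i y³`. The denominator `θ₂(2τ,
2z) θ₂(2τ, 6z)` contains all four of them, so each term of the difference cancels one pair. The
phases `e^(±πi/2) = ±i` turn the difference into a sum. -/
theorem psi4AB_eq {τ : ℂ} (hτ : 0 < τ.im) {z : ℂ} (h1 : thetaProd (I * nome z) (nome τ) ≠ 0)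
    (h3 : thetaProd (I * nome z ^ 3) (nome τ) ≠ 0) (h1' : thetaProd (-I * nome z) (nome τ) ≠ 0)
    (h3' : thetaProd (-I * nome z ^ 3) (nome τ) ≠ 0) :
    psi4AB τ z = traceSum (nome τ) I (nome z) := by
  have hq := norm_nome_lt hτ
  have hP := poch_self_ne_zero hq
  have hτ2 : 0 < (2 * τ).im := by simpa using hτ
  have hP2 : poch (nome τ ^ 2) (nome τ ^ 2) ≠ 0 := poch_self_ne_zero <| by
    rw [norm_pow]; exact pow_lt_one₀ (norm_nonneg _) hq two_ne_zero
  have s1 := thetaProd_sq hq (I * nome z)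
  have s3 := thetaProd_sq hq (I * nome z ^ 3)
  rw [mul_pow, I_sq, neg_one_mul, ← neg_mul] at s1 s3
  rw [← pow_mul] at s3
  have eτ := nome_nsmul 2 τ
  have e2 := nome_nsmul 2 z
  have e3 := nome_nsmul 3 z
  have e6 := nome_nsmul 6 z
  have x2 := exp_pi_mul_nsmul 2 z
  have x3 := exp_pi_mul_nsmul 3 z
  have x6 := exp_pi_mul_nsmul 6 z
  push_cast at eτ e2 e3 e6 x2 x3 x6
  have xτ : cexp (2 * Real.pi * I * (2 * τ) / 24) = cexp (2 * Real.pi * I * τ / 24) ^ 2 := by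
    rw [← exp_nat_mul]; congr 1; push_cast; ring
  have n1 := exp_ne_zero (2 * Real.pi * I * τ / 24)
  have n2 := exp_ne_zero (Real.pi * I * z)
  have n3 := exp_ne_zero (Real.pi * I / 4)
  have hζ := exp_pi_div_four_sq
  rw [traceSum, inv_I, traceProduct_eq hq h1 h3, traceProduct_eq hq h1' h3', psi4AB]
  simp only [theta1_eq hτ, theta2_eq hτ, theta2_eq hτ2, eta_eq, nome_add_quarter,
    nome_sub_quarter, eτ, e2, e3, e6, exp_pi_mul_add_quarter, exp_pi_mul_sub_quarter, x2, x3, x6,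
    exp_div_eight, xτ, mul_pow, I_sq, neg_sq, neg_one_mul]
  simp only [← pow_mul] at *
  norm_num only at *
  rw [s1, s3]
  generalize thetaProd (I * nome z) (nome τ) = A at *
  generalize thetaProd (I * nome z ^ 3) (nome τ) = B at *
  generalize thetaProd (-I * nome z) (nome τ) = A' at *
  generalize thetaProd (-I * nome z ^ 3) (nome τ) = B' at *
  generalize thetaProd (-nome z ^ 6) (nome τ) = C at *
  generalize poch (nome τ) (nome τ) = P at *
  generalize poch (nome τ ^ 2) (nome τ ^ 2) = P2 at *
  rw [nome_eq_sq z]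
  generalize cexp (Real.pi * I * z) = Y at *
  generalize cexp (2 * Real.pi * I * τ / 24) = T at *
  generalize cexp (Real.pi * I / 4) = ζ at *
  field_simp
  have hζ4 : ζ ^ 4 = -1 := by rw [← I_sq, ← hζ]; ring
  rw [hζ4, hζ, I_pow_three]
  ring

end Theta

/-! ## Convergence of the trace series -/

section Convergence

theorem hasDerivAt_nome (z : ℂ) : HasDerivAt nome (nome z * (2 * Real.pi * I)) z := by
  have h := ((hasDerivAt_id z).const_mul (2 * Real.pi * I)).cexp
  rw [mul_one] at h
  exact h

theorem continuous_nome : Continuous nome := by unfold nome; fun_prop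

/-- The arguments of both factors have nonzero derivative in `w`, so they carry punctured
neighbourhoods into punctured neighbourhoods, where `poch` does not vanish. -/
theorem eventually_thetaProd_ne_zero {q : ℂ} (hq : ‖q‖ < 1) (hq0 : q ≠ 0) {c : ℂ} (hc : c ≠ 0)
    {k : ℕ} (hk : k ≠ 0) (z : ℂ) : ∀ᶠ w in 𝓝[≠] z, thetaProd (c * nome w ^ k) q ≠ 0 := by
  have hn := nome_ne_zero z
  have hb0 : c * nome z ^ k ≠ 0 := mul_ne_zero hc (pow_ne_zero k hn)
  have hd := ((hasDerivAt_nome z).pow k).const_mul c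
  have hd0 : c * (k * nome z ^ (k - 1) * (nome z * (2 * Real.pi * I))) ≠ 0 := by
    have := Real.pi_ne_zero
    simp [hc, hk, hn]
  have h1 := (hd.inv hb0).tendsto_nhdsNE (div_ne_zero (neg_ne_zero.2 hd0) (pow_ne_zero 2 hb0))
  have h2 := (hd.mul_const q).tendsto_nhdsNE (mul_ne_zero hd0 hq0)
  filter_upwards [h1.eventually (eventually_poch_ne_zero hq _),
    h2.eventually (eventually_poch_ne_zero hq _)] with w hw1 hw2
  exact mul_ne_zero hw1 hw2

/-- Zeros of `θ(b)` do no harm here, since `b` only enters through numerators; these points are the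
removable singularities of the theta quotient. -/
theorem continuousAt_traceProduct {q : ℂ} (hq : ‖q‖ < 1) {a b : ℂ → ℂ} {z : ℂ}
    (ha : ContinuousAt a z) (hb : ContinuousAt b z) (hb0 : b z ≠ 0) (h1 : ‖a z * q‖ < 1)
    (h2 : 1 < ‖a z‖) : ContinuousAt (fun w => traceProduct q (a w) (b w)) z := by
  have hq2 : ‖q ^ 2‖ < 1 := by
    rw [norm_pow]; exact pow_lt_one₀ (norm_nonneg _) hq two_ne_zero
  have ha0 : a z ≠ 0 := fun h => by rw [h, norm_zero] at h2; linarith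
  have p := (continuous_poch hq).continuousAt (x := a z * q)
  have p' := (continuous_poch hq).continuousAt (x := (a z)⁻¹)
  have c (f : ℂ → ℂ) (hf : ContinuousAt f z) : ContinuousAt (fun w => poch (f w) q) z :=
    (continuous_poch hq).continuousAt.comp hf
  have c2 (f : ℂ → ℂ) (hf : ContinuousAt f z) : ContinuousAt (fun w => poch (f w) (q ^ 2)) z :=
    (continuous_poch hq2).continuousAt.comp hf
  have n1 : poch (a z * q) q ≠ 0 := poch_ne_zero_of_norm_lt hq h1
  have n2 : poch (a z)⁻¹ q ≠ 0 := poch_ne_zero_of_norm_lt hq <| by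
    rw [norm_inv]; exact inv_lt_one_of_one_lt₀ h2
  have hb2 : ContinuousAt (fun w => (b w ^ 2)⁻¹) z := (hb.pow 2).inv₀ (pow_ne_zero 2 hb0)
  exact continuousAt_const.mul (((c2 _ ((hb.pow 2).mul_const q)).mul
    (c2 _ (hb2.mul_const q))).mul ((((c _ (ha.mul_const q)).inv₀ n1).mul
      ((c _ (ha.inv₀ ha0)).inv₀ n2)).mul
        ((c _ (hb.mul_const q).neg).mul (c _ (hb.inv₀ hb0).neg))))

theorem continuousAt_traceSum {q d z : ℂ} (hq : ‖q‖ < 1) (hd : ‖d‖ = 1) (h1 : ‖nome z * q‖ < 1)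
    (h2 : 1 < ‖nome z‖) : ContinuousAt (fun w => traceSum q d (nome w)) z := by
  have hn := continuous_nome.continuousAt (x := z)
  have hn0 := nome_ne_zero z
  have key (e : ℂ) (he : ‖e‖ = 1) :
      ContinuousAt (fun w => traceProduct q (e * nome w) (e * nome w ^ 3)) z := by
    have he0 : e ≠ 0 := fun h => by simp [h] at he
    refine continuousAt_traceProduct hq (hn.const_mul e) ((hn.pow 3).const_mul e)
      (mul_ne_zero he0 (pow_ne_zero 3 hn0)) ?_ ?_
    · rwa [mul_assoc, norm_mul, he, one_mul]
    · rwa [norm_mul, he, one_mul]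
  exact ((hn.mul (key d hd)).add (hn.mul (key d⁻¹ (by rw [norm_inv, hd, inv_one])))).neg

theorem tendsto_psi1A {τ : ℂ} (hτ : 0 < τ.im) {z ψ : ℂ}
    (h : Tendsto (fun w => traceSum (nome τ) 1 (nome w)) (𝓝[≠] z) (𝓝 ψ)) :
    Tendsto (psi1A τ) (𝓝[≠] z) (𝓝 ψ) := by
  have hev (k : ℕ) (hk : k ≠ 0) := eventually_thetaProd_ne_zero (norm_nome_lt hτ) (nome_ne_zero τ)
    one_ne_zero hk z
  refine h.congr' ?_
  filter_upwards [hev 1 one_ne_zero, hev 3 three_ne_zero] with w h1 h3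
  exact (psi1A_eq hτ (by simpa using h1) h3).symm

theorem tendsto_psi2A {τ : ℂ} (hτ : 0 < τ.im) {z ψ : ℂ}
    (h : Tendsto (fun w => traceSum (nome τ) (-1) (nome w)) (𝓝[≠] z) (𝓝 ψ)) :
    Tendsto (psi2A τ) (𝓝[≠] z) (𝓝 ψ) := by
  have hev (k : ℕ) (hk : k ≠ 0) := eventually_thetaProd_ne_zero (norm_nome_lt hτ) (nome_ne_zero τ)
    (neg_ne_zero.2 one_ne_zero) hk z
  refine h.congr' ?_
  filter_upwards [hev 1 one_ne_zero, hev 3 three_ne_zero] with w h1 h3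
  exact (psi2A_eq hτ (by simpa using h1) h3).symm

theorem tendsto_psi4AB {τ : ℂ} (hτ : 0 < τ.im) {z ψ : ℂ}
    (h : Tendsto (fun w => traceSum (nome τ) I (nome w)) (𝓝[≠] z) (𝓝 ψ)) :
    Tendsto (psi4AB τ) (𝓝[≠] z) (𝓝 ψ) := by
  have hev (k : ℕ) (hk : k ≠ 0) {c : ℂ} (hc : c ≠ 0) :=
    eventually_thetaProd_ne_zero (norm_nome_lt hτ) (nome_ne_zero τ) hc hk z
  have hI := neg_ne_zero.2 I_ne_zero
  refine h.congr' ?_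
  filter_upwards [hev 1 one_ne_zero I_ne_zero, hev 3 three_ne_zero I_ne_zero,
    hev 1 one_ne_zero hI, hev 3 three_ne_zero hI] with w h1 h3 h1' h3'
  exact (psi4AB_eq hτ (by simpa using h1) h3 (by simpa using h1') h3').symm

theorem exists_pow_of_card_eq_four {G : Type*} [Group G] (hcard : Nat.card G = 4) {γ : G}
    (hγ : ∀ g : G, g ∈ Subgroup.zpowers γ) (g : G) : ∃ k < 4, γ ^ k = g := by
  have hord : orderOf γ = 4 := by rw [orderOf_eq_card_of_forall_mem_zpowers hγ, hcard]
  have hfin : IsOfFinOrder γ := orderOf_pos_iff.1 (by omega)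
  obtain ⟨k, rfl⟩ := hfin.mem_powers_iff_mem_zpowers.2 (hγ g)
  exact ⟨k % 4, Nat.mod_lt _ four_pos, by rw [← hord, pow_mod_orderOf]⟩

/-- The trace series of an element of the cyclic group of order 4 converges to `ψ_g`. -/
theorem exists_hasSum_tendsto_psi {G : Type*} [Group G] (hcard : Nat.card G = 4) {γ : G}
    (hγ : ∀ g : G, g ∈ Subgroup.zpowers γ) {ρ : G →* Torus} (hρ : ρ γ = (1, -1, iUnit, iUnit))
    (g : G) {τ z : ℂ} (hz : 0 < -z.im) (hzτ : -z.im < τ.im) :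
    ∃ ψ : ℂ, HasSum (fun p : ℤ × ℕ => psiTildeCoeff (ρ g) p.1 p.2 * nome z ^ p.1 * nome τ ^ p.2) ψ ∧
      Tendsto (fun w => psi g τ w) (𝓝[≠] z) (𝓝 ψ) := by
  have hτ : 0 < τ.im := hz.trans hzτ
  have hq := norm_nome_lt hτ
  have hpi := Real.pi_pos
  have h1 : ‖nome z * nome τ‖ < 1 := by
    rw [norm_mul, norm_nome, norm_nome, ← Real.exp_add, Real.exp_lt_one_iff]
    nlinarith
  have h2 : 1 < ‖nome z‖ := by
    rw [norm_nome, Real.one_lt_exp_iff]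
    nlinarith
  have hord : orderOf γ = 4 := by rw [orderOf_eq_card_of_forall_mem_zpowers hγ, hcard]
  obtain ⟨k, hk, rfl⟩ := exists_pow_of_card_eq_four hcard hγ g
  have hI2 : iUnit ^ 2 = -1 := by ext; simp [iUnit]
  -- Since `-1 = i²`, every group element has the form `(1, d², d, d)` with `d = i^k`, as the
  -- cancellation requires.
  have hρk : ρ (γ ^ k) = (1, (iUnit ^ k) ^ 2, iUnit ^ k, iUnit ^ k) := by
    rw [map_pow, hρ, ← pow_mul, mul_comm, pow_mul, hI2]
    simp
  have hnorm : ‖((iUnit ^ k : ℂˣ) : ℂ)‖ = 1 := by simp [iUnit]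
  have hsum := hasSum_psiTildeCoeff (iUnit ^ k) hq (nome_ne_zero z) hnorm h1 h2
  have hcont := (continuousAt_traceSum hq hnorm h1 h2).tendsto.mono_left
    (nhdsWithin_le_nhds (s := {z}ᶜ))
  have hI : ((iUnit : ℂˣ) : ℂ) = I := rfl
  refine ⟨traceSum (nome τ) ((iUnit ^ k : ℂˣ) : ℂ) (nome z), by rw [hρk]; exact hsum, ?_⟩
  have hne (j : ℕ) (hj : 0 < j) (hj4 : j < 4) : γ ^ j ≠ 1 := fun h =>
    absurd (Nat.le_of_dvd hj (orderOf_dvd_of_pow_eq_one h)) (by omega)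
  rw [Units.val_pow_eq_pow_val, hI] at hcont ⊢
  interval_cases k
  · rw [pow_zero] at hcont
    simpa [psi] using tendsto_psi1A hτ hcont
  · rw [pow_one] at hcont
    have h1' := hne 1 one_pos (by norm_num)
    rw [pow_one] at h1' ⊢
    simpa [psi, h1', hne 2] using tendsto_psi4AB hτ hcont
  · rw [I_sq] at hcont
    have : (γ ^ 2) ^ 2 = 1 := by rw [← pow_mul, ← pow_orderOf_eq_one γ, hord]
    simpa [psi, hne 2, this] using tendsto_psi2A hτ hcont
  · have e : I ^ 3 = I⁻¹ := by rw [I_pow_three, inv_I]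
    have : (γ ^ 3) ^ 2 ≠ 1 := by
      have h4 : γ ^ 4 = 1 := by rw [← hord, pow_orderOf_eq_one]
      rw [← pow_mul, show 3 * 2 = 4 + 2 from rfl, pow_add, h4, one_mul]
      exact hne 2 two_pos (by norm_num)
    simp only [e, traceSum_inv] at hcont ⊢
    simpa [psi, hne 3, this] using tendsto_psi4AB hτ hcont

end Convergence

end Umbral13

end

theorem theorem2 {G : Type*} [Group G] (hcard : Nat.card G = 4)
    (γ : G) (hγ : ∀ g : G, g ∈ Subgroup.zpowers γ)
    (ρ : G →* Umbral13.Torus)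
    (hρ : ρ γ = (1, -1, Umbral13.iUnit, Umbral13.iUnit)) :
    -- the twisted module is bigraded by the eigenvalues of `J(0)` and `L(0)`
    DirectSum.IsInternal (fun p : ℤ × ℕ => Umbral13.piece p.1 p.2) ∧
    (∀ (m : ℤ) (n : ℕ), FiniteDimensional ℂ (Umbral13.piece m n)) ∧
    (∀ n : ℕ, ∃ N : ℤ, ∀ m : ℤ, N < m → Umbral13.piece m n = ⊥) ∧
    -- the operator whose trace is taken preserves the bigrading
    (∀ (g : G) (m : ℤ) (n : ℕ), ∀ x ∈ Umbral13.piece m n,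
      Umbral13.twinedOp (ρ g) x ∈ Umbral13.piece m n) ∧
    -- the trace series converges to the meromorphic function `ψ_g(τ, ·)`
    (∀ (g : G) (τ z : ℂ), 0 < -z.im → -z.im < τ.im →
      ∃ ψ : ℂ,
        HasSum (fun p : ℤ × ℕ => Umbral13.psiTildeCoeff (ρ g) p.1 p.2 *
          Complex.exp (2 * Real.pi * Complex.I * z) ^ p.1 *
          Complex.exp (2 * Real.pi * Complex.I * τ) ^ p.2) ψ ∧
        Filter.Tendsto (fun w => Umbral13.psi g τ w) (nhdsWithin z {z}ᶜ) (nhds ψ)) := by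
  refine ⟨Umbral13.isInternal_piece, Umbral13.finiteDimensional_piece,
    fun n => ⟨1 + 10 * n, fun m hm => Umbral13.piece_eq_bot hm⟩,
    fun g m n => Umbral13.twinedOp_mem_piece (ρ g) m n, fun g τ z hz hzτ => ?_⟩
  exact Umbral13.exists_hasSum_tendsto_psi hcard hγ hρ g hz hzτ
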